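/- Let $GQ(2,1)$ be a generalized quadrangle of order $(2,1)$: a point–line geometry with at least one point and at least one line, in which every line has 3 points, every point lies on 2 lines, two distinct points lie on at most one common line, and for each point $x$ not on a line $\ell$ there is exactly one incident pair $(y,m)$ of a point $y$ and a line $m$ with $x\in m$ and $y\in\ell$. Let $\mathbf B=\{b_0,b_1,b_2\}$ be the set of adjacency matrices of the association scheme of its collinearity graph, where $b_0$ is the identity matrix, $b_1$ is the adjacency matrix of the relation "distinct and collinear", and $b_2$ that of "distinct and non-collinear". For a commutative ring $R$ let $R\mathbf B$ be the $R$-algebra spanned by $\mathbf B$. Then $\mathbf B$ is a $\mathbb Z$-basis of the integral adjacency algebra $\mathbb Z\mathbf B$ (so the rank is 3), and the following hold. 1. For $\mathrm{Re}(s)>1$, Solomon's zeta function $\zeta_{\mathbb Z\mathbf B}(s)=\sum_{N}(\mathbb Z\mathbf B:N)^{-s}$, where $N$ runs over the $\mathbb Z\mathbf B$-submodules of finite index of $\mathbb Z\mathbf B$, converges absolutely and $$\zeta_{\mathbb Z\mathbf B}(s)=\bigl(3^{3-6s}-2\cdot 3^{2-5s}+4\cdot 3^{1-4s}+3^{1-3s}+4\cdot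 3^{-2s}-2\cdot 3^{-s}+1\bigr)\,\zeta_{\mathbb Z}(s)^3,$$ where $\zeta_{\mathbb Z}$ is the Riemann zeta function. 2. The only relevant prime is 3: a prime $p$ divides the discriminant of the maximal order $\Gamma\supseteq\mathbb Z\mathbf B$ of $\mathbb Q\mathbf B$, or the least positive integer $f$ with $f\Gamma\subseteq\mathbb Z\mathbf B$, if and only if $p=3$. 3. Put $e_0=\frac19(b_0+b_1+b_2)$, $e_1=\frac19(4b_0-2b_1+b_2)$, $e_2=\frac19(4b_0+b_1-2b_2)$, and write $\langle\cdot\rangle$ for the $\mathbb Z_3$-span. There are exactly seven isomorphism classes of full $\mathbb Z_3\mathbf B$-lattices in $\mathbb Q_3\mathbf B$, and they are represented by $\langle e_0,e_1,e_2\rangle$, $\langle e_0,e_1+e_2,3e_2\rangle$, $\langle e_0+e_1,3e_1,e_2\rangle$, $\langle e_0+e_2,e_1,3e_2\rangle$, $\langle e_0+e_1+e_2,3e_1,3e_2\rangle$, $\langle e_0+e_1+e_2,3e_1+6e_2,9e_2\rangle=\mathbb Z_3\mathbf B$ and $\langle e_0+2e_2,e_1+2e_2,3e_2\rangle$. The first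 six of these lattices are $\mathbb Z_3$-orders in $\mathbb Q_3\mathbf B$; the last one is not an order. -/

import Mathlib

noncomputable section

/-! ### Association schemes and their adjacency algebras -/

/-- A (symmetric or non-symmetric) association scheme on a finite set `X` with relations indexed
by `ι`.  The relations partition `X × X`; `color x y` is the index of the relation containing
`(x, y)`, and every relation is non-empty. -/
structure AssociationScheme (X ι : Type*) [Fintype X] where
  /-- the index of the relation that contains a given pair -/
  color : X → X → ι
  nonempty_rel : ∀ i, ∃ x y, color x y = i
  /-- the diagonal is one of the relations -/
  exists_diag : ∃ i₀, ∀ x y, color x y = i₀ ↔ x = y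
  /-- the transpose of a relation is a relation -/
  exists_transpose : ∀ i, ∃ j, ∀ x y, color x y = i ↔ color y x = j
  /-- the intersection numbers are well defined -/
  exists_intersectionNumber : ∀ i j k, ∃ p : ℕ, ∀ x y, color x y = k →
    Nat.card {z : X // color x z = i ∧ color z y = j} = p

namespace AssociationScheme

variable {X ι : Type*} [Fintype X] [DecidableEq X] [Fintype ι] [DecidableEq ι]

/-- The adjacency matrix `b_i` of the `i`-th relation, with entries in `K`. -/
def adjMatrix (S : AssociationScheme X ι) (K : Type*) [CommRing K] (i : ι) : Matrix X X K :=
  Matrix.of fun x y => if S.color x y = i then 1 else 0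

theorem one_eq_adjMatrix (S : AssociationScheme X ι) (K : Type*) [CommRing K] :
    ∃ i, (1 : Matrix X X K) = S.adjMatrix K i := by
  obtain ⟨i, hi⟩ := S.exists_diag
  refine ⟨i, ?_⟩
  ext x y
  by_cases h : x = y
  · subst h
    simp [adjMatrix, (hi x x).2 rfl]
  · simp [adjMatrix, h, hi]

theorem adjMatrix_mul (S : AssociationScheme X ι) (K : Type*) [CommRing K] (i j : ι) :
    ∃ p : ι → ℕ, S.adjMatrix K i * S.adjMatrix K j = ∑ k, p k • S.adjMatrix K k := by
  choose p hp using S.exists_intersectionNumber i j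
  refine ⟨p, ?_⟩
  ext x y
  have h := hp _ x y rfl
  rw [Nat.card_eq_fintype_card, Fintype.card_subtype] at h
  simp only [adjMatrix, Matrix.mul_apply, Matrix.of_apply, Matrix.sum_apply, Matrix.smul_apply,
    smul_ite, smul_zero, Finset.sum_ite_eq, Finset.mem_univ, if_true]
  rw [nsmul_eq_mul, mul_one]
  rw [← h]
  rw [Finset.card_filter, Nat.cast_sum]
  refine Finset.sum_congr rfl fun z _ => ?_
  by_cases h1 : S.color x z = i <;> by_cases h2 : S.color z y = j <;> simp [h1, h2]

/-- The adjacency algebra `R𝐁`, realised inside the matrices over an `R`-algebra `K`: its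
underlying module is the `R`-span of the set `𝐁` of adjacency matrices.  With `R = ℤ`, `K = ℚ`
this is the integral adjacency algebra `ℤ𝐁`; with `R = K = ℚ` it is `ℚ𝐁`; with `R = ℤ_p`,
`K = ℚ_p` it is `ℤ_p 𝐁`. -/
def adjacencyAlgebra (S : AssociationScheme X ι) (R K : Type*) [CommRing R] [CommRing K]
    [Algebra R K] : Subalgebra R (Matrix X X K) :=
  (Submodule.span R (Set.range (S.adjMatrix K))).toSubalgebra
    (by
      obtain ⟨i, hi⟩ := S.one_eq_adjMatrix K
      rw [hi]
      exact Submodule.subset_span ⟨i, rfl⟩)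
    (by
      intro x y hx hy
      have key := Submodule.mul_mem_mul hx hy
      rw [Submodule.span_mul_span] at key
      refine Submodule.span_le.2 ?_ key
      rintro _ ⟨_, ⟨i, rfl⟩, _, ⟨j, rfl⟩, rfl⟩
      obtain ⟨p, hp⟩ := S.adjMatrix_mul K i j
      change S.adjMatrix K i * S.adjMatrix K j ∈ Submodule.span R (Set.range (S.adjMatrix K))
      rw [hp]
      exact Submodule.sum_mem _ fun k _ =>
        nsmul_mem (Submodule.subset_span (Set.mem_range_self k)) _)

end AssociationScheme

/-! ### The association scheme of a strongly regular graph -/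

namespace SimpleGraph

variable {V : Type*}

open Classical in
/-- `0` on the diagonal, `1` on adjacent pairs, `2` on distinct non-adjacent pairs. -/
def pairColor (G : SimpleGraph V) (x y : V) : Fin 3 :=
  if x = y then 0 else if G.Adj x y then 1 else 2

theorem pairColor_comm (G : SimpleGraph V) (x y : V) : G.pairColor x y = G.pairColor y x := by
  unfold pairColor
  by_cases e : x = y
  · simp [e]
  · by_cases a : G.Adj x y
    · simp [e, Ne.symm e, a, a.symm]
    · have a' : ¬ G.Adj y x := fun h => a h.symm
      simp [e, Ne.symm e, a, a']

variable [Fintype V] [DecidableEq V]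

open Classical in
theorem IsSRGWith.exists_mul_eq {G : SimpleGraph V} {n k l m : ℕ}
    (h : G.IsSRGWith n k l m) (i j : Fin 3) :
    ∃ f : Fin 3 → ℤ, ∀ x y,
      ((Matrix.of fun x y => if G.pairColor x y = i then (1 : ℤ) else 0) *
        (Matrix.of fun x y => if G.pairColor x y = j then (1 : ℤ) else 0) : Matrix V V ℤ) x y =
      f (G.pairColor x y) := by
  set W : Submodule ℤ (Matrix V V ℤ) :=
    { carrier := {M | ∃ f : Fin 3 → ℤ, ∀ x y, M x y = f (G.pairColor x y)}
      zero_mem' := ⟨0, by simp⟩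
      add_mem' := by
        rintro a b ⟨f, hf⟩ ⟨g, hg⟩
        exact ⟨f + g, fun x y => by simp [hf, hg]⟩
      smul_mem' := by
        rintro c a ⟨f, hf⟩
        exact ⟨c • f, fun x y => by simp [hf]⟩ } with hW
  set J : Matrix V V ℤ := Matrix.of fun _ _ => 1 with hJ
  set A : Matrix V V ℤ := G.adjMatrix ℤ with hA
  have b0 : (Matrix.of fun x y => if G.pairColor x y = 0 then (1 : ℤ) else 0) = 1 := by
    ext x y
    by_cases e : x = y
    · subst e; simp [pairColor]
    · by_cases a : G.Adj x y <;> simp [pairColor, e, a]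
  have b1 : (Matrix.of fun x y => if G.pairColor x y = 1 then (1 : ℤ) else 0) = A := by
    ext x y
    by_cases e : x = y
    · subst e; simp [pairColor, hA]
    · by_cases a : G.Adj x y <;> simp [pairColor, e, a, hA]
  have b2 : (Matrix.of fun x y => if G.pairColor x y = 2 then (1 : ℤ) else 0) = J - 1 - A := by
    ext x y
    by_cases e : x = y
    · subst e; simp [pairColor, hA, hJ]
    · by_cases a : G.Adj x y <;> simp [pairColor, e, a, hA, hJ]
  have w1 : (1 : Matrix V V ℤ) ∈ W := ⟨fun c => if c = 0 then 1 else 0, fun x y => by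
    rw [← b0]; rfl⟩
  have wA : A ∈ W := ⟨fun c => if c = 1 then 1 else 0, fun x y => by rw [← b1]; rfl⟩
  have wJ : J ∈ W := ⟨fun _ => 1, fun x y => rfl⟩
  have wC : Gᶜ.adjMatrix ℤ ∈ W := by
    have : Gᶜ.adjMatrix ℤ = J - 1 - A := by
      ext x y
      by_cases e : x = y
      · subst e; simp [hA, hJ]
      · by_cases a : G.Adj x y <;> simp [e, a, hA, hJ]
    rw [this]
    exact W.sub_mem (W.sub_mem wJ w1) wA
  have wAA : A * A ∈ W := by
    rw [← pow_two, hA, h.matrix_eq]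
    exact W.add_mem (W.add_mem (nsmul_mem w1 _) (nsmul_mem wA _)) (nsmul_mem wC _)
  have wAJ : A * J ∈ W := by
    refine ⟨fun _ => k, fun x y => ?_⟩
    simp [hA, hJ, Matrix.mul_apply, adjMatrix_apply, Finset.sum_boole, ← h.regular x,
      ← card_neighborFinset_eq_degree, neighborFinset_eq_filter]
  have wJA : J * A ∈ W := by
    refine ⟨fun _ => k, fun x y => ?_⟩
    simp [hA, hJ, Matrix.mul_apply, adjMatrix_apply, Finset.sum_boole, ← h.regular y,
      ← card_neighborFinset_eq_degree, neighborFinset_eq_filter, G.adj_comm]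
  have wJJ : J * J ∈ W := ⟨fun _ => Fintype.card V, fun x y => by
    simp [hJ, Matrix.mul_apply]⟩
  have w2 : J - 1 - A ∈ W := W.sub_mem (W.sub_mem wJ w1) wA
  have wA2 : A * (J - 1 - A) ∈ W := by
    rw [mul_sub, mul_sub, mul_one]
    exact W.sub_mem (W.sub_mem wAJ wA) wAA
  have w2A : (J - 1 - A) * A ∈ W := by
    rw [sub_mul, sub_mul, one_mul]
    exact W.sub_mem (W.sub_mem wJA wA) wAA
  have wJ2 : J * (J - 1 - A) ∈ W := by
    rw [mul_sub, mul_sub, mul_one]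
    exact W.sub_mem (W.sub_mem wJJ wJ) wJA
  have w22 : (J - 1 - A) * (J - 1 - A) ∈ W := by
    rw [sub_mul, sub_mul, one_mul]
    exact W.sub_mem (W.sub_mem wJ2 w2) wA2
  change _ ∈ W
  fin_cases i <;> fin_cases j <;> simp only [Fin.zero_eta, Fin.mk_one, Fin.reduceFinMk] <;>
    simp only [b0, b1, b2, one_mul, mul_one] <;> assumption

open Classical in
/-- The rank 3 association scheme of a strongly regular graph that is neither complete nor
edgeless: its relations are equality, adjacency, and non-adjacency of distinct vertices. -/
def IsSRGWith.associationScheme {G : SimpleGraph V} {n k l m : ℕ} (h : G.IsSRGWith n k l m)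
    (hadj : ∃ x y, G.Adj x y) (hnadj : ∃ x y, x ≠ y ∧ ¬ G.Adj x y) :
    AssociationScheme V (Fin 3) where
  color := G.pairColor
  nonempty_rel i := by
    obtain ⟨x, y, a⟩ := hadj
    obtain ⟨z, w, e, b⟩ := hnadj
    fin_cases i
    · exact ⟨x, x, by simp [pairColor]⟩
    · exact ⟨x, y, by simp [pairColor, a.ne, a]⟩
    · exact ⟨z, w, by simp [pairColor, e, b]⟩
  exists_diag := ⟨0, fun x y => by
    by_cases e : x = y
    · simp [pairColor, e]
    · by_cases a : G.Adj x y <;> simp [pairColor, e, a]⟩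
  exists_transpose i := ⟨i, fun x y => by rw [G.pairColor_comm]⟩
  exists_intersectionNumber i j c := by
    obtain ⟨f, hf⟩ := h.exists_mul_eq i j
    refine ⟨(f c).toNat, fun x y hxy => ?_⟩
    have h1 := hf x y
    rw [hxy] at h1
    rw [← h1, Nat.card_eq_fintype_card, Fintype.card_subtype, Finset.card_filter,
      Matrix.mul_apply]
    simp only [Matrix.of_apply]
    rw [← Int.toNat_natCast (Finset.sum _ _), Nat.cast_sum]
    congr 1
    refine Finset.sum_congr rfl fun z _ => ?_
    by_cases h1 : G.pairColor x z = i <;> by_cases h2 : G.pairColor z y = j <;> simp [h1, h2]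

end SimpleGraph

/-! ### Generalized quadrangles -/

/-- A point–line geometry with incidence relation `I` is a generalized quadrangle of order
`(s, t)`, i.e. a `GQ(s, t)`. -/
structure IsGeneralizedQuadrangle {P L : Type*} (I : P → L → Prop) (s t : ℕ) : Prop where
  one_le_s : 1 ≤ s
  one_le_t : 1 ≤ t
  nonempty_points : Nonempty P
  nonempty_lines : Nonempty L
  /-- each line is incident with `s + 1` points -/
  ncard_points : ∀ l, {x | I x l}.ncard = s + 1
  /-- each point is incident with `t + 1` lines -/
  ncard_lines : ∀ x, {l | I x l}.ncard = t + 1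
  /-- two distinct points are incident with at most one common line -/
  line_unique : ∀ x y l m, x ≠ y → I x l → I y l → I x m → I y m → l = m
  /-- for a point `x` not on a line `l` there is exactly one incident pair `(y, m)` such that
  `m` passes through `x` and `y` lies on `l` -/
  projection : ∀ x l, ¬ I x l → ∃! q : P × L, I x q.2 ∧ I q.1 q.2 ∧ I q.1 l

/-- The collinearity graph of a point–line geometry. -/
def collinearityGraph {P L : Type*} (I : P → L → Prop) : SimpleGraph P where
  Adj x y := x ≠ y ∧ ∃ l, I x l ∧ I y l
  symm := ⟨fun _ _ h => ⟨h.1.symm, h.2.imp fun _ hl => hl.symm⟩⟩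
  loopless := ⟨fun _ h => h.1 rfl⟩

theorem collinearityGraph_adj {P L : Type*} {I : P → L → Prop} {x y : P} :
    (collinearityGraph I).Adj x y ↔ x ≠ y ∧ ∃ l, I x l ∧ I y l := Iff.rfl

namespace IsGeneralizedQuadrangle

variable {P L : Type*} {I : P → L → Prop} {s t : ℕ}

theorem mem_of_adj (h : IsGeneralizedQuadrangle I s t) {x y z : P} {l : L} (hxy : x ≠ y)
    (hx : I x l) (hy : I y l) (hzx : ∃ m, I z m ∧ I x m) (hzy : ∃ m, I z m ∧ I y m) : I z l := by
  by_contra hz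
  obtain ⟨m, m1, m2⟩ := hzx
  obtain ⟨m', m1', m2'⟩ := hzy
  have := (h.projection z l hz).unique (y₁ := (x, m)) (y₂ := (y, m')) ⟨m1, m2, hx⟩ ⟨m1', m2', hy⟩
  exact hxy (congrArg Prod.fst this)

theorem finite_lines (h : IsGeneralizedQuadrangle I s t) (x : P) : {l | I x l}.Finite :=
  Set.finite_of_ncard_ne_zero (by rw [h.ncard_lines]; omega)

theorem exists_ne_mem (h : IsGeneralizedQuadrangle I s t) (x : P) (l : L) :
    ∃ y, y ≠ x ∧ I y l := by
  have h1 : 1 < {y | I y l}.ncard := by have := h.one_le_s; rw [h.ncard_points]; omega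
  obtain ⟨y, hy, n⟩ := Set.exists_ne_of_one_lt_ncard h1 x
  exact ⟨y, n, hy⟩

theorem exists_adj (h : IsGeneralizedQuadrangle I s t) : ∃ x y, (collinearityGraph I).Adj x y := by
  obtain ⟨l⟩ := h.nonempty_lines
  obtain ⟨x₀⟩ := h.nonempty_points
  obtain ⟨x, _, hx⟩ := h.exists_ne_mem x₀ l
  obtain ⟨y, n, hy⟩ := h.exists_ne_mem x l
  exact ⟨x, y, n.symm, l, hx, hy⟩

theorem exists_not_adj (h : IsGeneralizedQuadrangle I s t) :
    ∃ x y, x ≠ y ∧ ¬ (collinearityGraph I).Adj x y := by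
  obtain ⟨x⟩ := h.nonempty_points
  have h1 : 1 < {l | I x l}.ncard := by have := h.one_le_t; rw [h.ncard_lines]; omega
  obtain ⟨l, hl, m, hm, hlm⟩ := (Set.one_lt_ncard (h.finite_lines x)).1 h1
  obtain ⟨y, hyx, hy⟩ := h.exists_ne_mem x l
  obtain ⟨z, hzx, hz⟩ := h.exists_ne_mem x m
  have hym : ¬ I y m := fun a => hlm (h.line_unique x y l m hyx.symm hl hy hm a)
  refine ⟨y, z, ?_, ?_⟩
  · rintro rfl
    exact hym hz
  · rintro ⟨n, k, a, b⟩
    exact hym (h.mem_of_adj hzx.symm hm hz ⟨l, hy, hl⟩ ⟨k, a, b⟩)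

variable [Fintype P]

open Classical in
theorem card_points (h : IsGeneralizedQuadrangle I s t) (l : L) :
    (Finset.univ.filter (I · l)).card = s + 1 := by
  rw [← h.ncard_points l, ← Set.ncard_coe_finset]
  simp

open Classical in
theorem isSRGWith [DecidableEq P] (h : IsGeneralizedQuadrangle I s t) :
    (collinearityGraph I).IsSRGWith (Fintype.card P) ((t + 1) * s) (s - 1) (t + 1) where
  card := rfl
  regular x := by
    rw [← SimpleGraph.card_neighborFinset_eq_degree]
    have e : (collinearityGraph I).neighborFinset x =
        (h.finite_lines x).toFinset.biUnion fun l => (Finset.univ.filter (I · l)).erase x := by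
      ext y
      simp only [SimpleGraph.mem_neighborFinset, collinearityGraph_adj, Finset.mem_biUnion,
        Set.Finite.mem_toFinset, Set.mem_ofPred_eq, Finset.mem_erase, Finset.mem_filter,
        Finset.mem_univ, true_and]
      constructor
      · rintro ⟨n, l, a, b⟩
        exact ⟨l, a, n.symm, b⟩
      · rintro ⟨l, a, n, b⟩
        exact ⟨n.symm, l, a, b⟩
    rw [e, Finset.card_biUnion]
    · rw [Finset.sum_congr rfl (g := fun _ => s), Finset.sum_const, smul_eq_mul,
        ← Set.ncard_eq_toFinset_card _ (h.finite_lines x), h.ncard_lines]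
      intro l hl
      rw [Finset.card_erase_of_mem (by simpa using hl), h.card_points, Nat.add_sub_cancel]
    · intro l hl m hm hlm
      rw [Function.onFun, Finset.disjoint_left]
      intro y hy hy'
      simp only [Set.Finite.coe_toFinset, Set.Finite.mem_toFinset, Set.mem_ofPred_eq,
        Finset.mem_erase, Finset.mem_filter, Finset.mem_univ, true_and] at hl hm hy hy'
      exact hlm (h.line_unique x y l m hy.1.symm hl hy.2 hm hy'.2)
  of_adj x y hxy := by
    obtain ⟨n, l, hx, hy⟩ := hxy
    rw [← Set.toFinset_card]
    have e : ((collinearityGraph I).commonNeighbors x y).toFinset =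
        ((Finset.univ.filter (I · l)).erase x).erase y := by
      ext z
      simp only [SimpleGraph.mem_commonNeighbors, collinearityGraph_adj, Set.mem_toFinset,
        Finset.mem_erase, Finset.mem_filter, Finset.mem_univ, true_and]
      constructor
      · rintro ⟨⟨a, m, b, c⟩, a', m', b', c'⟩
        exact ⟨a'.symm, a.symm, h.mem_of_adj n hx hy ⟨m, c, b⟩ ⟨m', c', b'⟩⟩
      · rintro ⟨a, b, c⟩
        exact ⟨⟨Ne.symm b, l, hx, c⟩, Ne.symm a, l, hy, c⟩
    rw [e, Finset.card_erase_of_mem (by simp [n.symm, hy]),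
      Finset.card_erase_of_mem (by simp [hx]), h.card_points, Nat.add_sub_cancel]
  of_not_adj x y n hxy := by
    rw [← Set.toFinset_card, ← h.ncard_lines x, Set.ncard_eq_toFinset_card _ (h.finite_lines x)]
    have hy : ∀ l, I x l → ¬ I y l := fun l a b => hxy ⟨n, l, a, b⟩
    symm
    refine Finset.card_bij
      (fun l hl => (h.projection y l (hy l (by simpa using hl))).choose.1) ?_ ?_ ?_
    · intro l hl
      have hl' : I x l := by simpa using hl
      obtain ⟨a, b, c⟩ := (h.projection y l (hy l hl')).choose_spec.1
      simp only [SimpleGraph.mem_commonNeighbors, collinearityGraph_adj, Set.mem_toFinset]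
      refine ⟨⟨?_, l, hl', c⟩, ?_, _, a, b⟩
      · intro e
        rw [← e] at b
        exact hy _ b a
      · intro e
        rw [← e] at c
        exact hy l hl' c
    · intro l hl m hm e
      have hl' : I x l := by simpa using hl
      have hm' : I x m := by simpa using hm
      obtain ⟨a, b, c⟩ := (h.projection y l (hy l hl')).choose_spec.1
      obtain ⟨a', b', c'⟩ := (h.projection y m (hy m hm')).choose_spec.1
      have e' : (h.projection y l (hy l hl')).choose.1 =
        (h.projection y m (hy m hm')).choose.1 := e
      rw [← e'] at c'
      refine h.line_unique x _ l m ?_ hl' c hm' c'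
      intro e
      rw [← e] at b
      exact hy _ b a
    · intro z hz
      simp only [SimpleGraph.mem_commonNeighbors, collinearityGraph_adj, Set.mem_toFinset] at hz
      obtain ⟨⟨a, l, b, c⟩, a', m, b', c'⟩ := hz
      refine ⟨l, by simpa using b, ?_⟩
      have := (h.projection y l (hy l b)).unique (y₂ := (z, m))
        (h.projection y l (hy l b)).choose_spec.1 ⟨b', c', c⟩
      exact congrArg Prod.fst this

/-- The association scheme of (the collinearity graph of) a generalized quadrangle. -/
def associationScheme [DecidableEq P] (h : IsGeneralizedQuadrangle I s t) : AssociationScheme P (Fin 3) :=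
  h.isSRGWith.associationScheme h.exists_adj h.exists_not_adj

end IsGeneralizedQuadrangle

/-! ### Solomon's zeta function -/

/-- The term `(L : N)^{-s}` of Solomon's zeta function for a `Λ`-submodule `N` of finite index
in `L`. -/
def solomonTerm (Λ L : Type*) [Ring Λ] [AddCommGroup L] [Module Λ L] (s : ℂ)
    (N : {N : Submodule Λ L // N.toAddSubgroup.FiniteIndex}) : ℂ :=
  (N.1.toAddSubgroup.index : ℂ) ^ (-s)

/-- Solomon's zeta function `ζ_Λ(L; s) = ∑ (L : N)^{-s}`, where `N` runs over the
`Λ`-submodules of finite index (the full sublattices) of the `Λ`-lattice `L`. -/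
def solomonZeta (Λ L : Type*) [Ring Λ] [AddCommGroup L] [Module Λ L] (s : ℂ) : ℂ :=
  ∑' N, solomonTerm Λ L s N

/-! ### Orders, relevant primes and lattices

Throughout, `R` is a subring of a field `K` (`ℤ ⊆ ℚ` or `ℤ_p ⊆ ℚ_p`), `M` is an ambient
`K`-algebra and `A` is a `K`-subalgebra of `M`. -/

section Orders

variable (R : Type*) {K M : Type*} [CommRing R] [Field K] [Algebra R K] [Ring M] [Algebra R M]
  [Algebra K M] [IsScalarTower R K M]

/-- `Γ` is an `R`-order in the `K`-algebra `A`: a subring which is finitely generated as an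
`R`-module and spans `A` over `K`. -/
structure IsOrderIn (A : Subalgebra K M) (Γ : Subalgebra R M) : Prop where
  fg : (Subalgebra.toSubmodule Γ).FG
  span_eq : Submodule.span K (Γ : Set M) = Subalgebra.toSubmodule A

variable {R}

/-- `N` is a full `Λ`-lattice in `A`: a `Λ`-submodule which is finitely generated over `R` and
spans `A` over `K`. -/
structure IsFullLattice (A : Subalgebra K M) (Λ : Subalgebra R M) (N : Submodule Λ M) :
    Prop where
  fg : (N.restrictScalars R).FG
  span_eq : Submodule.span K (N : Set M) = Subalgebra.toSubmodule A

end Orders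

section Relevant

variable {M : Type*} [Ring M] [Algebra ℚ M]

/-- `d` is the discriminant of the `ℤ`-order `Γ` in a commutative algebra: the determinant of the
trace form `(x, y) ↦ Tr(xy)` in a `ℤ`-basis of `Γ`. -/
def IsOrderDiscriminant (Γ : Subalgebra ℤ M) (d : ℤ) : Prop :=
  ∃ (n : ℕ) (b : Module.Basis (Fin n) ℤ Γ),
    d = (Matrix.of fun i j => LinearMap.trace ℤ Γ (LinearMap.mulLeft ℤ (b i * b j))).det

/-- `f` is the least positive integer with `f Γ ⊆ Λ`. -/
def IsLeastMultiplier (Γ Λ : Subalgebra ℤ M) (f : ℕ) : Prop :=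
  IsLeast {f : ℕ | 0 < f ∧ ∀ x ∈ Γ, f • x ∈ Λ} f

/-- The prime `p` is relevant for the `ℤ`-order `Λ` in the commutative `ℚ`-algebra `A`: for a
maximal order `Γ ⊇ Λ` of `A`, it divides the discriminant of `Γ` or the least positive integer
`f` with `f Γ ⊆ Λ`. -/
def IsRelevantPrime (A : Subalgebra ℚ M) (Λ : Subalgebra ℤ M) (p : ℕ) : Prop :=
  p.Prime ∧ ∃ Γ : Subalgebra ℤ M, Maximal (IsOrderIn ℤ A) Γ ∧ Λ ≤ Γ ∧
    ((∃ d, IsOrderDiscriminant Γ d ∧ (p : ℤ) ∣ d) ∨ ∃ f, IsLeastMultiplier Γ Λ f ∧ p ∣ f)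

end Relevant

/-! ### The seven lattices -/

section Lattices

variable {X : Type*} [Fintype X] [DecidableEq X]

/-- The idempotents `e₀ = (b₀ + b₁ + b₂)/9`, `e₁ = (4b₀ - 2b₁ + b₂)/9` and
`e₂ = (4b₀ + b₁ - 2b₂)/9`. -/
def gqIdempotent (S : AssociationScheme X (Fin 3)) (K : Type*) [Field K] (i : Fin 3) :
    Matrix X X K :=
  (9 : K)⁻¹ • ((![1, 4, 4] i : K) • S.adjMatrix K 0 + (![1, -2, 1] i : K) • S.adjMatrix K 1 +
    (![1, 1, -2] i : K) • S.adjMatrix K 2)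

/-- Bases of seven lattices, in terms of `e₀, e₁, e₂`. -/
def gqLatticeBasis {M : Type*} [Ring M] (e : Fin 3 → M) : Fin 7 → Fin 3 → M :=
  ![![e 0, e 1, e 2],
    ![e 0, e 1 + e 2, 3 * e 2],
    ![e 0 + e 1, 3 * e 1, e 2],
    ![e 0 + e 2, e 1, 3 * e 2],
    ![e 0 + e 1 + e 2, 3 * e 1, 3 * e 2],
    ![e 0 + e 1 + e 2, 3 * e 1 + 6 * e 2, 9 * e 2],
    ![e 0 + 2 * e 2, e 1 + 2 * e 2, 3 * e 2]]

end Lattices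

end

noncomputable section

/-! ### Congruence lattices in `R × R × R` -/

/-! The collinearity graph is strongly regular with parameters (9, 4, 1, 2). This fixes all products
of the adjacency matrices and makes e₀, e₁, e₂ orthogonal idempotents with sum 1. In their
coordinates ℚ𝐁 is ℚ³, and ℤ𝐁 is the order O of all (x, y, z) with 3 ∣ y − x and 9 ∣ x − 2y + z
(`mem_gq_adjacencyAlgebra_iff`). O has basis (1,1,1), (0,3,6), (0,0,9) and index 27 in ℤ³. It
contains 9ℤ³, so only the prime 3 matters, and only modulo 9.

Lattices: scale a full lattice stable under O so that its coordinates are integral and none is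
divisible by 3 on the whole of it. Some single vector then has all coordinates prime to 3
(`exists_not_three_dvd_of_forall_coord`); after division by that vector the lattice contains 1,
hence O. If it contains (0,0,3), it corresponds to one of the six subspaces of 𝔽₃²; otherwise it is
O (`exists_gqLattice_eq_of_one_mem`). Homomorphisms between such lattices are multiplications. Six
of the seven are rings closed under inverses of units, so a unit that scales one type to another
forces equality (`eq_of_unit_mul_mem_gqLattice_iff`).

Zeta function: an ideal of finite index is uniquely (a, b, c)·S, where a, b, c > 0 generate its
coordinate projections and S is a stable lattice that projects onto ℤ in each coordinate. There are
exactly 27 such S (`exists_eq_stableLattice`, `stableLattice_injective`). The ideal has index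
abc·3^d/27, with 3^d the index of S. Whether (a, b, c)·S lies in O depends only on the 3-adic
valuations of a, b, c cut off at 2, and the admissible S are counted by `card_stableLattice_colon`.
The series thus becomes a finite combination of products of three one-variable series, each a
polynomial in 3^(-s) times ζ(s); `sum_colonCount_valFactor` adds them up.

Relevant primes: elements of an order are integral, so ℤ³ is the unique maximal order. Its
discriminant is 1, and the least multiplier into O is 9. -/

/-- The triples `(x, y, z)` with `c ∣ αx + βy + γz`. -/
def congruenceLattice {R : Type*} [CommRing R] (c α β γ : R) : Submodule R (R × R × R) where
  carrier := {v | c ∣ α * v.1 + β * v.2.1 + γ * v.2.2}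
  zero_mem' := by simp
  add_mem' := by
    intro v w hv hw
    have := dvd_add hv hw
    simp only [Set.mem_ofPred_eq, Prod.fst_add, Prod.snd_add]
    convert this using 1
    ring
  smul_mem' := by
    intro r v hv
    have := Dvd.dvd.mul_left hv r
    simp only [Set.mem_ofPred_eq, Prod.smul_fst, Prod.smul_snd, smul_eq_mul]
    convert this using 1
    ring

theorem mem_congruenceLattice {R : Type*} [CommRing R] {c α β γ x y z : R} :
    (x, y, z) ∈ congruenceLattice c α β γ ↔ c ∣ α * x + β * y + γ * z := Iff.rfl

/-- The coordinate forms of the seven lattices with respect to `e₀, e₁, e₂`. -/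
def gqLattice (R : Type*) [CommRing R] : Fin 7 → Submodule R (R × R × R) :=
  ![⊤,
    congruenceLattice 3 0 (-1) 1,
    congruenceLattice 3 (-1) 1 0,
    congruenceLattice 3 (-1) 0 1,
    congruenceLattice 3 (-1) 1 0 ⊓ congruenceLattice 3 (-1) 0 1,
    congruenceLattice 3 (-1) 1 0 ⊓ congruenceLattice 9 1 (-2) 1,
    congruenceLattice 3 1 1 1]

/-! ### Membership in the seven lattices as explicit congruences. -/

section Membership

variable {R : Type*} [CommRing R] {x y z : R}

theorem mem_gqLattice_zero : (x, y, z) ∈ gqLattice R 0 ↔ True := by simp [gqLattice]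

theorem mem_gqLattice_one : (x, y, z) ∈ gqLattice R 1 ↔ 3 ∣ z - y := by
  simp [gqLattice, mem_congruenceLattice, neg_add_eq_sub]

theorem mem_gqLattice_two : (x, y, z) ∈ gqLattice R 2 ↔ 3 ∣ y - x := by
  simp [gqLattice, mem_congruenceLattice, neg_add_eq_sub]

theorem mem_gqLattice_three : (x, y, z) ∈ gqLattice R 3 ↔ 3 ∣ z - x := by
  simp [gqLattice, mem_congruenceLattice, neg_add_eq_sub]

theorem mem_gqLattice_four : (x, y, z) ∈ gqLattice R 4 ↔ 3 ∣ y - x ∧ 3 ∣ z - x := by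
  simp [gqLattice, mem_congruenceLattice, neg_add_eq_sub]

theorem mem_gqLattice_five : (x, y, z) ∈ gqLattice R 5 ↔ 3 ∣ y - x ∧ 9 ∣ x - 2 * y + z := by
  simp [gqLattice, mem_congruenceLattice, neg_add_eq_sub, sub_eq_add_neg]

theorem mem_gqLattice_six : (x, y, z) ∈ gqLattice R 6 ↔ 3 ∣ x + y + z := by
  simp [gqLattice, mem_congruenceLattice]

end Membership

/-! ### Classification of stable lattices up to units. -/

section Classification

variable {R : Type*} [CommRing R]

/-- Subtracting x(1,1,1) and multiples of (0,3,0) and (0,0,3) leaves only the classes of y − x and z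
− x modulo 3. -/
theorem mem_iff_of_three_dvd {N : Submodule R (R × R × R)}
    (h1 : (1, 1, 1) ∈ N) (hy : (0, 3, 0) ∈ N) (hz : (0, 0, 3) ∈ N) {x y z : R} (a b : R)
    (ha : 3 ∣ y - x - a) (hb : 3 ∣ z - x - b) : (x, y, z) ∈ N ↔ (0, a, b) ∈ N := by
  obtain ⟨m, hm⟩ := ha
  obtain ⟨n, hn⟩ := hb
  have e : (x, y, z) = x • (1, 1, 1) + m • (0, 3, 0) + n • (0, 0, 3) + (0, a, b) := by
    ext <;> simp
    · linear_combination hm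
    · linear_combination hn
  rw [e, N.add_mem_iff_right]
  exact N.add_mem (N.add_mem (N.smul_mem _ h1) (N.smul_mem _ hy)) (N.smul_mem _ hz)

/-- The pair (y − x, z − x) has nine possible residues in 𝔽₃². Up to sign these are 0 and four
directions, so four comparisons suffice. -/
theorem eq_of_mem_iff_of_three_mem (htri : ∀ x : R, 3 ∣ x ∨ 3 ∣ x - 1 ∨ 3 ∣ x + 1)
    {N M : Submodule R (R × R × R)}
    (h1 : (1, 1, 1) ∈ N) (hy : (0, 3, 0) ∈ N) (hz : (0, 0, 3) ∈ N)
    (h1' : (1, 1, 1) ∈ M) (hy' : (0, 3, 0) ∈ M) (hz' : (0, 0, 3) ∈ M)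
    (hA : (0, 1, 0) ∈ N ↔ (0, 1, 0) ∈ M) (hB : (0, 0, 1) ∈ N ↔ (0, 0, 1) ∈ M)
    (hC : (0, 1, 1) ∈ N ↔ (0, 1, 1) ∈ M) (hD : (0, 1, -1) ∈ N ↔ (0, 1, -1) ∈ M) : N = M := by
  have neg : ∀ (K : Submodule R (R × R × R)) (a b : R), (0, a, b) ∈ K ↔ (0, -a, -b) ∈ K := by
    intro K a b
    rw [← K.neg_mem_iff]
    simp
  have key : ∀ x y z a b : R, 3 ∣ y - x - a → 3 ∣ z - x - b →
      ((0, a, b) ∈ N ↔ (0, a, b) ∈ M) → ((x, y, z) ∈ N ↔ (x, y, z) ∈ M) :=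
    fun x y z a b ha hb h => by
      rw [mem_iff_of_three_dvd h1 hy hz a b ha hb, mem_iff_of_three_dvd h1' hy' hz' a b ha hb, h]
  ext ⟨x, y, z⟩
  rcases htri (y - x) with ha | ha | ha <;> rcases htri (z - x) with hb | hb | hb
  · exact key x y z 0 0 (by simpa using ha) (by simpa using hb)
      (iff_of_true N.zero_mem M.zero_mem)
  · exact key x y z 0 1 (by simpa using ha) (by simpa using hb) hB
  · exact key x y z 0 (-1) (by simpa using ha) (by simpa using hb)
      (by rw [neg N, neg M]; simpa using hB)
  · exact key x y z 1 0 (by simpa using ha) (by simpa using hb) hA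
  · exact key x y z 1 1 (by simpa using ha) (by simpa using hb) hC
  · exact key x y z 1 (-1) (by simpa using ha) (by simpa using hb) hD
  · exact key x y z (-1) 0 (by simpa using ha) (by simpa using hb)
      (by rw [neg N, neg M]; simpa using hA)
  · exact key x y z (-1) 1 (by simpa using ha) (by simpa using hb)
      (by rw [neg N, neg M]; simpa using hD)
  · exact key x y z (-1) (-1) (by simpa using ha) (by simpa using hb)
      (by rw [neg N, neg M]; simpa using hC)

/-- Any two of the four directions of 𝔽₃² span the plane. So N contains none, exactly one or all of
them, which gives 1 + 4 + 1 lattices. -/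
theorem exists_gqLattice_eq_of_three_mem (h3 : ¬ (3 : R) ∣ 1)
    (htri : ∀ x : R, 3 ∣ x ∨ 3 ∣ x - 1 ∨ 3 ∣ x + 1) (N : Submodule R (R × R × R))
    (h1 : (1, 1, 1) ∈ N) (hy : (0, 3, 0) ∈ N) (hz : (0, 0, 3) ∈ N) :
    ∃ i, N = gqLattice R i := by
  have h3' : ¬ (3 : R) ∣ 1 + 1 := fun h => h3 (by
    have := dvd_sub (dvd_refl (3 : R)) h
    norm_num at this
    exact this)
  have h3'' : ¬ (3 : R) ∣ -1 - 1 := fun h => h3' (by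
    rw [← dvd_neg]
    convert h using 1
    ring)
  have h111 : (3 : R) ∣ 1 + 1 + 1 := ⟨1, by norm_num⟩
  have AB : (0, 1, 0) ∈ N → (0, 0, 1) ∈ N → (0, 1, 1) ∈ N ∧ (0, 1, -1) ∈ N := fun a b =>
    ⟨by simpa using N.add_mem a b, by simpa using N.sub_mem a b⟩
  have AC : (0, 1, 0) ∈ N → (0, 1, 1) ∈ N → (0, 0, 1) ∈ N := fun a b => by
    simpa using N.sub_mem b a
  have AD : (0, 1, 0) ∈ N → (0, 1, -1) ∈ N → (0, 0, 1) ∈ N := fun a b => by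
    simpa using N.sub_mem a b
  have BC : (0, 0, 1) ∈ N → (0, 1, 1) ∈ N → (0, 1, 0) ∈ N := fun a b => by
    simpa using N.sub_mem b a
  have BD : (0, 0, 1) ∈ N → (0, 1, -1) ∈ N → (0, 1, 0) ∈ N := fun a b => by
    simpa using N.add_mem b a
  have CD : (0, 1, 1) ∈ N → (0, 1, -1) ∈ N → (0, 1, 0) ∈ N := fun a b => by
    have h := N.sub_mem hy (N.add_mem a b)
    convert h using 1
    ext <;> simp
    norm_num
  by_cases A : (0, 1, 0) ∈ N
  · by_cases B : (0, 0, 1) ∈ N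
    · refine ⟨0, eq_of_mem_iff_of_three_mem htri h1 hy hz ?_ ?_ ?_ ?_ ?_ ?_ ?_⟩ <;>
        simp [mem_gqLattice_zero, A, B, AB]
    · have C : (0, 1, 1) ∉ N := fun h => B (AC A h)
      have D : (0, 1, -1) ∉ N := fun h => B (AD A h)
      refine ⟨3, eq_of_mem_iff_of_three_mem htri h1 hy hz ?_ ?_ ?_ ?_ ?_ ?_ ?_⟩ <;>
        simp [mem_gqLattice_three, A, B, C, D, h3]
  · by_cases B : (0, 0, 1) ∈ N
    · have C : (0, 1, 1) ∉ N := fun h => A (BC B h)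
      have D : (0, 1, -1) ∉ N := fun h => A (BD B h)
      refine ⟨2, eq_of_mem_iff_of_three_mem htri h1 hy hz ?_ ?_ ?_ ?_ ?_ ?_ ?_⟩ <;>
        simp [mem_gqLattice_two, A, B, C, D, h3]
    · by_cases C : (0, 1, 1) ∈ N
      · have D : (0, 1, -1) ∉ N := fun h => A (CD C h)
        refine ⟨1, eq_of_mem_iff_of_three_mem htri h1 hy hz ?_ ?_ ?_ ?_ ?_ ?_ ?_⟩ <;>
          simp [mem_gqLattice_one, A, B, C, D, h3, h3'']
      · by_cases D : (0, 1, -1) ∈ N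
        · refine ⟨6, eq_of_mem_iff_of_three_mem htri h1 hy hz ?_ ?_ ?_ ?_ ?_ ?_ ?_⟩ <;>
            simp [mem_gqLattice_six, A, B, C, D, h3, h3', h111]
        · refine ⟨4, eq_of_mem_iff_of_three_mem htri h1 hy hz ?_ ?_ ?_ ?_ ?_ ?_ ?_⟩ <;>
            simp [mem_gqLattice_four, A, B, C, D, h3]

/-- Stability and (1,1,1) ∈ N put the whole order inside N. If (0,0,3) is also present, so is
(0,3,0), and N comes from a subspace of 𝔽₃². If not, stability under (0,3,6) leaves no room beyond
the order. -/
theorem exists_gqLattice_eq_of_one_mem (h3 : ¬ (3 : R) ∣ 1)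
    (htri : ∀ x : R, 3 ∣ x ∨ 3 ∣ x - 1 ∨ 3 ∣ x + 1) (N : Submodule R (R × R × R))
    (ht : ∀ v ∈ N, (0, 3, 6) * v ∈ N) (hn : ∀ v ∈ N, (0, 0, 9) * v ∈ N)
    (h1 : (1, 1, 1) ∈ N) : ∃ i, N = gqLattice R i := by
  have t1 : ((0, 3, 6) : R × R × R) ∈ N := by simpa using ht _ h1
  have n1 : ((0, 0, 9) : R × R × R) ∈ N := by simpa using hn _ h1
  by_cases hz : ((0, 0, 3) : R × R × R) ∈ N
  · refine exists_gqLattice_eq_of_three_mem h3 htri N h1 ?_ hz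
    convert N.sub_mem t1 (N.smul_mem 2 hz) using 1
    ext <;> simp
    norm_num
  refine ⟨5, le_antisymm ?_ ?_⟩
  · rintro ⟨x, y, z⟩ hv
    -- reduce to `(0, y - x, z - x)`
    have of_unit : ∀ c : R, ¬ 3 ∣ c → (0, 0, 3 * c) ∉ N := by
      intro c hc h
      -- If c = ±1 + 3m, subtracting m(0,0,9) turns (0,0,3c) into ±(0,0,3).
      rcases htri c with h' | ⟨m, hm⟩ | ⟨m, hm⟩
      · exact hc h'
      · refine hz ?_
        convert N.sub_mem h (N.smul_mem m n1) using 1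
        ext <;> simp
        linear_combination (-3) * hm
      · refine hz ?_
        convert N.sub_mem (N.smul_mem m n1) h using 1
        ext <;> simp
        linear_combination 3 * hm
    have hw : (0, y - x, z - x) ∈ N := by
      convert N.sub_mem hv (N.smul_mem x h1) using 1
      ext <;> simp
    -- Multiplying (0, y−x, z−x) by (0,3,6) and removing combinations of the two vectors isolates
    -- (0, 0, 6(y−x)). This is excluded when 3 does not divide y − x.
    have d : 3 ∣ y - x := by
      by_contra hd
      have k1 : (0, 0, 3 * (z - x)) ∈ N := by
        convert N.sub_mem (N.sub_mem (ht _ hw) (N.smul_mem (y - x) t1))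
          (N.sub_mem (N.smul_mem 3 hw) (N.smul_mem (y - x) t1)) using 1
        ext <;> simp <;> ring
      have k2 : (0, 0, 3 * (2 * (y - x))) ∈ N := by
        convert N.sub_mem k1 (N.sub_mem (N.smul_mem 3 hw) (N.smul_mem (y - x) t1)) using 1
        ext <;> simp <;> ring
      refine of_unit _ (fun h => hd ?_) k2
      have := dvd_sub (Dvd.intro (y - x) rfl : 3 ∣ 3 * (y - x)) h
      convert this using 1
      ring
    refine mem_gqLattice_five.2 ⟨d, ?_⟩
    obtain ⟨a, ha⟩ := d
    have k : (0, 0, x - 2 * y + z) ∈ N := by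
      convert N.sub_mem hw (N.smul_mem a t1) using 1
      ext <;> simp
      · linear_combination -ha
      · linear_combination (-2) * ha
    by_cases h : 3 ∣ x - 2 * y + z
    · obtain ⟨b, hb⟩ := h
      rw [hb] at k ⊢
      by_cases hb' : 3 ∣ b
      · convert mul_dvd_mul_left 3 hb' using 1
        norm_num
      · exact absurd k (of_unit b hb')
    · refine absurd ?_ (of_unit _ h)
      simpa using N.smul_mem 3 k
  · rintro ⟨x, y, z⟩ hv
    obtain ⟨⟨a, ha⟩, ⟨b, hb⟩⟩ := mem_gqLattice_five.1 hv
    convert N.add_mem (N.add_mem (N.smul_mem x h1) (N.smul_mem a t1)) (N.smul_mem b n1) using 1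
    ext <;> simp
    · linear_combination ha
    · linear_combination 2 * ha + hb

/-- The vectors with a given coordinate divisible by 3 form a proper subgroup of N containing 3N,
and a vector space over 𝔽₃ is never the union of three proper subspaces. -/
theorem exists_not_three_dvd_of_forall_coord
    (N : Submodule R (R × R × R)) (hx : ∃ v ∈ N, ¬ 3 ∣ v.1) (hy : ∃ v ∈ N, ¬ 3 ∣ v.2.1)
    (hz : ∃ v ∈ N, ¬ 3 ∣ v.2.2) : ∃ v ∈ N, ¬ 3 ∣ v.1 ∧ ¬ 3 ∣ v.2.1 ∧ ¬ 3 ∣ v.2.2 := by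
  have step : ∃ v ∈ N, ¬ 3 ∣ v.1 ∧ ¬ 3 ∣ v.2.1 := by
    obtain ⟨v, hv, hvx⟩ := hx
    obtain ⟨w, hw, hwy⟩ := hy
    by_cases hvy : 3 ∣ v.2.1
    · by_cases hwx : 3 ∣ w.1
      · exact ⟨v + w, N.add_mem hv hw, by simpa [dvd_add_left hwx], by simpa [dvd_add_right hvy]⟩
      · exact ⟨w, hw, hwx, hwy⟩
    · exact ⟨v, hv, hvx, hvy⟩
  obtain ⟨v, hv, hvx, hvy⟩ := step
  by_cases hvz : 3 ∣ v.2.2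
  swap
  · exact ⟨v, hv, hvx, hvy, hvz⟩
  obtain ⟨w, hw, hwz⟩ := hz
  have two : ∀ a b : R, ¬ 3 ∣ a → 3 ∣ b - a → 3 ∣ b + a → False := fun a b ha h h' => ha (by
    have := dvd_sub (Dvd.intro a rfl : 3 ∣ 3 * a) (dvd_sub h' h)
    convert this using 1
    ring)
  have one : ∀ a b : R, ¬ 3 ∣ a → 3 ∣ b → 3 ∣ b + a → False := fun a b ha h h' =>
    ha ((dvd_add_right h).1 h')
  have one' : ∀ a b : R, ¬ 3 ∣ a → 3 ∣ b → 3 ∣ b - a → False := fun a b ha h h' =>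
    ha ((dvd_sub_right h).1 h')
  have cand : ∀ u : R × R × R, u ∈ N → ¬ 3 ∣ u.2.2 → (3 ∣ u.1 ∨ 3 ∣ u.2.1) ∨
      ∃ v ∈ N, ¬ 3 ∣ v.1 ∧ ¬ 3 ∣ v.2.1 ∧ ¬ 3 ∣ v.2.2 := fun u hu h => by
    by_cases h1 : 3 ∣ u.1
    · exact Or.inl (Or.inl h1)
    by_cases h2 : 3 ∣ u.2.1
    · exact Or.inl (Or.inr h2)
    exact Or.inr ⟨u, hu, h1, h2, h⟩
  rcases cand w hw hwz with c0 | c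
  swap
  · exact c
  rcases cand (w + v) (N.add_mem hw hv) (by simpa [dvd_add_left hvz]) with c1 | c
  swap
  · exact c
  rcases cand (w - v) (N.sub_mem hw hv) (by simpa [dvd_sub_left hvz]) with c2 | c
  swap
  · exact c
  exfalso
  simp only [Prod.fst_add, Prod.snd_add, Prod.fst_sub, Prod.snd_sub] at c1 c2
  -- Pigeonhole: each of w, w + v, w − v fails in the first or second coordinate, so two of them
  -- fail in the same one. Their difference is ±v or ±2v, whose first two coordinates are not
  -- divisible by 3.
  rcases c0 with c0 | c0 <;> rcases c1 with c1 | c1 <;> rcases c2 with c2 | c2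
  · exact one _ _ hvx c0 c1
  · exact one _ _ hvx c0 c1
  · exact one' _ _ hvx c0 c2
  · exact two _ _ hvy c2 c1
  · exact two _ _ hvx c2 c1
  · exact one' _ _ hvy c0 c2
  · exact one _ _ hvy c0 c1
  · exact one _ _ hvy c0 c1

/-- Up to a unit, every lattice with full coordinate projections is one of the seven. -/
theorem exists_unit_mul_mem_gqLattice_iff (h3 : ¬ (3 : R) ∣ 1)
    (htri : ∀ x : R, 3 ∣ x ∨ 3 ∣ x - 1 ∨ 3 ∣ x + 1) (hunit : ∀ x : R, ¬ 3 ∣ x → IsUnit x)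
    (N : Submodule R (R × R × R))
    (ht : ∀ v ∈ N, (0, 3, 6) * v ∈ N) (hn : ∀ v ∈ N, (0, 0, 9) * v ∈ N)
    (hx : ∃ v ∈ N, ¬ 3 ∣ v.1) (hy : ∃ v ∈ N, ¬ 3 ∣ v.2.1) (hz : ∃ v ∈ N, ¬ 3 ∣ v.2.2) :
    ∃ (u : (R × R × R)ˣ) (i : Fin 7), ∀ w, w ∈ N ↔ (u : R × R × R) * w ∈ gqLattice R i := by
  obtain ⟨v, hv, h⟩ := exists_not_three_dvd_of_forall_coord N hx hy hz
  have hvu : IsUnit v :=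
    Prod.isUnit_iff.2 ⟨hunit _ h.1, Prod.isUnit_iff.2 ⟨hunit _ h.2.1, hunit _ h.2.2⟩⟩
  obtain ⟨u, rfl⟩ := hvu
  -- The lattice u⁻¹N contains 1 and is still stable.
  obtain ⟨i, hi⟩ := exists_gqLattice_eq_of_one_mem h3 htri
    (N.comap (LinearMap.mulLeft R (u : R × R × R)))
    (fun w hw => by
      simp only [Submodule.mem_comap, LinearMap.mulLeft_apply] at hw ⊢
      rw [mul_left_comm]
      exact ht _ hw)
    (fun w hw => by
      simp only [Submodule.mem_comap, LinearMap.mulLeft_apply] at hw ⊢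
      rw [mul_left_comm]
      exact hn _ hw)
    (by
      simp only [Submodule.mem_comap, LinearMap.mulLeft_apply]
      rwa [show ((1, 1, 1) : R × R × R) = 1 from rfl, mul_one])
  refine ⟨u⁻¹, i, fun w => ?_⟩
  rw [← hi, Submodule.mem_comap, LinearMap.mulLeft_apply, Units.mul_inv_cancel_left]

end Classification

/-! ### Products, inverses, comparison and bases of the seven lattices. -/

section LatticeArithmetic

variable {R : Type*} [CommRing R]

theorem three_dvd_nine : (3 : R) ∣ 9 := ⟨3, by norm_num⟩

theorem mem_gqLattice_of_nine_dvd {x y z : R} (hx : 9 ∣ x) (hy : 9 ∣ y) (hz : 9 ∣ z) (i : Fin 7) :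
    (x, y, z) ∈ gqLattice R i := by
  have hx' := three_dvd_nine.trans hx
  have hy' := three_dvd_nine.trans hy
  have hz' := three_dvd_nine.trans hz
  fin_cases i
  · exact mem_gqLattice_zero.2 trivial
  · exact mem_gqLattice_one.2 (dvd_sub hz' hy')
  · exact mem_gqLattice_two.2 (dvd_sub hy' hx')
  · exact mem_gqLattice_three.2 (dvd_sub hz' hx')
  · exact mem_gqLattice_four.2 ⟨dvd_sub hy' hx', dvd_sub hz' hx'⟩
  · exact mem_gqLattice_five.2 ⟨dvd_sub hy' hx', dvd_add (dvd_sub hx (hy.mul_left 2)) hz⟩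
  · exact mem_gqLattice_six.2 (dvd_add (dvd_add hx' hy') hz')

theorem one_mem_gqLattice (i : Fin 7) : (1 : R × R × R) ∈ gqLattice R i := by
  change ((1, 1, 1) : R × R × R) ∈ _
  fin_cases i
  · exact mem_gqLattice_zero.2 trivial
  · exact mem_gqLattice_one.2 (by simp)
  · exact mem_gqLattice_two.2 (by simp)
  · exact mem_gqLattice_three.2 (by simp)
  · exact mem_gqLattice_four.2 (by simp)
  · exact mem_gqLattice_five.2 ⟨by simp, ⟨0, by norm_num⟩⟩
  · exact mem_gqLattice_six.2 ⟨1, by norm_num⟩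

/-- Congruences between coordinates are multiplicative, which settles types 1 to 4. In type 5 write
y = x + 3a and z = x + 6a + 9b: the only cross term in x − 2y + z not already carrying b or b' is
18aa'. -/
theorem mul_mem_gqLattice {i : Fin 7} (hi : i ≠ 6) {v w : R × R × R} (hv : v ∈ gqLattice R i)
    (hw : w ∈ gqLattice R i) : v * w ∈ gqLattice R i := by
  obtain ⟨x, y, z⟩ := v
  obtain ⟨x', y', z'⟩ := w
  simp only [Prod.mk_mul_mk]
  fin_cases i
  · exact mem_gqLattice_zero.2 trivial
  · exact mem_gqLattice_one.2 (dvd_mul_sub_mul (mem_gqLattice_one.1 hv) (mem_gqLattice_one.1 hw))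
  · exact mem_gqLattice_two.2 (dvd_mul_sub_mul (mem_gqLattice_two.1 hv) (mem_gqLattice_two.1 hw))
  · exact mem_gqLattice_three.2
      (dvd_mul_sub_mul (mem_gqLattice_three.1 hv) (mem_gqLattice_three.1 hw))
  · have hv := mem_gqLattice_four.1 hv
    have hw := mem_gqLattice_four.1 hw
    exact mem_gqLattice_four.2 ⟨dvd_mul_sub_mul hv.1 hw.1, dvd_mul_sub_mul hv.2 hw.2⟩
  · obtain ⟨ha, ⟨b, hb⟩⟩ := mem_gqLattice_five.1 hv
    obtain ⟨ha', ⟨b', hb'⟩⟩ := mem_gqLattice_five.1 hw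
    refine mem_gqLattice_five.2 ⟨dvd_mul_sub_mul ha ha', ?_⟩
    obtain ⟨a, ha⟩ := ha
    obtain ⟨a', ha'⟩ := ha'
    obtain rfl : y = x + 3 * a := by linear_combination ha
    obtain rfl : y' = x' + 3 * a' := by linear_combination ha'
    obtain rfl : z = x + 6 * a + 9 * b := by linear_combination hb
    obtain rfl : z' = x' + 6 * a' + 9 * b' := by linear_combination hb'
    exact ⟨2 * a * a' + b * (x' + 6 * a') + b' * (x + 6 * a) + 9 * b * b', by ring⟩
  · exact absurd rfl hi

/-- Modulo 3 the first factor is a scalar, so it preserves the plane x + y + z = 0. -/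
theorem mul_mem_gqLattice_six {v w : R × R × R} (hv : v ∈ gqLattice R 4)
    (hw : w ∈ gqLattice R 6) : v * w ∈ gqLattice R 6 := by
  obtain ⟨x, y, z⟩ := v
  obtain ⟨x', y', z'⟩ := w
  obtain ⟨⟨a, ha⟩, ⟨b, hb⟩⟩ := mem_gqLattice_four.1 hv
  obtain ⟨c, hc⟩ := mem_gqLattice_six.1 hw
  refine mem_gqLattice_six.2 ⟨a * y' + b * z' + x * c, ?_⟩
  linear_combination ha * y' + hb * z' + hc * x

theorem gqLattice_five_le (i : Fin 7) : gqLattice R 5 ≤ gqLattice R i := by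
  rintro ⟨x, y, z⟩ hv
  obtain ⟨ha, hb⟩ := mem_gqLattice_five.1 hv
  have hb := three_dvd_nine.trans hb
  have hzx : 3 ∣ z - x := by
    convert dvd_add (ha.mul_left 2) hb using 1
    ring
  fin_cases i
  · exact mem_gqLattice_zero.2 trivial
  · refine mem_gqLattice_one.2 ?_
    convert dvd_sub hzx ha using 1
    ring
  · exact mem_gqLattice_two.2 ha
  · exact mem_gqLattice_three.2 hzx
  · exact mem_gqLattice_four.2 ⟨ha, hzx⟩
  · exact hv
  · refine mem_gqLattice_six.2 ?_
    convert dvd_add (dvd_add ha hzx) (Dvd.intro x rfl) using 1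
    ring

theorem mul_mem_gqLattice_of_five {i : Fin 7} {v w : R × R × R} (hv : v ∈ gqLattice R 5)
    (hw : w ∈ gqLattice R i) : v * w ∈ gqLattice R i := by
  by_cases hi : i = 6
  · subst hi
    exact mul_mem_gqLattice_six (gqLattice_five_le 4 hv) hw
  · exact mul_mem_gqLattice hi (gqLattice_five_le i hv) hw

theorem dvd_inv_sub_inv {c x y x' y' : R} (hx : x * x' = 1) (hy : y * y' = 1) (h : c ∣ y - x) :
    c ∣ y' - x' := by
  convert h.mul_left (-x' * y') using 1
  linear_combination x' * hy - y' * hx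

/-- A difference of inverses is a difference divided by units. In type 5, 1/x − 2/y + 1/z has
numerator yz − 2xz + xy, which is again divisible by 9. -/
theorem inv_mem_gqLattice {i : Fin 7} (hi : i ≠ 6) {v w : R × R × R} (hvw : v * w = 1)
    (hv : v ∈ gqLattice R i) : w ∈ gqLattice R i := by
  obtain ⟨x, y, z⟩ := v
  obtain ⟨x', y', z'⟩ := w
  obtain ⟨hx, hy, hz⟩ : x * x' = 1 ∧ y * y' = 1 ∧ z * z' = 1 := by
    simpa [Prod.ext_iff] using hvw
  fin_cases i
  · exact mem_gqLattice_zero.2 trivial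
  · exact mem_gqLattice_one.2 (dvd_inv_sub_inv hy hz (mem_gqLattice_one.1 hv))
  · exact mem_gqLattice_two.2 (dvd_inv_sub_inv hx hy (mem_gqLattice_two.1 hv))
  · exact mem_gqLattice_three.2 (dvd_inv_sub_inv hx hz (mem_gqLattice_three.1 hv))
  · have hv := mem_gqLattice_four.1 hv
    exact mem_gqLattice_four.2 ⟨dvd_inv_sub_inv hx hy hv.1, dvd_inv_sub_inv hx hz hv.2⟩
  · obtain ⟨ha, ⟨b, hb⟩⟩ := mem_gqLattice_five.1 hv
    refine mem_gqLattice_five.2 ⟨dvd_inv_sub_inv hx hy ha, ?_⟩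
    obtain ⟨a, ha⟩ := ha
    have e : 9 ∣ y * z - 2 * x * z + x * y := by
      obtain rfl : y = x + 3 * a := by linear_combination ha
      obtain rfl : z = x + 6 * a + 9 * b := by linear_combination hb
      exact ⟨2 * a * a + b * (3 * a - x), by ring⟩
    convert e.mul_left (x' * y' * z') using 1
    linear_combination (-x') * hy - y' * y * x' * hz + 2 * y' * hx + 2 * x * x' * y' * hz -
      z' * hx - z' * x * x' * hy
  · exact absurd rfl hi

/-- The four directions of 𝔽₃² separate all types except 4 and 5, which contain none of them;
(0,0,3) lies in type 4 but not in type 5. -/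
theorem gqLattice_injective (h3 : ¬ (3 : R) ∣ 1) (h9 : ¬ (9 : R) ∣ 3) :
    Function.Injective (gqLattice R) := by
  have h3' : ¬ (3 : R) ∣ 1 + 1 := fun h => h3 (by
    have := dvd_sub (dvd_refl (3 : R)) h
    norm_num at this
    exact this)
  have h3'' : ¬ (3 : R) ∣ -1 - 1 := fun h => h3' (by
    rw [← dvd_neg]
    convert h using 1
    ring)
  have hA : ∀ i, (0, 1, 0) ∈ gqLattice R i ↔ i = 0 ∨ i = 3 := by
    intro i
    fin_cases i <;> simp [mem_gqLattice_zero, mem_gqLattice_one, mem_gqLattice_two,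
      mem_gqLattice_three, mem_gqLattice_four, mem_gqLattice_five, mem_gqLattice_six, h3]
  have hB : ∀ i, (0, 0, 1) ∈ gqLattice R i ↔ i = 0 ∨ i = 2 := by
    have h9' : ¬ (9 : R) ∣ 1 := fun h => h3 (three_dvd_nine.trans h)
    intro i
    fin_cases i <;> simp [mem_gqLattice_zero, mem_gqLattice_one, mem_gqLattice_two,
      mem_gqLattice_three, mem_gqLattice_four, mem_gqLattice_five, mem_gqLattice_six, h3, h9']
  have hC : ∀ i, (0, 1, 1) ∈ gqLattice R i ↔ i = 0 ∨ i = 1 := by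
    intro i
    fin_cases i <;> simp [mem_gqLattice_zero, mem_gqLattice_one, mem_gqLattice_two,
      mem_gqLattice_three, mem_gqLattice_four, mem_gqLattice_five, mem_gqLattice_six, h3, h3']
  have hD : ∀ i, (0, 1, -1) ∈ gqLattice R i ↔ i = 0 ∨ i = 6 := by
    intro i
    fin_cases i <;> simp [mem_gqLattice_zero, mem_gqLattice_one, mem_gqLattice_two,
      mem_gqLattice_three, mem_gqLattice_four, mem_gqLattice_five, mem_gqLattice_six, h3, h3'']
  have hE : ∀ i, (0, 0, 3) ∈ gqLattice R i ↔ i ≠ 5 := by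
    intro i
    fin_cases i <;> simp [mem_gqLattice_zero, mem_gqLattice_one, mem_gqLattice_two,
      mem_gqLattice_three, mem_gqLattice_four, mem_gqLattice_five, mem_gqLattice_six, h9]
  intro i j hij
  have A := (hA i).symm.trans ((congrArg (_ ∈ ·) hij).to_iff.trans (hA j))
  have B := (hB i).symm.trans ((congrArg (_ ∈ ·) hij).to_iff.trans (hB j))
  have C := (hC i).symm.trans ((congrArg (_ ∈ ·) hij).to_iff.trans (hC j))
  have D := (hD i).symm.trans ((congrArg (_ ∈ ·) hij).to_iff.trans (hD j))
  have E := (hE i).symm.trans ((congrArg (_ ∈ ·) hij).to_iff.trans (hE j))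
  revert A B C D E
  clear hij
  revert i j
  decide

/-- If multiplication by a unit carries one of the seven lattices to another, they agree. -/
theorem eq_of_unit_mul_mem_gqLattice_iff (h3 : ¬ (3 : R) ∣ 1) (h9 : ¬ (9 : R) ∣ 3) {i j : Fin 7}
    (c : (R × R × R)ˣ)
    (h : ∀ w, w ∈ gqLattice R i ↔ (c : R × R × R) * w ∈ gqLattice R j) : i = j := by
  have main : ∀ (i j : Fin 7) (c : (R × R × R)ˣ), j ≠ 6 →
      (∀ w, w ∈ gqLattice R i ↔ (c : R × R × R) * w ∈ gqLattice R j) → i = j := by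
    intro i j c hj h
    -- Since 1 lies in type i, c = c·1 lies in the ring of type j, and so does c⁻¹. Multiplication
    -- by c therefore maps type j onto itself.
    have hc : (c : R × R × R) ∈ gqLattice R j := by
      simpa using (h 1).1 (one_mem_gqLattice i)
    have hc' := inv_mem_gqLattice hj c.mul_inv hc
    refine gqLattice_injective h3 h9 (SetLike.ext fun w => (h w).trans ⟨fun hw => ?_, fun hw => ?_⟩)
    · simpa using mul_mem_gqLattice hj hc' hw
    · exact mul_mem_gqLattice hj hc hw
  by_cases hj : j = 6
  · by_cases hi : i = 6
    · rw [hi, hj]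
    · refine (main j i c⁻¹ hi fun w => ?_).symm
      rw [h, Units.mul_inv_cancel_left]
  · exact main i j c hj h

/-- Type 6 is a module over the ring of type 4, every other type over itself. As c⁶ ≡ 1 modulo 9, c⁵
undoes c up to an error in 9R³, which every type contains. -/
theorem mul_mem_gqLattice_iff {i : Fin 7} {c : R × R × R}
    (hc : c ∈ gqLattice R (if i = 6 then 4 else i)) (h1 : 9 ∣ c.1 ^ 6 - 1)
    (h2 : 9 ∣ c.2.1 ^ 6 - 1) (h3 : 9 ∣ c.2.2 ^ 6 - 1) (w : R × R × R) :
    c * w ∈ gqLattice R i ↔ w ∈ gqLattice R i := by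
  have mul : ∀ w ∈ gqLattice R i, c * w ∈ gqLattice R i := fun w hw => by
    by_cases hi : i = 6
    · subst hi
      exact mul_mem_gqLattice_six hc hw
    · rw [if_neg hi] at hc
      exact mul_mem_gqLattice hi hc hw
  refine ⟨fun h => ?_, mul w⟩
  have k := mul _ (mul _ (mul _ (mul _ (mul _ h))))
  have k' : (c ^ 6 - 1) * w ∈ gqLattice R i :=
    mem_gqLattice_of_nine_dvd (h1.mul_right _) (h2.mul_right _) (h3.mul_right _) i
  convert (gqLattice R i).sub_mem k k' using 1
  ring

/-- The standard basis vectors of `R × R × R`. -/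
def tripleBasis (R : Type*) [CommRing R] : Fin 3 → R × R × R := ![(1, 0, 0), (0, 1, 0), (0, 0, 1)]

/-- The coordinates of the bases of the seven lattices. -/
def gqLatticeCoord (R : Type*) [CommRing R] : Fin 7 → Fin 3 → R × R × R :=
  ![![(1, 0, 0), (0, 1, 0), (0, 0, 1)],
    ![(1, 0, 0), (0, 1, 1), (0, 0, 3)],
    ![(1, 1, 0), (0, 3, 0), (0, 0, 1)],
    ![(1, 0, 1), (0, 1, 0), (0, 0, 3)],
    ![(1, 1, 1), (0, 3, 0), (0, 0, 3)],
    ![(1, 1, 1), (0, 3, 6), (0, 0, 9)],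
    ![(1, 0, 2), (0, 1, 2), (0, 0, 3)]]

theorem gqLatticeBasis_tripleBasis : gqLatticeBasis (tripleBasis R) = gqLatticeCoord R := by
  funext i j
  fin_cases i <;> fin_cases j <;>
    ext <;> simp [gqLatticeBasis, tripleBasis, gqLatticeCoord]

theorem gqLatticeCoord_mem (i : Fin 7) (j : Fin 3) : gqLatticeCoord R i j ∈ gqLattice R i := by
  have h33 : (9 : R) ∣ -(2 * 3) + 6 := ⟨0, by norm_num⟩
  have h12 : (3 : R) ∣ 1 + 2 := ⟨1, by norm_num⟩
  have h21 : (9 : R) ∣ 1 - 2 + 1 := ⟨0, by norm_num⟩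
  fin_cases i <;> fin_cases j <;> simp [gqLatticeCoord, mem_gqLattice_zero,
    mem_gqLattice_one, mem_gqLattice_two, mem_gqLattice_three, mem_gqLattice_four,
    mem_gqLattice_five, mem_gqLattice_six, h33, h12, h21]

theorem span_gqLatticeBasis_tripleBasis (i : Fin 7) :
    Submodule.span R (Set.range (gqLatticeBasis (tripleBasis R) i)) = gqLattice R i := by
  apply le_antisymm
  · rw [Submodule.span_le]
    rintro _ ⟨j, rfl⟩
    rw [gqLatticeBasis_tripleBasis]
    exact gqLatticeCoord_mem i j
  · rintro ⟨x, y, z⟩ hv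
    rw [Submodule.mem_span_range_iff_exists_fun]
    fin_cases i
    · exact ⟨![x, y, z], by simp [Fin.sum_univ_three, gqLatticeBasis, tripleBasis]⟩
    · obtain ⟨a, ha⟩ := mem_gqLattice_one.1 hv
      refine ⟨![x, y, a], ?_⟩
      ext <;> simp [Fin.sum_univ_three, gqLatticeBasis, tripleBasis]
      linear_combination -ha
    · obtain ⟨a, ha⟩ := mem_gqLattice_two.1 hv
      refine ⟨![x, a, z], ?_⟩
      ext <;> simp [Fin.sum_univ_three, gqLatticeBasis, tripleBasis]
      linear_combination -ha
    · obtain ⟨a, ha⟩ := mem_gqLattice_three.1 hv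
      refine ⟨![x, y, a], ?_⟩
      ext <;> simp [Fin.sum_univ_three, gqLatticeBasis, tripleBasis]
      linear_combination -ha
    · obtain ⟨⟨a, ha⟩, ⟨b, hb⟩⟩ := mem_gqLattice_four.1 hv
      refine ⟨![x, a, b], ?_⟩
      ext <;> simp [Fin.sum_univ_three, gqLatticeBasis, tripleBasis]
      · linear_combination -ha
      · linear_combination -hb
    · obtain ⟨⟨a, ha⟩, ⟨b, hb⟩⟩ := mem_gqLattice_five.1 hv
      refine ⟨![x, a, b], ?_⟩
      ext <;> simp [Fin.sum_univ_three, gqLatticeBasis, tripleBasis]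
      · linear_combination -ha
      · linear_combination -hb - 2 * ha
    · obtain ⟨a, ha⟩ := mem_gqLattice_six.1 hv
      refine ⟨![x, y, a - x - y], ?_⟩
      ext <;> simp [Fin.sum_univ_three, gqLatticeBasis, tripleBasis]
      linear_combination -ha

end LatticeArithmetic

/-! ### Lattices in `ℤ × ℤ × ℤ` between `9 (ℤ × ℤ × ℤ)` and `ℤ × ℤ × ℤ` -/

section IntegralLattices

theorem int_three_trichotomy (x : ℤ) : 3 ∣ x ∨ 3 ∣ x - 1 ∨ 3 ∣ x + 1 := by omega

theorem nine_dvd_pow_six_sub_one {x : ℤ} (hx : ¬ 3 ∣ x) : 9 ∣ x ^ 6 - 1 := by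
  have key : ∀ y : ZMod 9, 3 * y = 0 ∨ y ^ 6 - 1 = 0 := by decide
  refine (ZMod.intCast_zmod_eq_zero_iff_dvd (x ^ 6 - 1) 9).1 ?_
  push_cast
  refine (key x).resolve_left fun h => hx ?_
  have h' : ((3 * x : ℤ) : ZMod 9) = 0 := by exact_mod_cast h
  rw [ZMod.intCast_zmod_eq_zero_iff_dvd] at h'
  push_cast at h'
  omega

/-- Membership of `(x, y, z)` in the lattice `gqLattice ℤ i`, as a computation. -/
def latticeTest (i x y z : ℕ) : Bool :=
  -- In natural numbers −1 becomes 2 modulo 3, and −2 becomes 7 modulo 9.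
  match i with
  | 0 => true
  | 1 => Nat.beq ((z + 2 * y) % 3) 0
  | 2 => Nat.beq ((y + 2 * x) % 3) 0
  | 3 => Nat.beq ((z + 2 * x) % 3) 0
  | 4 => Nat.beq ((y + 2 * x) % 3) 0 && Nat.beq ((z + 2 * x) % 3) 0
  | 5 => Nat.beq ((y + 2 * x) % 3) 0 && Nat.beq ((x + 7 * y + z) % 9) 0
  | _ => Nat.beq ((x + y + z) % 3) 0

theorem latticeTest_iff (i : Fin 7) (x y z : ℕ) :
    latticeTest i x y z = true ↔ ((x : ℤ), (y : ℤ), (z : ℤ)) ∈ gqLattice ℤ i := by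
  fin_cases i <;> simp [latticeTest, mem_gqLattice_zero, mem_gqLattice_one, mem_gqLattice_two,
    mem_gqLattice_three, mem_gqLattice_four, mem_gqLattice_five, mem_gqLattice_six] <;> omega

/-- The type, one of the seven lattices, of each of the 27 stable lattices between
`9 (ℤ × ℤ × ℤ)` and `ℤ × ℤ × ℤ` with full projections. -/
def stableType (k : Fin 27) : Fin 7 :=
  -- Types 0, …, 6 occur 1, 2, 2, 2, 4, 12, 4 times: the sizes of their orbits under the unit group
  -- of (ℤ/9)³.
  [0, 1, 1, 2, 2, 3, 3, 4, 4, 4, 4, 6, 6, 6, 6, 5, 5, 5, 5, 5, 5, 5, 5, 5, 5, 5, 5].getD k 0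

/-- The pair `(r, s)` such that multiplication by `(1, r, s)` carries the `k`-th stable lattice
to the lattice of its type. -/
def stableUnit (k : Fin 27) : ℕ × ℕ :=
  [(1, 1), (1, 1), (1, 8), (1, 1), (8, 1), (1, 1), (1, 8),
    (1, 1), (1, 8), (8, 1), (8, 8), (1, 1), (1, 8), (8, 1), (8, 8),
    (1, 1), (1, 8), (8, 1), (8, 8), (1, 2), (1, 7), (8, 2), (8, 7),
    (1, 4), (1, 5), (8, 4), (8, 5)].getD k (1, 1)

/-- The triple `(1, r, s)` of integers. -/
def stableMultiplier (k : Fin 27) : ℤ × ℤ × ℤ := (1, (stableUnit k).1, (stableUnit k).2)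

/-- The 27 stable lattices between `9 (ℤ × ℤ × ℤ)` and `ℤ × ℤ × ℤ` with full projections. -/
def stableLattice (k : Fin 27) : Submodule ℤ (ℤ × ℤ × ℤ) :=
  (gqLattice ℤ (stableType k)).comap (LinearMap.mulLeft ℤ (stableMultiplier k))

theorem mem_stableLattice {k : Fin 27} {v : ℤ × ℤ × ℤ} :
    v ∈ stableLattice k ↔ stableMultiplier k * v ∈ gqLattice ℤ (stableType k) := Iff.rfl

theorem stableUnit_not_dvd (k : Fin 27) :
    ¬ (3 : ℤ) ∣ (stableUnit k).1 ∧ ¬ (3 : ℤ) ∣ (stableUnit k).2 := by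
  revert k
  decide +kernel

theorem nine_dvd_stableMultiplier (k : Fin 27) (v : ℤ × ℤ × ℤ) :
    9 ∣ ((stableMultiplier k ^ 6 - 1) * v).1 ∧ 9 ∣ ((stableMultiplier k ^ 6 - 1) * v).2.1 ∧
      9 ∣ ((stableMultiplier k ^ 6 - 1) * v).2.2 := by
  have h := stableUnit_not_dvd k
  refine ⟨Dvd.dvd.mul_right ?_ _, Dvd.dvd.mul_right ?_ _, Dvd.dvd.mul_right ?_ _⟩
  · simp [stableMultiplier]
  · exact nine_dvd_pow_six_sub_one h.1
  · exact nine_dvd_pow_six_sub_one h.2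

theorem mem_iff_of_sub_mem {i : Fin 7} {v w : ℤ × ℤ × ℤ} (h1 : 9 ∣ v.1 - w.1)
    (h2 : 9 ∣ v.2.1 - w.2.1) (h3 : 9 ∣ v.2.2 - w.2.2) :
    v ∈ gqLattice ℤ i ↔ w ∈ gqLattice ℤ i := by
  have h : v - w ∈ gqLattice ℤ i := mem_gqLattice_of_nine_dvd h1 h2 h3 i
  exact ⟨fun hv => by simpa using Submodule.sub_mem _ hv h,
    fun hw => by simpa using Submodule.add_mem _ h hw⟩

/-- The listed multipliers represent every unit triple modulo 9, up to a factor from the ring that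
acts on the given type. The fifth powers are inverses modulo 9. -/
theorem exists_stable_test : ∀ x y z : Fin 9,
    (x.val % 3 = 0 ∨ y.val % 3 = 0 ∨ z.val % 3 = 0) ∨ ∀ i : Fin 7, ∃ k : Fin 27, stableType k = i ∧
      latticeTest (if i = 6 then 4 else i : Fin 7) x.val (y.val * (stableUnit k).1 ^ 5)
        (z.val * (stableUnit k).2 ^ 5) = true := by
  decide +kernel

theorem exists_nat_mod_nine (x : ℤ) : ∃ n : ℕ, n < 9 ∧ 9 ∣ x - n :=
  ⟨(x % 9).toNat, by omega, by omega⟩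

theorem exists_stableLattice_iff {w : ℤ × ℤ × ℤ} (h1 : ¬ 3 ∣ w.1) (h2 : ¬ 3 ∣ w.2.1)
    (h3 : ¬ 3 ∣ w.2.2) (i : Fin 7) :
    ∃ k, ∀ v, v ∈ stableLattice k ↔ w * v ∈ gqLattice ℤ i := by
  obtain ⟨a, b, c⟩ := w
  simp only at h1 h2 h3
  obtain ⟨x, hx, hx'⟩ := exists_nat_mod_nine a
  obtain ⟨y, hy, hy'⟩ := exists_nat_mod_nine b
  obtain ⟨z, hz, hz'⟩ := exists_nat_mod_nine c
  obtain ⟨k, hk, hk'⟩ := (exists_stable_test ⟨x, hx⟩ ⟨y, hy⟩ ⟨z, hz⟩).resolve_left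
    (by simp only; omega) i
  rw [latticeTest_iff] at hk'
  obtain ⟨hr, hs⟩ := stableUnit_not_dvd k
  have hp : Prime (3 : ℤ) := Int.prime_three
  have hx3 : ¬ 3 ∣ (x : ℤ) := by omega
  have hy3 : ¬ 3 ∣ ((y * (stableUnit k).1 ^ 5 : ℕ) : ℤ) := by
    push_cast
    exact fun h => (hp.dvd_or_dvd h).elim (by omega) fun h => hr (hp.dvd_of_dvd_pow h)
  have hz3 : ¬ 3 ∣ ((z * (stableUnit k).2 ^ 5 : ℕ) : ℤ) := by
    push_cast
    exact fun h => (hp.dvd_or_dvd h).elim (by omega) fun h => hs (hp.dvd_of_dvd_pow h)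
  refine ⟨k, fun v => ?_⟩
  -- The factor (x, yr⁵, zs⁵) preserves the type in both directions, and its product with (1, r, s)
  -- is (x, y, z) modulo 9.
  rw [mem_stableLattice, hk, ← mul_mem_gqLattice_iff hk' (nine_dvd_pow_six_sub_one hx3)
    (nine_dvd_pow_six_sub_one hy3) (nine_dvd_pow_six_sub_one hz3)]
  obtain ⟨p, q, t⟩ := v
  apply mem_iff_of_sub_mem
  · simp only [stableMultiplier, Prod.mk_mul_mk]
    rw [dvd_sub_comm]
    convert hx'.mul_right p using 1
    ring
  · simp only [stableMultiplier, Prod.mk_mul_mk]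
    rw [dvd_sub_comm]
    convert dvd_sub (hy'.mul_right q) ((nine_dvd_pow_six_sub_one hr).mul_right (y * q)) using 1
    push_cast
    ring
  · simp only [stableMultiplier, Prod.mk_mul_mk]
    rw [dvd_sub_comm]
    convert dvd_sub (hz'.mul_right t) ((nine_dvd_pow_six_sub_one hs).mul_right (z * t)) using 1
    push_cast
    ring

/-- The classification of the stable sublattices of `ℤ × ℤ × ℤ` with full projections. -/
theorem exists_eq_stableLattice (N : Submodule ℤ (ℤ × ℤ × ℤ))
    (hN : ∀ v ∈ gqLattice ℤ 5, ∀ w ∈ N, v * w ∈ N)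
    (hx : ∃ v ∈ N, v.1 = 1) (hy : ∃ v ∈ N, v.2.1 = 1) (hz : ∃ v ∈ N, v.2.2 = 1) :
    ∃ k, N = stableLattice k := by
  have h3 : ¬ (3 : ℤ) ∣ 1 := by norm_num
  have ht : ((0, 3, 6) : ℤ × ℤ × ℤ) ∈ gqLattice ℤ 5 := mem_gqLattice_five.2 (by norm_num)
  have hn : ((0, 0, 9) : ℤ × ℤ × ℤ) ∈ gqLattice ℤ 5 := mem_gqLattice_five.2 (by norm_num)
  -- The order contains 9 times each coordinate idempotent. Applied to vectors of N with an entry 1,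
  -- these give 9ℤ³ ⊆ N.
  have nine : ∀ v : ℤ × ℤ × ℤ, 9 ∣ v.1 → 9 ∣ v.2.1 → 9 ∣ v.2.2 → v ∈ N := by
    rintro ⟨_, _, _⟩ ⟨a, rfl⟩ ⟨b, rfl⟩ ⟨c, rfl⟩
    obtain ⟨p, hp, hp1⟩ := hx
    obtain ⟨q, hq, hq1⟩ := hy
    obtain ⟨r, hr, hr1⟩ := hz
    have ha : ((9 * a, 0, 0) : ℤ × ℤ × ℤ) ∈ gqLattice ℤ 5 :=
      mem_gqLattice_of_nine_dvd (Dvd.intro _ rfl) (dvd_zero _) (dvd_zero _) 5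
    have hb : ((0, 9 * b, 0) : ℤ × ℤ × ℤ) ∈ gqLattice ℤ 5 :=
      mem_gqLattice_of_nine_dvd (dvd_zero _) (Dvd.intro _ rfl) (dvd_zero _) 5
    have hc : ((0, 0, 9 * c) : ℤ × ℤ × ℤ) ∈ gqLattice ℤ 5 :=
      mem_gqLattice_of_nine_dvd (dvd_zero _) (dvd_zero _) (Dvd.intro _ rfl) 5
    convert N.add_mem (N.add_mem (hN _ ha _ hp) (hN _ hb _ hq)) (hN _ hc _ hr) using 1
    ext <;> simp [hp1, hq1, hr1]
  obtain ⟨u, hu, hu1, hu2, hu3⟩ := exists_not_three_dvd_of_forall_coord N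
    (hx.imp fun v hv => ⟨hv.1, by rw [hv.2]; norm_num⟩)
    (hy.imp fun v hv => ⟨hv.1, by rw [hv.2]; norm_num⟩)
    (hz.imp fun v hv => ⟨hv.1, by rw [hv.2]; norm_num⟩)
  obtain ⟨i, hi⟩ := exists_gqLattice_eq_of_one_mem h3 int_three_trichotomy
    (N.comap (LinearMap.mulLeft ℤ u))
    (fun w hw => by
      simp only [Submodule.mem_comap, LinearMap.mulLeft_apply] at hw ⊢
      rw [mul_left_comm]
      exact hN _ ht _ hw)
    (fun w hw => by
      simp only [Submodule.mem_comap, LinearMap.mulLeft_apply] at hw ⊢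
      rw [mul_left_comm]
      exact hN _ hn _ hw)
    (by
      simp only [Submodule.mem_comap, LinearMap.mulLeft_apply]
      rwa [show ((1, 1, 1) : ℤ × ℤ × ℤ) = 1 from rfl, mul_one])
  have hp : Prime (3 : ℤ) := Int.prime_three
  -- Over ℤ the vector u need not be invertible. Its inverse modulo 9 is u⁵, which is enough because
  -- 9ℤ³ ⊆ N.
  obtain ⟨k, hk⟩ := exists_stableLattice_iff (w := u ^ 5) (fun h => hu1 (hp.dvd_of_dvd_pow h))
    (fun h => hu2 (hp.dvd_of_dvd_pow h)) (fun h => hu3 (hp.dvd_of_dvd_pow h)) i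
  refine ⟨k, SetLike.ext fun v => ?_⟩
  rw [hk, ← hi, Submodule.mem_comap, LinearMap.mulLeft_apply]
  have d : (u ^ 6 - 1) * v ∈ N := nine _ ((nine_dvd_pow_six_sub_one hu1).mul_right _)
    ((nine_dvd_pow_six_sub_one hu2).mul_right _) ((nine_dvd_pow_six_sub_one hu3).mul_right _)
  have e : u * (u ^ 5 * v) = (u ^ 6 - 1) * v + v := by ring
  rw [e, N.add_mem_iff_right d]

theorem mul_mem_stableLattice {k : Fin 27} {v w : ℤ × ℤ × ℤ} (hv : v ∈ gqLattice ℤ 5)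
    (hw : w ∈ stableLattice k) : v * w ∈ stableLattice k := by
  rw [mem_stableLattice] at hw ⊢
  rw [mul_left_comm]
  exact mul_mem_gqLattice_of_five hv hw

/-- Sixteen test vectors are enough to reduce the distinctness of the 27 lattices to a finite
evaluation. -/
theorem stable_separation : ∀ k l : Fin 27,
    (∀ t ∈ [(0, 0, 1), (0, 1, 0), (1, 1, 1), (1, 0, 0), (0, 0, 3), (0, 1, 2), (1, 1, 2), (0, 1, 1),
      (1, 2, 1), (2, 1, 1), (1, 2, 2), (2, 1, 2), (2, 2, 1), (0, 3, 3), (3, 0, 3), (1, 1, 4)],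
      latticeTest (stableType k) t.1 ((stableUnit k).1 * t.2.1) ((stableUnit k).2 * t.2.2) =
      latticeTest (stableType l) t.1 ((stableUnit l).1 * t.2.1) ((stableUnit l).2 * t.2.2)) →
    k = l := by
  decide +kernel

theorem latticeTest_mul_iff (k : Fin 27) (x y z : ℕ) :
    latticeTest (stableType k) x ((stableUnit k).1 * y) ((stableUnit k).2 * z) = true ↔
      ((x : ℤ), (y : ℤ), (z : ℤ)) ∈ stableLattice k := by
  rw [latticeTest_iff, mem_stableLattice, stableMultiplier]
  simp

theorem stableLattice_injective : Function.Injective stableLattice := by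
  intro k l h
  refine stable_separation k l fun t _ => ?_
  rw [Bool.eq_iff_iff, latticeTest_mul_iff, latticeTest_mul_iff, h]

/-- The 3-adic valuation of the index of the lattices of each type. -/
def typeDepth (i : ℕ) : ℕ := [0, 1, 1, 1, 2, 3, 1].getD i 0

/-- `latticeTest` for the multiples of generators of a stable lattice. -/
def colonTest (k : Fin 27) (x y z : ℕ) : Bool :=
  -- Modulo 9 the stable lattice is (1, r⁵, s⁵) times the lattice of its type, so three generators
  -- decide the inclusion.
  (List.finRange 3).all fun j =>
    latticeTest 5 (x * (gqLatticeCoord ℤ (stableType k) j).1.toNat)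
      (y * (stableUnit k).1 ^ 5 * (gqLatticeCoord ℤ (stableType k) j).2.1.toNat)
      (z * (stableUnit k).2 ^ 5 * (gqLatticeCoord ℤ (stableType k) j).2.2.toNat)

/-- The number of stable lattices of given depth that `(x, y, z)` carries into `gqLattice ℤ 5`,
in terms of the truncated valuations of `x`, `y` and `z`. -/
def colonCount (a b c d : ℕ) : ℕ :=
  -- The branches are: valuations all 0; all 1; two 1's and a 2; all 2. The lists are indexed by
  -- depth 0, …, 3, and the last one counts all 27 lattices.
  if a + b + c = 0 then [0, 0, 0, 1].getD d 0
  else if a * b * c = 1 then [0, 1, 1, 3].getD d 0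
  else if a * b * c = 2 then [0, 1, 2, 6].getD d 0
  else if a * b * c = 8 then [1, 10, 4, 12].getD d 0
  else 0

/-- The 3-adic valuation, truncated at 2. -/
def truncVal (n : ℕ) : ℕ := if n % 9 = 0 then 2 else if n % 3 = 0 then 1 else 0

theorem card_colonTest : ∀ x y z : Fin 9, ∀ d : Fin 4,
    (Finset.univ.filter fun k => typeDepth (stableType k) = d ∧ colonTest k x y z).card =
      colonCount (truncVal x) (truncVal y) (truncVal z) d := by
  decide +kernel

end IntegralLattices

/-! ### Inclusions in the order, indices and projections of the stable lattices. -/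

section StableLatticeInvariants

/-- The triple of integers given by a triple of natural numbers. -/
def natTriple (x y z : ℕ) : ℤ × ℤ × ℤ := (x, y, z)

theorem colonTest_iff_forall (k : Fin 27) (x y z : ℕ) :
    colonTest k x y z = true ↔ ∀ j, natTriple x y z * stableMultiplier k ^ 5 *
      gqLatticeCoord ℤ (stableType k) j ∈ gqLattice ℤ 5 := by
  have nonneg : ∀ i j, 0 ≤ (gqLatticeCoord ℤ i j).1 ∧ 0 ≤ (gqLatticeCoord ℤ i j).2.1 ∧
      0 ≤ (gqLatticeCoord ℤ i j).2.2 := by decide +kernel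
  simp only [colonTest, List.all_eq_true, List.mem_finRange, true_implies]
  refine forall_congr' fun j => ?_
  obtain ⟨h1, h2, h3⟩ := nonneg (stableType k) j
  have := latticeTest_iff 5 (x * (gqLatticeCoord ℤ (stableType k) j).1.toNat)
      (y * (stableUnit k).1 ^ 5 * (gqLatticeCoord ℤ (stableType k) j).2.1.toNat)
      (z * (stableUnit k).2 ^ 5 * (gqLatticeCoord ℤ (stableType k) j).2.2.toNat)
  refine this.trans ?_
  push_cast
  rw [Int.toNat_of_nonneg h1, Int.toNat_of_nonneg h2, Int.toNat_of_nonneg h3]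
  refine iff_of_eq (congrArg (· ∈ gqLattice ℤ 5) ?_)
  ext <;> simp [natTriple, stableMultiplier]

theorem pow_six_mul_mem_gqLattice_iff {i : Fin 7} (k : Fin 27) (v : ℤ × ℤ × ℤ)
    (w : ℤ × ℤ × ℤ) :
    w * (stableMultiplier k ^ 6 * v) ∈ gqLattice ℤ i ↔ w * v ∈ gqLattice ℤ i := by
  have h := nine_dvd_stableMultiplier k (w * v)
  have e : w * (stableMultiplier k ^ 6 * v) - w * v = (stableMultiplier k ^ 6 - 1) * (w * v) := by
    ring
  rw [← e] at h
  exact mem_iff_of_sub_mem h.1 h.2.1 h.2.2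

theorem natTriple_mod_mul_mem_iff {i : Fin 7} (x y z : ℕ) (v : ℤ × ℤ × ℤ) :
    natTriple (x % 9) (y % 9) (z % 9) * v ∈ gqLattice ℤ i ↔
      natTriple x y z * v ∈ gqLattice ℤ i := by
  have key : ∀ n : ℕ, ∀ m : ℤ, 9 ∣ ((n % 9 : ℕ) : ℤ) * m - n * m := fun n m => by
    rw [← sub_mul]
    exact Dvd.dvd.mul_right (by omega) _
  exact mem_iff_of_sub_mem (key x _) (key y _) (key z _)

/-- Every type contains 9ℤ³, so the scaling factors matter only modulo 9, and the fifth power of the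
multiplier serves as its inverse. -/
theorem colonTest_iff (k : Fin 27) (x y z : ℕ) :
    colonTest k (x % 9) (y % 9) (z % 9) = true ↔
      ∀ v ∈ stableLattice k, natTriple x y z * v ∈ gqLattice ℤ 5 := by
  rw [colonTest_iff_forall]
  constructor
  · intro h v hv
    have hle : gqLattice ℤ (stableType k) ≤ (gqLattice ℤ 5).comap
        (LinearMap.mulLeft ℤ (natTriple (x % 9) (y % 9) (z % 9) * stableMultiplier k ^ 5)) := by
      rw [← span_gqLatticeBasis_tripleBasis, Submodule.span_le, gqLatticeBasis_tripleBasis]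
      rintro _ ⟨j, rfl⟩
      exact h j
    have h' := hle hv
    rw [Submodule.mem_comap, LinearMap.mulLeft_apply] at h'
    rw [← natTriple_mod_mul_mem_iff, ← pow_six_mul_mem_gqLattice_iff k]
    convert h' using 1
    rw [LinearMap.mulLeft_apply]
    ring
  · intro h j
    rw [mul_assoc, natTriple_mod_mul_mem_iff]
    refine h _ ?_
    rw [mem_stableLattice]
    have := (pow_six_mul_mem_gqLattice_iff (i := stableType k) k
      (gqLatticeCoord ℤ (stableType k) j) 1).2 (by
        rw [one_mul]; exact gqLatticeCoord_mem _ _)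
    convert this using 1
    ring

open Classical in
theorem card_stableLattice_colon (x y z : ℕ) (d : Fin 4) :
    (Finset.univ.filter fun k => typeDepth (stableType k) = d ∧
      ∀ v ∈ stableLattice k, natTriple x y z * v ∈ gqLattice ℤ 5).card =
      colonCount (truncVal x) (truncVal y) (truncVal z) d := by
  have h := card_colonTest ⟨x % 9, Nat.mod_lt _ (by norm_num)⟩ ⟨y % 9, Nat.mod_lt _ (by norm_num)⟩
    ⟨z % 9, Nat.mod_lt _ (by norm_num)⟩ d
  have e : ∀ n, truncVal (n % 9) = truncVal n := fun n => by
    unfold truncVal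
    rw [Nat.mod_mod, Nat.mod_mod_of_dvd n (by norm_num : 3 ∣ 9)]
  simp only [e] at h
  rw [← h]
  congr 1
  ext k
  simp only [Finset.mem_filter, Finset.mem_univ, true_and, colonTest_iff]

theorem index_ker_of_surjective {G A : Type*} [AddGroup G] [AddGroup A] (f : G →+ A)
    (hf : Function.Surjective f) : f.ker.index = Nat.card A := by
  rw [AddSubgroup.index_ker, AddMonoidHom.range_eq_top.2 hf]
  exact Nat.card_congr AddSubgroup.topEquiv.toEquiv

/-- The reduction of a linear form modulo `c`. -/
def formMod (c : ℕ) (α β γ : ℤ) : ℤ × ℤ × ℤ →+ ZMod c :=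
  (Int.castAddHom (ZMod c)).comp ((α • AddMonoidHom.fst ℤ (ℤ × ℤ)) +
    ((β • AddMonoidHom.fst ℤ ℤ) + γ • AddMonoidHom.snd ℤ ℤ).comp (AddMonoidHom.snd ℤ (ℤ × ℤ)))

theorem formMod_apply (c : ℕ) (α β γ : ℤ) (v : ℤ × ℤ × ℤ) :
    formMod c α β γ v = ((α * v.1 + β * v.2.1 + γ * v.2.2 : ℤ) : ZMod c) := by
  simp [formMod, add_assoc]

theorem ker_formMod (c : ℕ) (α β γ : ℤ) :
    (formMod c α β γ).ker = (congruenceLattice (c : ℤ) α β γ).toAddSubgroup := by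
  ext v
  rw [AddMonoidHom.mem_ker, formMod_apply, ZMod.intCast_zmod_eq_zero_iff_dvd]
  rfl

theorem index_congruenceLattice (c : ℕ) (α β : ℤ) :
    (congruenceLattice (c : ℤ) α β 1).toAddSubgroup.index = c := by
  rw [← ker_formMod, index_ker_of_surjective, Nat.card_zmod]
  intro a
  obtain ⟨a, rfl⟩ := ZMod.intCast_surjective a
  exact ⟨(0, 0, a), by simp [formMod_apply]⟩

theorem index_congruenceLattice_inf (c d : ℕ) (α β γ : ℤ) :
    (congruenceLattice (c : ℤ) α 1 0 ⊓ congruenceLattice (d : ℤ) β γ 1).toAddSubgroup.index =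
      c * d := by
  have h : (congruenceLattice (c : ℤ) α 1 0 ⊓ congruenceLattice (d : ℤ) β γ 1).toAddSubgroup =
      ((formMod c α 1 0).prod (formMod d β γ 1)).ker := by
    rw [AddMonoidHom.ker_prod, ker_formMod, ker_formMod]
    rfl
  rw [h, index_ker_of_surjective, Nat.card_prod, Nat.card_zmod, Nat.card_zmod]
  rintro ⟨a, b⟩
  obtain ⟨a, rfl⟩ := ZMod.intCast_surjective a
  obtain ⟨b, rfl⟩ := ZMod.intCast_surjective b
  exact ⟨(0, a, b - γ * a), by simp [formMod_apply]⟩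

theorem index_gqLattice (i : Fin 7) : (gqLattice ℤ i).toAddSubgroup.index = 3 ^ typeDepth i := by
  fin_cases i
  · exact AddSubgroup.index_top
  · exact index_congruenceLattice 3 0 (-1)
  · have : (gqLattice ℤ 2).toAddSubgroup = (formMod 3 (-1) 1 0).ker := (ker_formMod 3 _ _ _).symm
    change (gqLattice ℤ 2).toAddSubgroup.index = 3
    rw [this, index_ker_of_surjective, Nat.card_zmod]
    intro a
    obtain ⟨a, rfl⟩ := ZMod.intCast_surjective a
    exact ⟨(0, a, 0), by simp [formMod_apply]⟩
  · exact index_congruenceLattice 3 (-1) 0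
  · exact index_congruenceLattice_inf 3 3 (-1) (-1) 0
  · exact index_congruenceLattice_inf 3 9 (-1) 1 (-2)
  · exact index_congruenceLattice 3 1 1

/-- The stable lattice is the kernel of v ↦ mv from ℤ³ to ℤ³/L. This map is onto because m⁵ inverts
m modulo 9ℤ³ ⊆ L, so the index is that of L. -/
theorem index_stableLattice (k : Fin 27) :
    (stableLattice k).toAddSubgroup.index = 3 ^ typeDepth (stableType k) := by
  set L := (gqLattice ℤ (stableType k)).toAddSubgroup with hL
  set f : ℤ × ℤ × ℤ →+ (ℤ × ℤ × ℤ) ⧸ L :=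
    (QuotientAddGroup.mk' L).comp (AddMonoidHom.mulLeft (stableMultiplier k)) with hf
  have hk : (stableLattice k).toAddSubgroup = f.ker := by
    ext v
    rw [AddMonoidHom.mem_ker, hf, AddMonoidHom.comp_apply, QuotientAddGroup.mk'_apply,
      QuotientAddGroup.eq_zero_iff]
    rfl
  rw [hk, index_ker_of_surjective, ← index_gqLattice]
  · rfl
  · intro q
    obtain ⟨v, rfl⟩ := QuotientAddGroup.mk'_surjective L q
    refine ⟨stableMultiplier k ^ 5 * v, ?_⟩
    rw [hf, AddMonoidHom.comp_apply, QuotientAddGroup.mk'_apply, QuotientAddGroup.mk'_apply,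
      QuotientAddGroup.eq_iff_sub_mem]
    have h := nine_dvd_stableMultiplier k v
    have e : AddMonoidHom.mulLeft (stableMultiplier k) (stableMultiplier k ^ 5 * v) - v =
        (stableMultiplier k ^ 6 - 1) * v := by
      rw [AddMonoidHom.coe_mulLeft]
      ring
    rw [e]
    exact mem_gqLattice_of_nine_dvd h.1 h.2.1 h.2.2 _

/-- The vector m⁵ lies in the lattice because m⁶ ≡ 1 modulo 9. Scaling it by r or s makes the
relevant coordinate ≡ 1 modulo 9, and an element of 9ℤ³ corrects it to 1. -/
theorem exists_mem_stableLattice_coord (k : Fin 27) :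
    (∃ v ∈ stableLattice k, v.1 = 1) ∧ (∃ v ∈ stableLattice k, v.2.1 = 1) ∧
      ∃ v ∈ stableLattice k, v.2.2 = 1 := by
  have hu : stableMultiplier k ^ 5 ∈ stableLattice k := by
    rw [mem_stableLattice]
    have := (pow_six_mul_mem_gqLattice_iff (i := stableType k) k 1 1).2
      (by rw [one_mul]; exact one_mem_gqLattice _)
    convert this using 1
    ring
  have hn : ∀ v : ℤ × ℤ × ℤ, 9 ∣ v.1 → 9 ∣ v.2.1 → 9 ∣ v.2.2 → v ∈ stableLattice k :=
    fun v h1 h2 h3 => mem_stableLattice.2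
      (mem_gqLattice_of_nine_dvd (h1.mul_left _) (h2.mul_left _) (h3.mul_left _) _)
  obtain ⟨h1, h2, h3⟩ := nine_dvd_stableMultiplier k 1
  obtain ⟨hr, hs⟩ := stableUnit_not_dvd k
  have hr := nine_dvd_pow_six_sub_one hr
  have hs := nine_dvd_pow_six_sub_one hs
  refine ⟨⟨_, hu, by simp [stableMultiplier]⟩,
    ⟨((stableUnit k).1 : ℤ) • stableMultiplier k ^ 5 -
      (0, ((stableUnit k).1 : ℤ) ^ 6 - 1, 0),
      Submodule.sub_mem _ (Submodule.smul_mem _ _ hu) (hn _ (dvd_zero _) hr (dvd_zero _)), ?_⟩,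
    ⟨((stableUnit k).2 : ℤ) • stableMultiplier k ^ 5 -
      (0, 0, ((stableUnit k).2 : ℤ) ^ 6 - 1),
      Submodule.sub_mem _ (Submodule.smul_mem _ _ hu) (hn _ (dvd_zero _) (dvd_zero _) hs), ?_⟩⟩
  · simp [stableMultiplier]
    ring
  · simp [stableMultiplier]
    ring

end StableLatticeInvariants

/-! ### Parametrisation of the ideals of finite index -/

section Ideals

/-- The parameters of an ideal of finite index of the order `gqLattice ℤ 5`: a stable lattice and
positive scaling factors that carry it into the order. -/
def IdealParam : Type :=
  {p : Fin 27 × ℕ+ × ℕ+ × ℕ+ //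
    ∀ v ∈ stableLattice p.1, natTriple p.2.1 p.2.2.1 p.2.2.2 * v ∈ gqLattice ℤ 5}

/-- The multiple of a stable lattice by a triple of positive integers. -/
def scaledLattice (p : Fin 27 × ℕ+ × ℕ+ × ℕ+) : Submodule ℤ (ℤ × ℤ × ℤ) :=
  (stableLattice p.1).map (LinearMap.mulLeft ℤ (natTriple p.2.1 p.2.2.1 p.2.2.2))

theorem natTriple_mul_injective (a b c : ℕ+) :
    Function.Injective (fun v => natTriple a b c * v) := by
  rintro ⟨x, y, z⟩ ⟨x', y', z'⟩ h
  simpa [natTriple] using h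

theorem natTriple_mul_mem_scaledLattice {p : Fin 27 × ℕ+ × ℕ+ × ℕ+} {v : ℤ × ℤ × ℤ} :
    natTriple p.2.1 p.2.2.1 p.2.2.2 * v ∈ scaledLattice p ↔ v ∈ stableLattice p.1 := by
  constructor
  · rintro ⟨w, hw, h⟩
    rwa [← natTriple_mul_injective _ _ _ h]
  · exact fun h => ⟨v, h, rfl⟩

/-- Multiplication by (a, b, c) is injective with image aℤ × bℤ × cℤ, so it multiplies the index by
abc. -/
theorem index_scaledLattice (p : Fin 27 × ℕ+ × ℕ+ × ℕ+) :
    (scaledLattice p).toAddSubgroup.index =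
      3 ^ typeDepth (stableType p.1) * (p.2.1 * p.2.2.1 * p.2.2.2) := by
  obtain ⟨k, a, b, c⟩ := p
  have h : (scaledLattice (k, a, b, c)).toAddSubgroup =
      (stableLattice k).toAddSubgroup.map (AddMonoidHom.mulLeft (natTriple a b c)) := rfl
  rw [h, AddSubgroup.index_map_of_injective _ (natTriple_mul_injective a b c),
    index_stableLattice]
  congr 1
  set f : ℤ × ℤ × ℤ →+ ZMod a × ZMod b × ZMod c :=
    (Int.castAddHom (ZMod a)).prodMap ((Int.castAddHom (ZMod b)).prodMap
      (Int.castAddHom (ZMod c))) with hf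
  have hr : (AddMonoidHom.mulLeft (natTriple a b c)).range = f.ker := by
    ext ⟨x, y, z⟩
    have : f (x, y, z) = 0 ↔ (a : ℤ) ∣ x ∧ (b : ℤ) ∣ y ∧ (c : ℤ) ∣ z := by
      simp [hf, ZMod.intCast_zmod_eq_zero_iff_dvd]
    rw [AddMonoidHom.mem_ker, this]
    constructor
    · rintro ⟨⟨p, q, r⟩, h⟩
      simp only [natTriple, AddMonoidHom.coe_mulLeft, Prod.mk_mul_mk, Prod.mk.injEq] at h
      exact ⟨⟨p, h.1.symm⟩, ⟨q, h.2.1.symm⟩, ⟨r, h.2.2.symm⟩⟩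
    · rintro ⟨⟨p, rfl⟩, ⟨q, rfl⟩, ⟨r, rfl⟩⟩
      exact ⟨(p, q, r), rfl⟩
  rw [hr, index_ker_of_surjective]
  · simp [mul_assoc]
  · exact ZMod.intCast_surjective.prodMap
      (ZMod.intCast_surjective.prodMap ZMod.intCast_surjective)

theorem exists_pnat_generator (P : AddSubgroup ℤ) {n : ℤ} (hn : n ≠ 0) (h : n ∈ P) :
    ∃ a : ℕ+, ∀ m, m ∈ P ↔ (a : ℤ) ∣ m := by
  obtain ⟨a, ha⟩ := Int.subgroup_cyclic P
  rw [← AddSubgroup.zmultiples_eq_closure] at ha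
  have hmem : ∀ m, m ∈ P ↔ a ∣ m := fun m => by rw [ha, Int.mem_zmultiples_iff]
  have ha0 : a ≠ 0 := by
    rintro rfl
    exact hn (zero_dvd_iff.1 ((hmem n).1 h))
  exact ⟨⟨a.natAbs, Int.natAbs_pos.2 ha0⟩, fun m => by
    rw [hmem]
    exact Int.natAbs_dvd.symm⟩

theorem exists_mem_scaledLattice_coord_iff (p : Fin 27 × ℕ+ × ℕ+ × ℕ+) :
    (∀ m, (∃ v ∈ scaledLattice p, v.1 = m) ↔ (p.2.1 : ℤ) ∣ m) ∧
    (∀ m, (∃ v ∈ scaledLattice p, v.2.1 = m) ↔ (p.2.2.1 : ℤ) ∣ m) ∧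
    (∀ m, (∃ v ∈ scaledLattice p, v.2.2 = m) ↔ (p.2.2.2 : ℤ) ∣ m) := by
  obtain ⟨⟨u, hu, hu'⟩, ⟨v, hv, hv'⟩, ⟨w, hw, hw'⟩⟩ := exists_mem_stableLattice_coord p.1
  refine ⟨fun m => ⟨?_, ?_⟩, fun m => ⟨?_, ?_⟩, fun m => ⟨?_, ?_⟩⟩
  · rintro ⟨_, ⟨x, -, rfl⟩, rfl⟩
    exact ⟨x.1, rfl⟩
  · rintro ⟨n, rfl⟩
    exact ⟨_, Submodule.smul_mem _ n (natTriple_mul_mem_scaledLattice.2 hu),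
      by simp [natTriple, hu', mul_comm]⟩
  · rintro ⟨_, ⟨x, -, rfl⟩, rfl⟩
    exact ⟨x.2.1, rfl⟩
  · rintro ⟨n, rfl⟩
    exact ⟨_, Submodule.smul_mem _ n (natTriple_mul_mem_scaledLattice.2 hv),
      by simp [natTriple, hv', mul_comm]⟩
  · rintro ⟨_, ⟨x, -, rfl⟩, rfl⟩
    exact ⟨x.2.2, rfl⟩
  · rintro ⟨n, rfl⟩
    exact ⟨_, Submodule.smul_mem _ n (natTriple_mul_mem_scaledLattice.2 hw),
      by simp [natTriple, hw', mul_comm]⟩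

theorem pnat_eq_of_forall_dvd_iff {a b : ℕ+} (h : ∀ m : ℤ, (a : ℤ) ∣ m ↔ (b : ℤ) ∣ m) : a = b :=
  PNat.coe_injective (Nat.dvd_antisymm (Int.natCast_dvd_natCast.1 ((h _).2 dvd_rfl))
    (Int.natCast_dvd_natCast.1 ((h _).1 dvd_rfl)))

/-- The coordinate projections recover the scaling factors; dividing by them recovers the stable
lattice. -/
theorem scaledLattice_injective : Function.Injective scaledLattice := by
  intro p q h
  have hp := exists_mem_scaledLattice_coord_iff p
  have hq := exists_mem_scaledLattice_coord_iff q
  rw [← h] at hq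
  have e : p.2 = q.2 := Prod.ext (pnat_eq_of_forall_dvd_iff fun m => (hp.1 m).symm.trans (hq.1 m))
    (Prod.ext (pnat_eq_of_forall_dvd_iff fun m => (hp.2.1 m).symm.trans (hq.2.1 m))
      (pnat_eq_of_forall_dvd_iff fun m => (hp.2.2 m).symm.trans (hq.2.2 m)))
  refine Prod.ext (stableLattice_injective (SetLike.ext fun v => ?_)) e
  rw [← natTriple_mul_mem_scaledLattice, h, e, natTriple_mul_mem_scaledLattice]

/-- The vector (n,n,n) makes each coordinate projection a nonzero ideal of ℤ. Dividing H by the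
three generators leaves a stable lattice with full projections. -/
theorem exists_eq_scaledLattice (H : Submodule ℤ (ℤ × ℤ × ℤ))
    (hH : ∀ v ∈ gqLattice ℤ 5, ∀ w ∈ H, v * w ∈ H) {n : ℤ} (hn : n ≠ 0) (hnH : (n, n, n) ∈ H) :
    ∃ p, H = scaledLattice p := by
  obtain ⟨a, ha⟩ := exists_pnat_generator
    (H.toAddSubgroup.map (AddMonoidHom.fst ℤ (ℤ × ℤ))) hn ⟨_, hnH, rfl⟩
  obtain ⟨b, hb⟩ := exists_pnat_generator
    (H.toAddSubgroup.map ((AddMonoidHom.fst ℤ ℤ).comp (AddMonoidHom.snd ℤ (ℤ × ℤ)))) hn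
    ⟨_, hnH, rfl⟩
  obtain ⟨c, hc⟩ := exists_pnat_generator
    (H.toAddSubgroup.map ((AddMonoidHom.snd ℤ ℤ).comp (AddMonoidHom.snd ℤ (ℤ × ℤ)))) hn
    ⟨_, hnH, rfl⟩
  have div : ∀ v ∈ H, ∃ w, v = natTriple a b c * w := by
    rintro ⟨x, y, z⟩ hv
    obtain ⟨p, hp⟩ := (ha x).1 ⟨_, hv, rfl⟩
    obtain ⟨q, hq⟩ := (hb y).1 ⟨_, hv, rfl⟩
    obtain ⟨r, hr⟩ := (hc z).1 ⟨_, hv, rfl⟩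
    exact ⟨(p, q, r), by rw [hp, hq, hr]; rfl⟩
  obtain ⟨k, hk⟩ := exists_eq_stableLattice
    (H.comap (LinearMap.mulLeft ℤ (natTriple a b c)))
    (fun v hv w hw => by
      simp only [Submodule.mem_comap, LinearMap.mulLeft_apply] at hw ⊢
      rw [mul_left_comm]
      exact hH _ hv _ hw)
    (by
      obtain ⟨v, hv, hv'⟩ := (ha a).2 dvd_rfl
      obtain ⟨w, rfl⟩ := div v hv
      refine ⟨w, hv, ?_⟩
      simpa [natTriple] using hv')
    (by
      obtain ⟨v, hv, hv'⟩ := (hb b).2 dvd_rfl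
      obtain ⟨w, rfl⟩ := div v hv
      refine ⟨w, hv, ?_⟩
      simpa [natTriple] using hv')
    (by
      obtain ⟨v, hv, hv'⟩ := (hc c).2 dvd_rfl
      obtain ⟨w, rfl⟩ := div v hv
      refine ⟨w, hv, ?_⟩
      simpa [natTriple] using hv')
  refine ⟨(k, a, b, c), SetLike.ext fun v => ⟨fun hv => ?_, ?_⟩⟩
  · obtain ⟨w, rfl⟩ := div v hv
    refine natTriple_mul_mem_scaledLattice.2 ?_
    rw [← hk]
    exact hv
  · rintro ⟨w, hw, rfl⟩
    rw [SetLike.mem_coe, ← hk] at hw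
    exact hw

theorem mul_mem_scaledLattice {p : Fin 27 × ℕ+ × ℕ+ × ℕ+} {v w : ℤ × ℤ × ℤ}
    (hv : v ∈ gqLattice ℤ 5) (hw : w ∈ scaledLattice p) : v * w ∈ scaledLattice p := by
  obtain ⟨x, hx, rfl⟩ := hw
  rw [LinearMap.mulLeft_apply, mul_left_comm]
  exact natTriple_mul_mem_scaledLattice.2 (mul_mem_stableLattice hv hx)

variable {Λ : Type*} [Ring Λ] (g : Λ →+* ℤ × ℤ × ℤ)

/-- The ideal with given parameters, in a ring that maps to `gqLattice ℤ 5`. -/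
def idealOfParam (hg : ∀ x, g x ∈ gqLattice ℤ 5) (p : Fin 27 × ℕ+ × ℕ+ × ℕ+) :
    Submodule Λ Λ where
  carrier := {x | g x ∈ scaledLattice p}
  zero_mem' := by simp
  add_mem' hx hy := by
    rw [Set.mem_ofPred_eq, map_add]
    exact Submodule.add_mem _ hx hy
  smul_mem' c x hx := by
    rw [Set.mem_ofPred_eq, smul_eq_mul, map_mul]
    exact mul_mem_scaledLattice (hg c) hx

theorem scaledLattice_le (p : IdealParam) : scaledLattice p.1 ≤ gqLattice ℤ 5 := by
  rintro _ ⟨v, hv, rfl⟩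
  exact p.2 v hv

/-- The factor 27 is the index of the order in ℤ³; the index is multiplicative along N ⊆ O ⊆ ℤ³. -/
theorem index_idealOfParam (hg : ∀ v, v ∈ gqLattice ℤ 5 ↔ ∃ x, g x = v) (p : IdealParam) :
    (idealOfParam g (fun x => (hg _).2 ⟨x, rfl⟩) p.1).toAddSubgroup.index * 27 =
      3 ^ typeDepth (stableType p.1.1) * (p.1.2.1 * p.1.2.2.1 * p.1.2.2.2) := by
  have h : (idealOfParam g (fun x => (hg _).2 ⟨x, rfl⟩) p.1).toAddSubgroup =
      (scaledLattice p.1).toAddSubgroup.comap g.toAddMonoidHom := rfl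
  have hr : g.toAddMonoidHom.range = (gqLattice ℤ 5).toAddSubgroup := by
    ext v
    exact (hg v).symm
  rw [h, AddSubgroup.index_comap, hr, ← index_scaledLattice,
    ← AddSubgroup.relIndex_mul_index (K := (gqLattice ℤ 5).toAddSubgroup) (scaledLattice_le p),
    index_gqLattice]
  rfl

/-- The ideals of finite index correspond to their parameters. -/
def idealEquiv (hinj : Function.Injective g) (hg : ∀ v, v ∈ gqLattice ℤ 5 ↔ ∃ x, g x = v) :
    IdealParam ≃ {N : Submodule Λ Λ // N.toAddSubgroup.FiniteIndex} :=
  Equiv.ofBijective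
    (fun p => ⟨idealOfParam g (fun x => (hg _).2 ⟨x, rfl⟩) p.1, ⟨by
      intro h
      have := index_idealOfParam g hg p
      rw [h, zero_mul] at this
      have pos : 0 < 3 ^ typeDepth (stableType p.1.1) * (p.1.2.1 * p.1.2.2.1 * p.1.2.2.2 : ℕ) := by
        have := p.1.2.1.pos
        have := p.1.2.2.1.pos
        have := p.1.2.2.2.pos
        positivity
      omega⟩⟩)
    (by
      constructor
      · intro p q h
        refine Subtype.ext (scaledLattice_injective (le_antisymm ?_ ?_))
        · intro v hv
          obtain ⟨x, rfl⟩ := (hg v).1 (scaledLattice_le p hv)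
          exact (SetLike.ext_iff.1 (congrArg Subtype.val h) x).1 hv
        · intro v hv
          obtain ⟨x, rfl⟩ := (hg v).1 (scaledLattice_le q hv)
          exact (SetLike.ext_iff.1 (congrArg Subtype.val h) x).2 hv
      · rintro ⟨N, hN⟩
        set H : Submodule ℤ (ℤ × ℤ × ℤ) :=
          AddSubgroup.toIntSubmodule (N.toAddSubgroup.map g.toAddMonoidHom) with hH
        have hmem : ∀ x, g x ∈ H ↔ x ∈ N := by
          intro x
          constructor
          · rintro ⟨y, hy, e⟩
            rwa [← hinj e]
          · exact fun hx => ⟨x, hx, rfl⟩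
        obtain ⟨p, hp⟩ := exists_eq_scaledLattice H
          (by
            rintro v hv _ ⟨x, hx, rfl⟩
            obtain ⟨c, rfl⟩ := (hg v).1 hv
            refine ⟨c * x, N.smul_mem c hx, ?_⟩
            exact map_mul g c x)
          -- The index n annihilates the quotient, so n·1 lies in N, and its image is (n,n,n).
          (n := N.toAddSubgroup.index) (by exact_mod_cast hN.index_ne_zero)
          (by
            have := AddSubgroup.nsmul_index_mem N.toAddSubgroup (1 : Λ)
            refine ⟨_, this, ?_⟩
            simp [Prod.ext_iff])
        refine ⟨⟨p, fun v hv => ?_⟩, Subtype.ext (SetLike.ext fun x => ?_)⟩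
        · have h := natTriple_mul_mem_scaledLattice.2 hv
          rw [← hp] at h
          obtain ⟨x, -, hx⟩ := h
          exact (hg _).2 ⟨x, hx⟩
        · rw [← hmem]
          exact (SetLike.ext_iff.1 hp (g x)).symm)

theorem idealEquiv_index (hinj : Function.Injective g)
    (hg : ∀ v, v ∈ gqLattice ℤ 5 ↔ ∃ x, g x = v) (p : IdealParam) :
    (idealEquiv g hinj hg p).1.toAddSubgroup.index * 27 =
      3 ^ typeDepth (stableType p.1.1) * (p.1.2.1 * p.1.2.2.1 * p.1.2.2.2) :=
  index_idealOfParam g hg p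

end Ideals

/-! ### Summation over the ideals -/

section Zeta

theorem hasSum_of_eq {ι : Type*} {f g : ι → ℂ} {a : ℂ} (h : ∀ i, f i = g i) (hg : HasSum g a) :
    HasSum f a := by
  rwa [funext h]

theorem hasSum_mul_of_summable_norm {R ι κ : Type*} [NormedRing R] [CompleteSpace R] {f : ι → R}
    {g : κ → R} {a b : R} (hf : HasSum f a) (hg : HasSum g b) (nf : Summable fun i => ‖f i‖)
    (ng : Summable fun i => ‖g i‖) : HasSum (fun p : ι × κ => f p.1 * g p.2) (a * b) := by
  have := summable_mul_of_summable_norm nf ng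
  exact hf.mul hg this

theorem hasSum_mul_mul {R ι κ μ : Type*} [NormedRing R] [CompleteSpace R] {f : ι → R} {g : κ → R}
    {h : μ → R} {a b c : R} (hf : HasSum f a) (hg : HasSum g b) (hh : HasSum h c)
    (nf : Summable fun i => ‖f i‖) (ng : Summable fun i => ‖g i‖) (nh : Summable fun i => ‖h i‖) :
    HasSum (fun p : ι × κ × μ => f p.1 * (g p.2.1 * h p.2.2)) (a * (b * c)) := by
  have hgh := hasSum_mul_of_summable_norm hg hh ng nh
  have ngh := ng.mul_norm nh
  exact hasSum_mul_of_summable_norm (g := fun p : κ × μ => g p.1 * h p.2) hf hgh nf ngh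

theorem hasSum_pnat_cpow {s : ℂ} (hs : 1 < s.re) :
    HasSum (fun n : ℕ+ => (n : ℂ) ^ (-s)) (riemannZeta s) := by
  have hs0 : s ≠ 0 := by
    rintro rfl
    norm_num at hs
  have h : HasSum (fun n : ℕ => (n : ℂ) ^ (-s)) (riemannZeta s) := by
    have h1 := (Complex.summable_one_div_nat_cpow.2 hs).hasSum
    rw [← zeta_eq_tsum_one_div_nat_cpow hs] at h1
    convert h1 using 2 with n
    rw [Complex.cpow_neg, one_div]
  refine (PNat.coe_injective.hasSum_iff fun n hn => ?_).2 h
  obtain rfl : n = 0 := by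
    by_contra h0
    exact hn ⟨⟨n, Nat.pos_of_ne_zero h0⟩, rfl⟩
  simp [Complex.zero_cpow (neg_ne_zero.2 hs0)]

theorem hasSum_pnat_dvd_cpow {s : ℂ} (hs : 1 < s.re) (m : ℕ+) :
    HasSum (fun n : ℕ+ => if (m : ℕ) ∣ n then (n : ℂ) ^ (-s) else 0)
      ((m : ℂ) ^ (-s) * riemannZeta s) := by
  have hinj : Function.Injective (fun n : ℕ+ => m * n) := fun a b h => mul_left_cancel h
  rw [← hinj.hasSum_iff]
  · refine hasSum_of_eq (fun n => ?_) ((hasSum_pnat_cpow hs).mul_left ((m : ℂ) ^ (-s)))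
    simp only [Function.comp_apply, PNat.mul_coe, dvd_mul_right, if_true, Nat.cast_mul]
    exact Complex.natCast_mul_natCast_cpow _ _ _
  · intro n hn
    rw [if_neg]
    rintro ⟨k, hk⟩
    have hk0 : 0 < k := Nat.pos_of_ne_zero fun h => n.ne_zero (by rw [hk, h, mul_zero])
    exact hn ⟨⟨k, hk0⟩, PNat.coe_injective hk.symm⟩

/-- The summands of the Riemann zeta function with given truncated 3-adic valuation. -/
def valTerm (s : ℂ) (i : Fin 3) (n : ℕ+) : ℂ := if truncVal n = i then (n : ℂ) ^ (-s) else 0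

/-- The Euler factor of `valTerm`, in terms of `x = 3^(-s)`. -/
def valFactor (x : ℂ) : Fin 3 → ℂ := ![1 - x, x - x ^ 2, x ^ 2]

/-- The multiples of 1, 3 and 9 contribute ζ, 3^(-s)ζ and 9^(-s)ζ; successive differences isolate
each valuation. -/
theorem hasSum_valTerm {s : ℂ} (hs : 1 < s.re) (i : Fin 3) :
    HasSum (valTerm s i) (valFactor ((3 : ℂ) ^ (-s)) i * riemannZeta s) := by
  have h1 := hasSum_pnat_cpow hs
  have h3 := hasSum_pnat_dvd_cpow hs 3
  have h9 := hasSum_pnat_dvd_cpow hs 9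
  have e9 : (((9 : ℕ+) : ℕ) : ℂ) ^ (-s) = ((3 : ℂ) ^ (-s)) ^ 2 := by
    have := Complex.natCast_mul_natCast_cpow 3 3 (-s)
    norm_num at this ⊢
    rw [this, sq]
  rw [e9] at h9
  have c3 : ((3 : ℕ+) : ℕ) = 3 := rfl
  have c9 : ((9 : ℕ+) : ℕ) = 9 := rfl
  simp only [c3, c9, Nat.cast_ofNat] at h3 h9
  fin_cases i
  · have e : valFactor ((3 : ℂ) ^ (-s)) 0 * riemannZeta s =
        riemannZeta s - (3 : ℂ) ^ (-s) * riemannZeta s := by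
      simp only [valFactor, Matrix.cons_val_zero]
      ring
    change HasSum _ (valFactor ((3 : ℂ) ^ (-s)) 0 * riemannZeta s)
    rw [e]
    refine hasSum_of_eq (fun n => ?_) (h1.sub h3)
    simp only [valTerm, truncVal]
    split_ifs <;> simp_all <;> omega
  · have e : valFactor ((3 : ℂ) ^ (-s)) 1 * riemannZeta s =
        (3 : ℂ) ^ (-s) * riemannZeta s - ((3 : ℂ) ^ (-s)) ^ 2 * riemannZeta s := by
      simp only [valFactor, Matrix.cons_val_one, Matrix.cons_val_zero]
      ring
    change HasSum _ (valFactor ((3 : ℂ) ^ (-s)) 1 * riemannZeta s)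
    rw [e]
    refine hasSum_of_eq (fun n => ?_) (h3.sub h9)
    simp only [valTerm, truncVal]
    split_ifs <;> simp_all <;> omega
  · refine hasSum_of_eq (fun n => ?_) h9
    simp only [valTerm, truncVal]
    split_ifs <;> simp_all <;> omega

theorem truncVal_lt (n : ℕ) : truncVal n < 3 := by
  unfold truncVal
  split_ifs <;> norm_num

/-- A weight that sees only truncated valuations is constant on 27 boxes, and over each box the
triple series is a product of three absolutely convergent ones. -/
theorem hasSum_truncVal {s : ℂ} (hs : 1 < s.re) (Q : ℕ → ℕ → ℕ → ℂ) :
    HasSum (fun a : ℕ+ × ℕ+ × ℕ+ => Q (truncVal a.1) (truncVal a.2.1) (truncVal a.2.2) *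
        ((a.1 : ℂ) ^ (-s) * ((a.2.1 : ℂ) ^ (-s) * (a.2.2 : ℂ) ^ (-s))))
      (∑ i : Fin 3, ∑ j : Fin 3, ∑ l : Fin 3, Q i j l *
        (valFactor ((3 : ℂ) ^ (-s)) i * riemannZeta s *
          (valFactor ((3 : ℂ) ^ (-s)) j * riemannZeta s *
            (valFactor ((3 : ℂ) ^ (-s)) l * riemannZeta s)))) := by
  have h : ∀ i j l : Fin 3, HasSum (fun a : ℕ+ × ℕ+ × ℕ+ =>
      valTerm s i a.1 * (valTerm s j a.2.1 * valTerm s l a.2.2))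
      (valFactor ((3 : ℂ) ^ (-s)) i * riemannZeta s *
          (valFactor ((3 : ℂ) ^ (-s)) j * riemannZeta s *
            (valFactor ((3 : ℂ) ^ (-s)) l * riemannZeta s))) := by
    exact fun i j l => hasSum_mul_mul (hasSum_valTerm hs i) (hasSum_valTerm hs j)
      (hasSum_valTerm hs l) (hasSum_valTerm hs i).summable.norm
      (hasSum_valTerm hs j).summable.norm (hasSum_valTerm hs l).summable.norm
  have h' := hasSum_sum (s := Finset.univ) fun (i : Fin 3) _ =>
    hasSum_sum (s := Finset.univ) fun (j : Fin 3) _ =>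
      hasSum_sum (s := Finset.univ) fun (l : Fin 3) _ => (h i j l).mul_left (Q i j l)
  refine hasSum_of_eq (fun a => ?_) h'
  obtain ⟨a, b, c⟩ := a
  have single : ∀ (n : ℕ+) (i : Fin 3), valTerm s i n =
      if i = ⟨truncVal n, truncVal_lt n⟩ then (n : ℂ) ^ (-s) else 0 := fun n i => by
    unfold valTerm
    congr 1
    rw [Fin.ext_iff]
    exact propext eq_comm
  simp only [single, mul_ite, ite_mul, zero_mul, mul_zero, Finset.sum_ite_eq', Finset.mem_univ,
    if_true]

open Classical in
theorem sum_stableLattice_colon (x : ℂ) (a b c : ℕ) :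
    (∑ k : Fin 27, if ∀ v ∈ stableLattice k, natTriple a b c * v ∈ gqLattice ℤ 5 then
        x ^ typeDepth (stableType k) else 0) =
      ∑ d : Fin 4, (colonCount (truncVal a) (truncVal b) (truncVal c) d : ℂ) * x ^ (d : ℕ) := by
  have hd : ∀ k, typeDepth (stableType k) < 4 := by decide +kernel
  rw [← Finset.sum_fiberwise (s := Finset.univ)
    (g := fun k => (⟨typeDepth (stableType k), hd k⟩ : Fin 4))]
  refine Finset.sum_congr rfl fun d _ => ?_
  rw [← card_stableLattice_colon, ← Finset.sum_filter, Finset.filter_filter,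
    Finset.card_eq_sum_ones, Nat.cast_sum, Finset.sum_mul]
  have e : (Finset.univ.filter fun k => (⟨typeDepth (stableType k), hd k⟩ : Fin 4) = d ∧
      ∀ v ∈ stableLattice k, natTriple a b c * v ∈ gqLattice ℤ 5) =
      Finset.univ.filter fun k => typeDepth (stableType k) = (d : ℕ) ∧
      ∀ v ∈ stableLattice k, natTriple a b c * v ∈ gqLattice ℤ 5 := by
    ext k
    simp [Fin.ext_iff]
  rw [e]
  refine Finset.sum_congr rfl fun k hk => ?_
  rw [(Finset.mem_filter.1 hk).2.1]
  simp

/-- The Euler factor at 3 of the zeta function of `gqLattice ℤ 5`. -/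
def gqEulerFactor (x : ℂ) : ℂ :=
  27 * x ^ 6 - 18 * x ^ 5 + 12 * x ^ 4 + 3 * x ^ 3 + 4 * x ^ 2 - 2 * x + 1

/-- The factor x³ on the right accounts for the index 27 of the order in ℤ³. -/
theorem sum_colonCount_valFactor (x z : ℂ) :
    (∑ i : Fin 3, ∑ j : Fin 3, ∑ l : Fin 3,
      (∑ d : Fin 4, (colonCount i j l d : ℂ) * x ^ (d : ℕ)) *
        (valFactor x i * z * (valFactor x j * z * (valFactor x l * z)))) =
      x ^ 3 * (gqEulerFactor x * z ^ 3) := by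
  simp only [Fin.sum_univ_succ, Fin.sum_univ_zero]
  simp [colonCount, valFactor, gqEulerFactor]
  ring

-- Extended by zero to all parameters, the family is absolutely summable. The finite sum over stable
-- lattices can then be taken inside, where it is the count by depth.
open Classical in
theorem hasSum_idealParam {s : ℂ} (hs : 1 < s.re) :
    HasSum (fun p : IdealParam => ((3 : ℂ) ^ (-s)) ^ typeDepth (stableType p.1.1) *
        ((p.1.2.1 : ℂ) ^ (-s) * ((p.1.2.2.1 : ℂ) ^ (-s) * (p.1.2.2.2 : ℂ) ^ (-s))))
      (((3 : ℂ) ^ (-s)) ^ 3 * (gqEulerFactor ((3 : ℂ) ^ (-s)) * riemannZeta s ^ 3)) := by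
  set x := (3 : ℂ) ^ (-s) with hx
  set A : Set (Fin 27 × ℕ+ × ℕ+ × ℕ+) := {p |
    ∀ v ∈ stableLattice p.1, natTriple p.2.1 p.2.2.1 p.2.2.2 * v ∈ gqLattice ℤ 5} with hA
  set F : Fin 27 × ℕ+ × ℕ+ × ℕ+ → ℂ := fun p => x ^ typeDepth (stableType p.1) *
    ((p.2.1 : ℂ) ^ (-s) * ((p.2.2.1 : ℂ) ^ (-s) * (p.2.2.2 : ℂ) ^ (-s))) with hF
  have hsumF : Summable F := by
    have h1 : Summable fun k : Fin 27 => x ^ typeDepth (stableType k) := (hasSum_fintype _).summable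
    have h2 := (hasSum_truncVal hs fun _ _ _ => 1).summable
    simp only [one_mul] at h2
    exact summable_mul_of_summable_norm (f := fun k : Fin 27 => x ^ typeDepth (stableType k))
      (g := fun a : ℕ+ × ℕ+ × ℕ+ =>
        (a.1 : ℂ) ^ (-s) * ((a.2.1 : ℂ) ^ (-s) * (a.2.2 : ℂ) ^ (-s))) h1.norm h2.norm
  have hind := hsumF.indicator A
  have key : ∑' p, A.indicator F p =
      x ^ 3 * (gqEulerFactor x * riemannZeta s ^ 3) := by
    rw [hind.tsum_prod, tsum_fintype, ← Summable.tsum_finsetSum fun k _ => hind.prod_factor k,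
      ← sum_colonCount_valFactor]
    refine Eq.trans ?_ (hasSum_truncVal hs fun i j l =>
      ∑ d : Fin 4, (colonCount i j l d : ℂ) * x ^ (d : ℕ)).tsum_eq
    refine tsum_congr fun ⟨a, b, c⟩ => ?_
    rw [← sum_stableLattice_colon, Finset.sum_mul]
    refine Finset.sum_congr rfl fun k _ => ?_
    rw [Set.indicator_apply, ite_mul, zero_mul]
    rfl
  have h := hind.hasSum
  rw [key] at h
  exact (hasSum_subtype_iff_indicator (f := F) (s := A)).2 h

theorem hasSum_solomonTerm {Λ : Type*} [Ring Λ] (g : Λ →+* ℤ × ℤ × ℤ)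
    (hinj : Function.Injective g) (hg : ∀ v, v ∈ gqLattice ℤ 5 ↔ ∃ x, g x = v)
    {s : ℂ} (hs : 1 < s.re) :
    HasSum (solomonTerm Λ Λ s) (gqEulerFactor ((3 : ℂ) ^ (-s)) * riemannZeta s ^ 3) := by
  have hx : (3 : ℂ) ^ (-s) ≠ 0 := by simp [Complex.cpow_eq_zero_iff]
  rw [← (idealEquiv g hinj hg).hasSum_iff]
  have h := (hasSum_idealParam hs).mul_left ((((3 : ℂ) ^ (-s)) ^ 3)⁻¹)
  rw [inv_mul_cancel_left₀ (pow_ne_zero 3 hx)] at h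
  refine hasSum_of_eq (fun p => ?_) h
  rw [eq_inv_mul_iff_mul_eq₀ (pow_ne_zero 3 hx)]
  have e := idealEquiv_index g hinj hg p
  have pw : ∀ n : ℕ, ((3 ^ n : ℕ) : ℂ) ^ (-s) = ((3 : ℂ) ^ (-s)) ^ n := by
    intro n
    induction n with
    | zero => simp
    | succ n ih => rw [pow_succ, Nat.cast_mul, Complex.natCast_mul_natCast_cpow, ih, pow_succ,
        Nat.cast_ofNat]
  have e' : ((_ : ℕ) : ℂ) ^ (-s) = ((_ : ℕ) : ℂ) ^ (-s) := congrArg (fun n : ℕ => (n : ℂ) ^ (-s)) e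
  have mul : ∀ m n : ℕ, ((m * n : ℕ) : ℂ) ^ (-s) = (m : ℂ) ^ (-s) * (n : ℂ) ^ (-s) := fun m n => by
    rw [Nat.cast_mul, Complex.natCast_mul_natCast_cpow]
  have pw27 : ((27 : ℕ) : ℂ) ^ (-s) = ((3 : ℂ) ^ (-s)) ^ 3 := pw 3
  rw [mul, mul, mul, mul, pw27, pw] at e'
  rw [mul_comm, ← mul_assoc (((p.1.2.1 : ℕ) : ℂ) ^ (-s))]
  exact e'

theorem gqEulerFactor_eq (s : ℂ) : gqEulerFactor ((3 : ℂ) ^ (-s)) =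
    (3 : ℂ) ^ (3 - 6 * s) - 2 * (3 : ℂ) ^ (2 - 5 * s) + 4 * (3 : ℂ) ^ (1 - 4 * s) +
        (3 : ℂ) ^ (1 - 3 * s) + 4 * (3 : ℂ) ^ (-2 * s) - 2 * (3 : ℂ) ^ (-s) + 1 := by
  have key : ∀ m n : ℕ, (3 : ℂ) ^ ((m : ℂ) - n * s) = 3 ^ m * ((3 : ℂ) ^ (-s)) ^ n := by
    intro m n
    rw [sub_eq_add_neg, Complex.cpow_add _ _ (by norm_num), Complex.cpow_natCast, ← mul_neg,
      Complex.cpow_nat_mul]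
  have k1 := key 3 6
  have k2 := key 2 5
  have k3 := key 1 4
  have k4 := key 1 3
  have k5 := key 0 2
  norm_num at k1 k2 k3 k4 k5
  rw [k1, k2, k3, k4, gqEulerFactor]
  rw [show -2 * s = -(2 * s) by ring, k5]
  ring

end Zeta

/-! ### The adjacency algebra in coordinates -/

section SchemeAlgebra

variable {P L : Type*} [Fintype P] [DecidableEq P] {I : P → L → Prop}

/-- An entry at a pair in the i-th relation reads off the i-th coefficient. -/
theorem AssociationScheme.linearIndependent_adjMatrix {X ι : Type*} [Fintype X] [DecidableEq X]
    [Fintype ι] [DecidableEq ι] (S : AssociationScheme X ι) (R K : Type*) [CommRing R] [CommRing K]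
    [Algebra R K] (hinj : Function.Injective (algebraMap R K)) :
    LinearIndependent R (S.adjMatrix K) := by
  rw [Fintype.linearIndependent_iff]
  intro c hc i
  obtain ⟨x, y, hxy⟩ := S.nonempty_rel i
  have h := congrFun (congrFun hc x) y
  rw [Matrix.sum_apply] at h
  simp only [Matrix.smul_apply, AssociationScheme.adjMatrix, Matrix.of_apply, hxy,
    Matrix.zero_apply, Algebra.smul_def, mul_ite, mul_one, mul_zero, Finset.sum_ite_eq, Finset.mem_univ, if_true] at h
  exact hinj (h.trans (map_zero _).symm)

variable (hI : IsGeneralizedQuadrangle I 2 1) (K : Type*) [Field K]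

/-- The adjacency matrices of a generalized quadrangle of order `(2, 1)`. -/
abbrev gqAdj (i : Fin 3) : Matrix P P K := hI.associationScheme.adjMatrix K i

/-- The parameter identity k(k − λ − 1) = (v − k − 1)μ reads 8 = 2(v − 5). -/
theorem gq_card_points (hI : IsGeneralizedQuadrangle I 2 1) : Fintype.card P = 9 := by
  classical
  have h := SimpleGraph.IsSRGWith.param_eq _ hI.isSRGWith
    (Fintype.card_pos_iff.2 hI.nonempty_points)
  simp at h
  omega

theorem gq_adjMatrix_zero : gqAdj hI K 0 = 1 := by
  ext x y
  by_cases e : x = y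
  · subst e
    simp [AssociationScheme.adjMatrix, IsGeneralizedQuadrangle.associationScheme,
      SimpleGraph.IsSRGWith.associationScheme, SimpleGraph.pairColor]
  · by_cases a : (collinearityGraph I).Adj x y <;>
    simp [AssociationScheme.adjMatrix, IsGeneralizedQuadrangle.associationScheme,
      SimpleGraph.IsSRGWith.associationScheme, SimpleGraph.pairColor, e, a]

open Classical in
theorem gq_adjMatrix_one : gqAdj hI K 1 = (collinearityGraph I).adjMatrix K := by
  ext x y
  by_cases e : x = y
  · subst e
    simp [AssociationScheme.adjMatrix, IsGeneralizedQuadrangle.associationScheme,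
      SimpleGraph.IsSRGWith.associationScheme, SimpleGraph.pairColor]
  · by_cases a : (collinearityGraph I).Adj x y <;>
    simp [AssociationScheme.adjMatrix, IsGeneralizedQuadrangle.associationScheme,
      SimpleGraph.IsSRGWith.associationScheme, SimpleGraph.pairColor, e, a]

open Classical in
theorem gq_adjMatrix_two : gqAdj hI K 2 = (collinearityGraph I)ᶜ.adjMatrix K := by
  ext x y
  by_cases e : x = y
  · subst e
    simp [AssociationScheme.adjMatrix, IsGeneralizedQuadrangle.associationScheme,
      SimpleGraph.IsSRGWith.associationScheme, SimpleGraph.pairColor]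
  · by_cases a : (collinearityGraph I).Adj x y <;>
    simp [AssociationScheme.adjMatrix, IsGeneralizedQuadrangle.associationScheme,
      SimpleGraph.IsSRGWith.associationScheme, SimpleGraph.pairColor, e, a]

theorem gq_sum_adjMatrix : gqAdj hI K 0 + gqAdj hI K 1 + gqAdj hI K 2 = Matrix.of fun _ _ => 1 := by
  ext x y
  have h : ∀ c : Fin 3, ((if c = 0 then 1 else 0) + (if c = 1 then 1 else 0) +
      (if c = 2 then 1 else 0) : K) = 1 := by
    intro c
    fin_cases c <;> simp
  exact h _

theorem gq_one_mul_one : gqAdj hI K 1 * gqAdj hI K 1 =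
    (4 : K) • gqAdj hI K 0 + gqAdj hI K 1 + (2 : K) • gqAdj hI K 2 := by
  classical
  have h := hI.isSRGWith.matrix_eq (α := K)
  rw [gq_adjMatrix_zero, gq_adjMatrix_one, gq_adjMatrix_two, ← sq, h]
  simp [← Nat.cast_smul_eq_nsmul K]

open Classical in
theorem gq_one_mul_ones : gqAdj hI K 1 * (Matrix.of fun _ _ => 1) =
    (4 : K) • Matrix.of fun _ _ => 1 := by
  rw [gq_adjMatrix_one]
  ext x y
  have := hI.isSRGWith.regular x
  simp [SimpleGraph.adjMatrix_mul_apply, this]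

open Classical in
theorem gq_ones_mul_one : (Matrix.of fun _ _ => 1) * gqAdj hI K 1 =
    (4 : K) • Matrix.of fun _ _ => 1 := by
  rw [gq_adjMatrix_one]
  ext x y
  have := hI.isSRGWith.regular y
  simp [SimpleGraph.mul_adjMatrix_apply, this]

theorem gq_ones_mul_ones (hI : IsGeneralizedQuadrangle I 2 1) (K : Type*) [Field K] :
    (Matrix.of fun _ _ => 1 : Matrix P P K) * (Matrix.of fun _ _ => 1) =
    (9 : K) • Matrix.of fun _ _ => 1 := by
  ext x y
  simp [Matrix.mul_apply, gq_card_points hI]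

/-- With J = b₀ + b₁ + b₂, expand b₁J = 4J and solve for the unknown product. -/
theorem gq_one_mul_two : gqAdj hI K 1 * gqAdj hI K 2 =
    (2 : K) • gqAdj hI K 1 + (2 : K) • gqAdj hI K 2 := by
  have h := gq_one_mul_ones hI K
  rw [← gq_sum_adjMatrix hI, mul_add, mul_add, gq_one_mul_one, gq_adjMatrix_zero, mul_one] at h
  rw [← sub_eq_zero] at h ⊢
  rw [← h]
  module

theorem gq_two_mul_one : gqAdj hI K 2 * gqAdj hI K 1 =
    (2 : K) • gqAdj hI K 1 + (2 : K) • gqAdj hI K 2 := by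
  have h := gq_ones_mul_one hI K
  rw [← gq_sum_adjMatrix hI, add_mul, add_mul, gq_one_mul_one, gq_adjMatrix_zero, one_mul] at h
  rw [← sub_eq_zero] at h ⊢
  rw [← h]
  module

theorem gq_two_mul_two : gqAdj hI K 2 * gqAdj hI K 2 =
    (4 : K) • gqAdj hI K 0 + (2 : K) • gqAdj hI K 1 + gqAdj hI K 2 := by
  have h := gq_ones_mul_ones hI K
  rw [← gq_sum_adjMatrix hI] at h
  simp only [mul_add, add_mul, gq_one_mul_one, gq_one_mul_two, gq_two_mul_one,
    gq_adjMatrix_zero, mul_one, one_mul] at h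
  rw [gq_adjMatrix_zero, ← sub_eq_zero]
  rw [← sub_eq_zero] at h
  rw [← h]
  module

variable [CharZero K]

theorem gqIdempotent_mul_self (i : Fin 3) :
    gqIdempotent hI.associationScheme K i * gqIdempotent hI.associationScheme K i =
      gqIdempotent hI.associationScheme K i := by
  have h11 := gq_one_mul_one hI K
  have h12 := gq_one_mul_two hI K
  have h21 := gq_two_mul_one hI K
  have h22 := gq_two_mul_two hI K
  have h0 := gq_adjMatrix_zero hI K
  unfold gqAdj at *
  fin_cases i <;>
  · simp only [gqIdempotent, mul_add, add_mul, smul_mul_smul_comm, smul_add, h11, h12, h21, h22,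
      h0, mul_one, one_mul, smul_smul]
    simp
    module

theorem gqIdempotent_mul_of_ne {i j : Fin 3} (hij : i ≠ j) :
    gqIdempotent hI.associationScheme K i * gqIdempotent hI.associationScheme K j = 0 := by
  have h11 := gq_one_mul_one hI K
  have h12 := gq_one_mul_two hI K
  have h21 := gq_two_mul_one hI K
  have h22 := gq_two_mul_two hI K
  have h0 := gq_adjMatrix_zero hI K
  unfold gqAdj at *
  fin_cases i <;> fin_cases j <;> first
  | exact absurd rfl hij
  | (simp only [gqIdempotent, mul_add, add_mul, smul_mul_smul_comm, smul_add, h11, h12, h21, h22,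
      h0, mul_one, one_mul, smul_smul]
     simp
     module)

theorem gqIdempotent_sum : gqIdempotent hI.associationScheme K 0 +
    gqIdempotent hI.associationScheme K 1 + gqIdempotent hI.associationScheme K 2 = 1 := by
  rw [← gq_adjMatrix_zero hI K]
  simp [gqIdempotent]
  module

/-- The coordinates with respect to `e₀, e₁, e₂`, as a linear map. -/
def gqLinear : K × K × K →ₗ[K] Matrix P P K where
  toFun v := v.1 • gqIdempotent hI.associationScheme K 0 +
    v.2.1 • gqIdempotent hI.associationScheme K 1 + v.2.2 • gqIdempotent hI.associationScheme K 2
  map_add' v w := by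
    simp only [Prod.fst_add, Prod.snd_add]
    module
  map_smul' c v := by
    simp only [Prod.smul_fst, Prod.smul_snd, smul_eq_mul, RingHom.id_apply]
    module

/-- The coordinates with respect to `e₀, e₁, e₂`, as a homomorphism of algebras. -/
def gqHom : K × K × K →ₐ[K] Matrix P P K :=
  AlgHom.ofLinearMap (gqLinear hI K)
    (by
      change (1 : K) • gqIdempotent hI.associationScheme K 0 +
        (1 : K) • gqIdempotent hI.associationScheme K 1 +
        (1 : K) • gqIdempotent hI.associationScheme K 2 = 1
      rw [one_smul, one_smul, one_smul, gqIdempotent_sum])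
    (by
      intro v w
      simp only [gqLinear, LinearMap.coe_mk, AddHom.coe_mk, mul_add, add_mul, smul_mul_smul_comm,
        gqIdempotent_mul_self, Prod.fst_mul, Prod.snd_mul]
      rw [gqIdempotent_mul_of_ne hI K (by decide : (0 : Fin 3) ≠ 1),
        gqIdempotent_mul_of_ne hI K (by decide : (0 : Fin 3) ≠ 2),
        gqIdempotent_mul_of_ne hI K (by decide : (1 : Fin 3) ≠ 0),
        gqIdempotent_mul_of_ne hI K (by decide : (1 : Fin 3) ≠ 2),
        gqIdempotent_mul_of_ne hI K (by decide : (2 : Fin 3) ≠ 0),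
        gqIdempotent_mul_of_ne hI K (by decide : (2 : Fin 3) ≠ 1)]
      simp)

theorem gqHom_apply (v : K × K × K) : gqHom hI K v =
    v.1 • gqIdempotent hI.associationScheme K 0 +
    v.2.1 • gqIdempotent hI.associationScheme K 1 +
    v.2.2 • gqIdempotent hI.associationScheme K 2 := rfl

theorem gqHom_tripleBasis (i : Fin 3) :
    gqHom hI K (tripleBasis K i) = gqIdempotent hI.associationScheme K i := by
  fin_cases i <;> simp [gqHom_apply, tripleBasis]

theorem gqHom_injective : Function.Injective (gqHom hI K) := by
  rw [injective_iff_map_eq_zero]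
  rintro ⟨x, y, z⟩ h
  have hli := hI.associationScheme.linearIndependent_adjMatrix K K Function.injective_id
  rw [Fintype.linearIndependent_iff] at hli
  have h' := hli ![(9 : K)⁻¹ * (x + 4 * y + 4 * z), (9 : K)⁻¹ * (x - 2 * y + z),
    (9 : K)⁻¹ * (x + y - 2 * z)] (by
      rw [← h, gqHom_apply, Fin.sum_univ_three]
      simp [gqIdempotent]
      module)
  have h0 : x + 4 * y + 4 * z = 0 := by simpa using h' 0
  have h1 : x - 2 * y + z = 0 := by simpa using h' 1
  have h2 : x + y - 2 * z = 0 := by simpa using h' 2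
  have h9 : (9 : K) ≠ 0 := by norm_num
  have hx : x = 0 := by
    refine (mul_eq_zero.1 (?_ : 9 * x = 0)).resolve_left h9
    linear_combination h0 + 4 * h1 + 4 * h2
  have hy : y = 0 := by
    refine (mul_eq_zero.1 (?_ : 9 * y = 0)).resolve_left h9
    linear_combination h0 - 2 * h1 + h2
  have hz : z = 0 := by
    refine (mul_eq_zero.1 (?_ : 9 * z = 0)).resolve_left h9
    linear_combination h0 + h1 - 2 * h2
  rw [hx, hy, hz]
  rfl

/-- The coordinatewise extension of scalars. -/
def castTriple (R K : Type*) [CommRing R] [CommRing K] [Algebra R K] :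
    R × R × R →ₐ[R] K × K × K :=
  (Algebra.ofId R K).prodMap ((Algebra.ofId R K).prodMap (Algebra.ofId R K))

theorem castTriple_apply {R K : Type*} [CommRing R] [CommRing K] [Algebra R K] (v : R × R × R) :
    castTriple R K v = (algebraMap R K v.1, algebraMap R K v.2.1, algebraMap R K v.2.2) := rfl

theorem castTriple_injective {R K : Type*} [CommRing R] [CommRing K] [Algebra R K]
    (h : Function.Injective (algebraMap R K)) : Function.Injective (castTriple R K) :=
  h.prodMap (h.prodMap h)

/-- The triples list the eigenvalues of each matrix on the images of e₀, e₁, e₂. -/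
theorem gqAdj_eq_gqHom (i : Fin 3) : gqAdj hI K i = gqHom hI K
    (![(1, 1, 1), (4, -2, 1), (4, 1, -2)] i) := by
  rw [gqHom_apply]
  fin_cases i <;> simp [gqIdempotent, gqAdj] <;> module

/-- The adjacency algebra over `R` consists of the matrices with coordinates in
`gqLattice R 5`. -/
theorem mem_gq_adjacencyAlgebra_iff (R : Type*) [CommRing R] [Algebra R K] (m : Matrix P P K) :
    m ∈ hI.associationScheme.adjacencyAlgebra R K ↔
      ∃ v ∈ gqLattice R 5, gqHom hI K (castTriple R K v) = m := by
  set ψ : R × R × R →ₗ[R] Matrix P P K :=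
    ((gqHom hI K).restrictScalars R).toLinearMap ∘ₗ (castTriple R K).toLinearMap with hψ
  have hspan : Submodule.span R (Set.range (hI.associationScheme.adjMatrix K)) =
      (gqLattice R 5).map ψ := by
    have hb : ∀ i, hI.associationScheme.adjMatrix K i =
        ψ (![(1, 1, 1), (4, -2, 1), (4, 1, -2)] i) := by
      intro i
      refine (gqAdj_eq_gqHom hI K i).trans (congrArg (gqHom hI K) ?_)
      fin_cases i <;> simp [castTriple_apply, map_ofNat (algebraMap R K) 2,
        map_ofNat (algebraMap R K) 4]
    apply le_antisymm
    · rw [Submodule.span_le]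
      rintro _ ⟨i, rfl⟩
      rw [hb]
      refine Submodule.mem_map_of_mem ?_
      fin_cases i
      · exact mem_gqLattice_five.2 ⟨by simp, ⟨0, by norm_num⟩⟩
      · exact mem_gqLattice_five.2 ⟨⟨-2, by norm_num⟩, ⟨1, by norm_num⟩⟩
      · exact mem_gqLattice_five.2 ⟨⟨-1, by norm_num⟩, ⟨0, by norm_num⟩⟩
    · rw [← span_gqLatticeBasis_tripleBasis, gqLatticeBasis_tripleBasis, Submodule.map_span,
        Submodule.span_le]
      rintro _ ⟨_, ⟨j, rfl⟩, rfl⟩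
      have m0 := Submodule.subset_span (R := R)
        (Set.mem_range_self (f := hI.associationScheme.adjMatrix K) 0)
      have m1 := Submodule.subset_span (R := R)
        (Set.mem_range_self (f := hI.associationScheme.adjMatrix K) 1)
      have m2 := Submodule.subset_span (R := R)
        (Set.mem_range_self (f := hI.associationScheme.adjMatrix K) 2)
      rw [hb] at m0 m1 m2
      -- In coordinates (0,3,6) = 4b₀ − b₂ and (0,0,9) = b₁ − 2b₂ + 4b₀.
      fin_cases j
      · exact m0
      · have := Submodule.sub_mem _ (Submodule.smul_mem _ (4 : R) m0) m2
        rw [← map_smul, ← map_sub] at this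
        have e : (4 : R) • (![(1, 1, 1), (4, -2, 1), (4, 1, -2)] : Fin 3 → R × R × R) 0 -
            ![(1, 1, 1), (4, -2, 1), (4, 1, -2)] 2 = gqLatticeCoord R 5 1 := by
          ext <;> simp [gqLatticeCoord] <;> norm_num
        rw [e] at this
        exact this
      · have := Submodule.add_mem _ (Submodule.sub_mem _ m1 (Submodule.smul_mem _ (2 : R) m2))
          (Submodule.smul_mem _ (4 : R) m0)
        rw [← map_smul, ← map_smul, ← map_sub, ← map_add] at this
        have e : (![(1, 1, 1), (4, -2, 1), (4, 1, -2)] : Fin 3 → R × R × R) 1 -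
            (2 : R) • ![(1, 1, 1), (4, -2, 1), (4, 1, -2)] 2 +
            (4 : R) • ![(1, 1, 1), (4, -2, 1), (4, 1, -2)] 0 = gqLatticeCoord R 5 2 := by
          ext <;> simp [gqLatticeCoord] <;> norm_num
        rw [e] at this
        exact this
  rw [AssociationScheme.adjacencyAlgebra, Submodule.mem_toSubalgebra, hspan]
  rfl

end SchemeAlgebra

/-! ### Relevant primes -/

section RelevantPrimes

/-- The standard basis of `ℤ × ℤ × ℤ`. -/
def intTripleBasis : Module.Basis (Fin 3) ℤ (ℤ × ℤ × ℤ) :=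
  Module.Basis.ofEquivFun
    { toFun := fun v => ![v.1, v.2.1, v.2.2]
      invFun := fun f => (f 0, f 1, f 2)
      map_add' := fun v w => by ext i; fin_cases i <;> rfl
      map_smul' := fun c v => by ext i; fin_cases i <;> rfl
      left_inv := fun v => rfl
      right_inv := fun f => by ext i; fin_cases i <;> rfl }

theorem intTripleBasis_apply (i : Fin 3) : intTripleBasis i = tripleBasis ℤ i := by
  rw [intTripleBasis, Module.Basis.coe_ofEquivFun]
  change ((Pi.single i 1 : Fin 3 → ℤ) 0, (Pi.single i 1 : Fin 3 → ℤ) 1,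
    (Pi.single i 1 : Fin 3 → ℤ) 2) = _
  fin_cases i <;> simp [tripleBasis]

theorem trace_int_triple (v : ℤ × ℤ × ℤ) : Algebra.trace ℤ (ℤ × ℤ × ℤ) v = v.1 + v.2.1 + v.2.2 := by
  rw [Algebra.trace_prod_apply, Algebra.trace_prod_apply, Algebra.trace_self_apply,
    Algebra.trace_self_apply, Algebra.trace_self_apply, add_assoc]

/-- The trace form is the identity matrix in the standard basis, and the discriminant over ℤ does
not depend on the basis. -/
theorem discr_int_triple (b : Module.Basis (Fin 3) ℤ (ℤ × ℤ × ℤ)) : Algebra.discr ℤ b = 1 := by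
  suffices h : Algebra.discr ℤ intTripleBasis = 1 from
    (Algebra.discr_eq_discr (ℤ × ℤ × ℤ) b intTripleBasis).trans h
  rw [Algebra.discr_def]
  have h : Algebra.traceMatrix ℤ intTripleBasis = 1 := by
    ext i j
    rw [Algebra.traceMatrix_apply, Algebra.traceForm_apply, trace_int_triple,
      intTripleBasis_apply, intTripleBasis_apply]
    fin_cases i <;> fin_cases j <;> simp [tripleBasis]
  rw [h, Matrix.det_one]

variable {M : Type*} [Ring M]

theorem isOrderDiscriminant_range_eq_one (ψ : ℤ × ℤ × ℤ →ₐ[ℤ] M) (hψ : Function.Injective ψ)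
    {d : ℤ} (h : IsOrderDiscriminant ψ.range d) : d = 1 := by
  obtain ⟨n, b, rfl⟩ := h
  set σ := AlgEquiv.ofInjective ψ hψ
  have hn : n = 3 := by
    have h1 := Module.finrank_eq_card_basis (b.map σ.symm.toLinearEquiv)
    have h2 := Module.finrank_eq_card_basis intTripleBasis
    rw [h1] at h2
    simpa using h2
  subst hn
  rw [← discr_int_triple (b.map σ.symm.toLinearEquiv), Algebra.discr_def]
  congr 1
  ext i j
  rw [Matrix.of_apply, Algebra.traceMatrix_apply, Algebra.traceForm_apply, Algebra.trace_apply,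
    ← LinearMap.trace_conj' _ σ.symm.toLinearEquiv]
  congr 1
  ext <;> simp [LinearEquiv.conj_apply]

variable [Algebra ℚ M]

/-- The homomorphism to `M` on integral triples. -/
def intTripleHom (φ : ℚ × ℚ × ℚ →ₐ[ℚ] M) : ℤ × ℤ × ℤ →ₐ[ℤ] M :=
  ((φ : ℚ × ℚ × ℚ →+* M).comp (castTriple ℤ ℚ : ℤ × ℤ × ℤ →+* ℚ × ℚ × ℚ)).toIntAlgHom

variable {φ : ℚ × ℚ × ℚ →ₐ[ℚ] M} (hφ : Function.Injective φ) {A : Subalgebra ℚ M}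
  (hA : ∀ m, m ∈ A ↔ ∃ v, φ v = m)

include hφ in
theorem intTripleHom_injective : Function.Injective (intTripleHom φ) :=
  hφ.comp (castTriple_injective Int.cast_injective)

include hA in
theorem isOrderIn_range_intTripleHom : IsOrderIn ℤ A (intTripleHom φ).range where
  fg := by
    have : Subalgebra.toSubmodule (intTripleHom φ).range =
        LinearMap.range (intTripleHom φ).toLinearMap := rfl
    rw [this, LinearMap.range_eq_map]
    exact Submodule.FG.map _ Module.Finite.fg_top
  span_eq := by
    apply le_antisymm
    · rw [Submodule.span_le]
      rintro _ ⟨v, rfl⟩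
      exact (hA _).2 ⟨_, rfl⟩
    · intro m hm
      obtain ⟨v, rfl⟩ := (hA m).1 hm
      have e : v = v.1 • castTriple ℤ ℚ (1, 0, 0) + v.2.1 • castTriple ℤ ℚ (0, 1, 0) +
          v.2.2 • castTriple ℤ ℚ (0, 0, 1) := by
        ext <;> simp [castTriple_apply]
      rw [e, map_add, map_add, map_smul, map_smul, map_smul]
      exact Submodule.add_mem _ (Submodule.add_mem _
        (Submodule.smul_mem _ _ (Submodule.subset_span ⟨_, rfl⟩))
        (Submodule.smul_mem _ _ (Submodule.subset_span ⟨_, rfl⟩)))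
        (Submodule.smul_mem _ _ (Submodule.subset_span ⟨_, rfl⟩))

-- Elements of an order are integral over ℤ, hence so are their rational coordinates, and ℤ is
-- integrally closed.
include hφ hA in
theorem IsOrderIn.le_range_intTripleHom {Γ : Subalgebra ℤ M} (hΓ : IsOrderIn ℤ A Γ) :
    Γ ≤ (intTripleHom φ).range := by
  intro m hm
  have hmA : m ∈ Subalgebra.toSubmodule A := by
    rw [← hΓ.span_eq]
    exact Submodule.subset_span hm
  obtain ⟨v, rfl⟩ := (hA m).1 hmA
  have hint : IsIntegral ℤ (φ v) := IsIntegral.of_mem_of_fg Γ hΓ.fg _ hm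
  have hv : IsIntegral ℤ v :=
    (isIntegral_algHom_iff (φ : ℚ × ℚ × ℚ →+* M).toIntAlgHom hφ).1 hint
  obtain ⟨a, ha⟩ := IsIntegrallyClosed.isIntegral_iff.1
    (hv.map (RingHom.fst ℚ (ℚ × ℚ)).toIntAlgHom)
  obtain ⟨b, hb⟩ := IsIntegrallyClosed.isIntegral_iff.1
    (hv.map ((RingHom.fst ℚ ℚ).comp (RingHom.snd ℚ (ℚ × ℚ))).toIntAlgHom)
  obtain ⟨c, hc⟩ := IsIntegrallyClosed.isIntegral_iff.1
    (hv.map ((RingHom.snd ℚ ℚ).comp (RingHom.snd ℚ (ℚ × ℚ))).toIntAlgHom)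
  refine ⟨(a, b, c), ?_⟩
  change φ _ = φ v
  congr 1
  exact Prod.ext ha (Prod.ext hb hc)

-- The element e₀ alone forces 9 ∣ f, through the congruence modulo 9.
include hφ in
theorem isLeastMultiplier_range_intTripleHom {Λ : Subalgebra ℤ M}
    (hΛ : ∀ m, m ∈ Λ ↔ ∃ v ∈ gqLattice ℤ 5, φ (castTriple ℤ ℚ v) = m) :
    IsLeastMultiplier (intTripleHom φ).range Λ 9 := by
  refine ⟨⟨by norm_num, ?_⟩, ?_⟩
  · rintro _ ⟨v, rfl⟩
    refine (hΛ _).2 ⟨9 • v, ?_, ?_⟩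
    · exact mem_gqLattice_of_nine_dvd ⟨v.1, by simp⟩ ⟨v.2.1, by simp⟩ ⟨v.2.2, by simp⟩ 5
    · rw [map_nsmul, map_nsmul]
      rfl
  · rintro f ⟨hf, h⟩
    obtain ⟨v, hv, e⟩ := (hΛ _).1 (h _ ⟨(1, 0, 0), rfl⟩)
    have e' : intTripleHom φ v = intTripleHom φ (f • (1, 0, 0)) := by
      rw [map_nsmul]
      exact e
    rw [intTripleHom_injective hφ e'] at hv
    have h9 : ((f : ℤ), (0 : ℤ), (0 : ℤ)) ∈ gqLattice ℤ 5 := by simpa using hv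
    have := (mem_gqLattice_five.1 h9).2
    omega

include hφ hA in
theorem isRelevantPrime_iff {Λ : Subalgebra ℤ M}
    (hΛ : ∀ m, m ∈ Λ ↔ ∃ v ∈ gqLattice ℤ 5, φ (castTriple ℤ ℚ v) = m) (p : ℕ) :
    IsRelevantPrime A Λ p ↔ p = 3 := by
  have hO := isOrderIn_range_intTripleHom hA
  have h9 := isLeastMultiplier_range_intTripleHom hφ hΛ
  constructor
  · rintro ⟨hp, Γ, hΓ, -, h⟩
    have hle := hΓ.prop.le_range_intTripleHom hφ hA
    obtain rfl : Γ = (intTripleHom φ).range := le_antisymm hle (hΓ.le_of_ge hO hle)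
    rcases h with ⟨d, hd, hpd⟩ | ⟨f, hf, hpf⟩
    · rw [isOrderDiscriminant_range_eq_one _ (intTripleHom_injective hφ) hd] at hpd
      exact absurd (Nat.dvd_one.1 (Int.natCast_dvd_natCast.1 hpd)) hp.one_lt.ne'
    · rw [hf.unique h9] at hpf
      exact (Nat.prime_dvd_prime_iff_eq hp Nat.prime_three).1
        (hp.dvd_of_dvd_pow (show p ∣ 3 ^ 2 from hpf))
  · rintro rfl
    refine ⟨Nat.prime_three, (intTripleHom φ).range, ⟨hO, fun Γ hΓ _ => ?_⟩, ?_,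
      Or.inr ⟨9, h9, by norm_num⟩⟩
    · exact hΓ.le_range_intTripleHom hφ hA
    · intro m hm
      obtain ⟨v, -, rfl⟩ := (hΛ m).1 hm
      exact ⟨v, rfl⟩

end RelevantPrimes

/-! ### Lattices over the 3-adic integers -/

section PadicIntegers

theorem padicInt_not_three_dvd_iff (x : ℤ_[3]) : ¬ 3 ∣ x ↔ IsUnit x := by
  have h := PadicInt.norm_lt_one_iff_dvd (p := 3) x
  rw [show (((3 : ℕ) : ℤ_[3])) = 3 by norm_num] at h
  rw [← h, PadicInt.isUnit_iff, not_lt]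
  exact ⟨fun h' => le_antisymm (PadicInt.norm_le_one x) h', fun h' => h'.ge⟩

theorem padicInt_not_three_dvd_one : ¬ (3 : ℤ_[3]) ∣ 1 :=
  (padicInt_not_three_dvd_iff 1).2 isUnit_one

theorem padicInt_not_nine_dvd_three : ¬ (9 : ℤ_[3]) ∣ 3 := by
  rintro ⟨c, hc⟩
  refine padicInt_not_three_dvd_one ⟨c, ?_⟩
  have h3 : (3 : ℤ_[3]) ≠ 0 := by norm_num
  refine mul_left_cancel₀ h3 ?_
  linear_combination hc

theorem padicInt_three_trichotomy (x : ℤ_[3]) : 3 ∣ x ∨ 3 ∣ x - 1 ∨ 3 ∣ x + 1 := by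
  obtain ⟨n, hn, h⟩ := PadicInt.exists_mem_range (p := 3) x
  rw [IsLocalRing.mem_maximalIdeal, mem_nonunits_iff, ← padicInt_not_three_dvd_iff, not_not] at h
  interval_cases n
  · left
    simpa using h
  · right
    left
    simpa using h
  · right
    right
    convert dvd_add h (dvd_refl 3) using 1
    push_cast
    ring

/-- A generator of largest norm divides all the others, since the quotients have norm at most 1. -/
theorem exists_generator_of_fg {P : Submodule ℤ_[3] ℚ_[3]} (hfg : P.FG) (hP : P ≠ ⊥) :
    ∃ a ∈ P, a ≠ 0 ∧ ∀ x ∈ P, ∃ r : ℤ_[3], x = r * a := by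
  obtain ⟨S, rfl⟩ := hfg
  have hS : S.Nonempty := by
    rw [Finset.nonempty_iff_ne_empty]
    rintro rfl
    simp at hP
  obtain ⟨a, haS, ha⟩ := S.exists_max_image (fun x => ‖x‖) hS
  have ha0 : a ≠ 0 := by
    rintro rfl
    refine hP (Submodule.span_eq_bot.2 fun x hx => ?_)
    have := ha x hx
    simpa using this
  refine ⟨a, Submodule.subset_span haS, ha0, fun x hx => ?_⟩
  have hle : Submodule.span ℤ_[3] (S : Set ℚ_[3]) ≤ Submodule.span ℤ_[3] {a} := by
    rw [Submodule.span_le]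
    intro s hs
    have hn : ‖s / a‖ ≤ 1 := by
      rw [norm_div]
      exact div_le_one_of_le₀ (ha s hs) (norm_nonneg a)
    refine Submodule.mem_span_singleton.2 ⟨⟨s / a, hn⟩, ?_⟩
    change s / a * a = s
    rw [div_mul_cancel₀ _ ha0]
  obtain ⟨r, hr⟩ := Submodule.mem_span_singleton.1 (hle hx)
  exact ⟨r, hr.symm⟩

end PadicIntegers

/-! ### The seven lattices as modules over the adjacency algebra, and their homomorphisms. -/

section LatticeModules

variable {R K M : Type*} [CommRing R] [IsDomain R] [CharZero R] [Field K] [Algebra R K] [Ring M]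
  [Algebra R M] [Algebra K M] [IsScalarTower R K M] {φ : K × K × K →ₐ[K] M}
  {A : Subalgebra K M} {Λ : Subalgebra R M}

/-- The full lattice in `M` with coordinates in one of the seven lattices. -/
def latticeModule (hΛ : ∀ m, m ∈ Λ ↔ ∃ v ∈ gqLattice R 5, φ (castTriple R K v) = m) (i : Fin 7) :
    Submodule Λ M where
  carrier := {m | ∃ v ∈ gqLattice R i, φ (castTriple R K v) = m}
  zero_mem' := ⟨0, Submodule.zero_mem _, by simp⟩
  add_mem' := by
    rintro _ _ ⟨v, hv, rfl⟩ ⟨w, hw, rfl⟩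
    exact ⟨v + w, Submodule.add_mem _ hv hw, by simp⟩
  smul_mem' := by
    rintro ⟨c, hc⟩ _ ⟨w, hw, rfl⟩
    obtain ⟨v, hv, rfl⟩ := (hΛ c).1 hc
    exact ⟨v * w, mul_mem_gqLattice_of_five hv hw, by rw [map_mul, map_mul]; rfl⟩

variable (hΛ : ∀ m, m ∈ Λ ↔ ∃ v ∈ gqLattice R 5, φ (castTriple R K v) = m)

theorem map_gqLatticeBasis {B C : Type*} [Ring B] [Ring C] (f : B →+* C) (e : Fin 3 → B)
    (i : Fin 7) (j : Fin 3) : f (gqLatticeBasis e i j) = gqLatticeBasis (fun k => f (e k)) i j := by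
  fin_cases i <;> fin_cases j <;> simp [gqLatticeBasis, map_ofNat f 2, map_ofNat f 3,
    map_ofNat f 6, map_ofNat f 9]

omit [IsDomain R] [CharZero R] in
theorem castTriple_tripleBasis (i : Fin 3) :
    castTriple R K (tripleBasis R i) = tripleBasis K i := by
  fin_cases i <;> simp [castTriple_apply, tripleBasis]

omit [IsDomain R] [CharZero R] in
theorem latticeModule_restrictScalars (i : Fin 7) :
    (latticeModule hΛ i).restrictScalars R = Submodule.span R
      (Set.range (gqLatticeBasis (fun j => φ (tripleBasis K j)) i)) := by
  set ψ : R × R × R →ₐ[R] M := (φ.restrictScalars R).comp (castTriple R K) with hψ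
  have h1 : (latticeModule hΛ i).restrictScalars R = (gqLattice R i).map ψ.toLinearMap := by
    ext m
    exact Iff.rfl
  rw [h1, ← span_gqLatticeBasis_tripleBasis, Submodule.map_span, ← Set.range_comp]
  congr 2
  funext j
  refine (map_gqLatticeBasis (ψ : R × R × R →+* M) _ i j).trans ?_
  congr 1
  funext k
  exact congrArg φ (castTriple_tripleBasis k)

omit [IsDomain R] [CharZero R] [IsScalarTower R K M] in
theorem span_latticeModule (hA : ∀ m, m ∈ A ↔ ∃ v, φ v = m) [CharZero K] (i : Fin 7) :
    Submodule.span K (latticeModule hΛ i : Set M) = Subalgebra.toSubmodule A := by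
  apply le_antisymm
  · rw [Submodule.span_le]
    rintro _ ⟨v, -, rfl⟩
    exact (hA _).2 ⟨_, rfl⟩
  · intro m hm
    obtain ⟨v, rfl⟩ := (hA m).1 hm
    have h9 : (9 : K) ≠ 0 := by norm_num
    have e : v = (v.1 / 9) • castTriple R K (9, 0, 0) + (v.2.1 / 9) • castTriple R K (0, 9, 0) +
        (v.2.2 / 9) • castTriple R K (0, 0, 9) := by
      ext <;> simp [castTriple_apply, map_ofNat (algebraMap R K) 9, h9]
    rw [e, map_add, map_add, map_smul, map_smul, map_smul]
    refine Submodule.add_mem _ (Submodule.add_mem _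
      (Submodule.smul_mem _ _ (Submodule.subset_span ⟨_, ?_, rfl⟩))
      (Submodule.smul_mem _ _ (Submodule.subset_span ⟨_, ?_, rfl⟩)))
      (Submodule.smul_mem _ _ (Submodule.subset_span ⟨_, ?_, rfl⟩))
    · exact mem_gqLattice_of_nine_dvd dvd_rfl (dvd_zero _) (dvd_zero _) i
    · exact mem_gqLattice_of_nine_dvd (dvd_zero _) dvd_rfl (dvd_zero _) i
    · exact mem_gqLattice_of_nine_dvd (dvd_zero _) (dvd_zero _) dvd_rfl i

omit [IsDomain R] [CharZero R] in
theorem isFullLattice_latticeModule (hA : ∀ m, m ∈ A ↔ ∃ v, φ v = m) [CharZero K] (i : Fin 7) :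
    IsFullLattice A Λ (latticeModule hΛ i) where
  fg := by
    rw [latticeModule_restrictScalars]
    exact Submodule.fg_span (Set.finite_range _)
  span_eq := span_latticeModule hΛ hA i

-- Type 6 contains (1,−1,0) but not its square (1,1,0). The other types contain 1 and are closed
-- under products.
omit [IsDomain R] [CharZero R] in
theorem exists_isOrderIn_eq_latticeModule_iff (hφ : Function.Injective φ)
    (hRK : Function.Injective (algebraMap R K)) (h3 : ¬ (3 : R) ∣ 1)
    (hA : ∀ m, m ∈ A ↔ ∃ v, φ v = m) [CharZero K] (i : Fin 7) :
    (∃ Γ : Subalgebra R M, IsOrderIn R A Γ ∧ (Γ : Set M) = latticeModule hΛ i) ↔ i ≠ 6 := by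
  constructor
  · rintro ⟨Γ, -, hΓ⟩ rfl
    have hm : ∀ m, m ∈ Γ ↔ m ∈ latticeModule hΛ 6 := fun m => Set.ext_iff.1 hΓ m
    have h1 : φ (castTriple R K (1, -1, 0)) ∈ Γ :=
      (hm _).2 ⟨_, mem_gqLattice_six.2 (by simp), rfl⟩
    obtain ⟨v, hv, e⟩ := (hm _).1 (Γ.mul_mem h1 h1)
    rw [← map_mul, ← map_mul] at e
    rw [castTriple_injective hRK (hφ e)] at hv
    have h2 : (3 : R) ∣ 1 + 1 := by simpa using mem_gqLattice_six.1 hv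
    refine h3 ?_
    have := dvd_sub (dvd_refl (3 : R)) h2
    norm_num at this
    exact this
  · intro hi
    refine ⟨{ carrier := latticeModule hΛ i
              mul_mem' := ?_
              add_mem' := fun ha hb => Submodule.add_mem _ ha hb
              algebraMap_mem' := ?_ }, ⟨?_, span_latticeModule hΛ hA i⟩, rfl⟩
    · rintro _ _ ⟨v, hv, rfl⟩ ⟨w, hw, rfl⟩
      exact ⟨v * w, mul_mem_gqLattice hi hv hw, by rw [map_mul, map_mul]⟩
    · intro r
      refine ⟨r • 1, Submodule.smul_mem _ _ (one_mem_gqLattice i), ?_⟩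
      rw [map_smul, map_one, ← algebraMap_smul K, map_smul, map_one, algebraMap_smul,
        Algebra.algebraMap_eq_smul_one]
    · exact (isFullLattice_latticeModule hΛ hA i).fg

-- Both 9v and 9 lie in the order, so linearity gives 9v·f(1) = f(9v) = 9f(v). Cancelling 9 shows
-- that f is multiplication by c = f(1).
omit [IsScalarTower R K M] in
theorem exists_mul_of_linearMap_latticeModule (hφ : Function.Injective φ)
    (hRK : Function.Injective (algebraMap R K)) {i j : Fin 7}
    (f : latticeModule hΛ i →ₗ[Λ] latticeModule hΛ j) :
    ∃ c, ∀ v (hv : v ∈ gqLattice R i), v * c ∈ gqLattice R j ∧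
      (f ⟨φ (castTriple R K v), ⟨v, hv, rfl⟩⟩ : M) = φ (castTriple R K (v * c)) := by
  have hinj : Function.Injective fun v => φ (castTriple R K v) :=
    hφ.comp (castTriple_injective hRK)
  obtain ⟨c, hc, hc'⟩ := (f ⟨φ (castTriple R K 1), ⟨1, one_mem_gqLattice i, rfl⟩⟩).2
  refine ⟨c, fun v hv => ?_⟩
  obtain ⟨w, hw, hw'⟩ := (f ⟨φ (castTriple R K v), ⟨v, hv, rfl⟩⟩).2
  have h9 : (9 * v : R × R × R) ∈ gqLattice R 5 :=
    mem_gqLattice_of_nine_dvd (Dvd.intro _ rfl) (Dvd.intro _ rfl) (Dvd.intro _ rfl) 5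
  have h9' : (9 : R × R × R) ∈ gqLattice R 5 :=
    mem_gqLattice_of_nine_dvd dvd_rfl dvd_rfl dvd_rfl 5
  set lam : Λ := ⟨φ (castTriple R K (9 * v)), (hΛ _).2 ⟨_, h9, rfl⟩⟩ with hlam
  set nu : Λ := ⟨φ (castTriple R K 9), (hΛ _).2 ⟨_, h9', rfl⟩⟩ with hnu
  have e : lam • (⟨φ (castTriple R K 1), ⟨1, one_mem_gqLattice i, rfl⟩⟩ : latticeModule hΛ i) =
      nu • ⟨φ (castTriple R K v), ⟨v, hv, rfl⟩⟩ := by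
    refine Subtype.ext ?_
    change φ (castTriple R K (9 * v)) * φ (castTriple R K 1) =
      φ (castTriple R K 9) * φ (castTriple R K v)
    rw [← map_mul, ← map_mul, mul_one, ← map_mul, ← map_mul]
  have e' := congrArg (fun x => (f x : M)) e
  simp only [map_smul] at e'
  have e'' : φ (castTriple R K (9 * v)) * φ (castTriple R K c) =
      φ (castTriple R K 9) * φ (castTriple R K w) := by
    rw [hc', hw']
    exact e'
  rw [← map_mul, ← map_mul, ← map_mul, ← map_mul] at e''
  have h := hinj e''
  have n9 : (9 : R) ≠ 0 := by norm_num
  have hwv : w = v * c := by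
    rw [mul_assoc] at h
    have key : ∀ a b : R, 9 * a = 9 * b → b = a := fun a b h => (mul_left_cancel₀ n9 h).symm
    exact Prod.ext (key _ _ (congrArg Prod.fst h))
      (Prod.ext (key _ _ (congrArg (fun x => x.2.1) h)) (key _ _ (congrArg (fun x => x.2.2) h)))
  rw [hwv] at hw hw'
  exact ⟨hw, hw'.symm⟩

-- The multipliers of f and of its inverse are mutually inverse, so the isomorphism is scaling by a
-- unit of R³.
omit [IsScalarTower R K M] in
theorem eq_of_latticeModule_equiv (hφ : Function.Injective φ)
    (hRK : Function.Injective (algebraMap R K)) (h3 : ¬ (3 : R) ∣ 1) (h9 : ¬ (9 : R) ∣ 3)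
    {i j : Fin 7} (f : latticeModule hΛ i ≃ₗ[Λ] latticeModule hΛ j) : i = j := by
  have hinj : Function.Injective fun v => φ (castTriple R K v) :=
    hφ.comp (castTriple_injective hRK)
  obtain ⟨c, hc⟩ := exists_mul_of_linearMap_latticeModule hΛ hφ hRK f.toLinearMap
  obtain ⟨d, hd⟩ := exists_mul_of_linearMap_latticeModule hΛ hφ hRK f.symm.toLinearMap
  have hcd : c * d = 1 := by
    obtain ⟨h1, h2⟩ := hc 1 (one_mem_gqLattice i)
    have h2' : f ⟨φ (castTriple R K 1), ⟨1, one_mem_gqLattice i, rfl⟩⟩ =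
        ⟨φ (castTriple R K (1 * c)), ⟨_, h1, rfl⟩⟩ := Subtype.ext h2
    have h3 := (hd _ h1).2
    rw [LinearEquiv.coe_coe, ← h2', LinearEquiv.symm_apply_apply, one_mul] at h3
    exact (hinj h3).symm
  refine eq_of_unit_mul_mem_gqLattice_iff h3 h9 ⟨c, d, hcd, by rw [mul_comm, hcd]⟩ fun w =>
    ⟨fun hw => ?_, fun hw => ?_⟩
  · change c * w ∈ _
    rw [mul_comm]
    exact (hc w hw).1
  · have := (hd _ hw).1
    change c * w * d ∈ _ at this
    rwa [mul_right_comm, hcd, one_mul] at this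

end LatticeModules

/-! ### Isomorphism classes of full lattices -/

section PadicLattices

variable {M : Type*} [Ring M] [Algebra ℤ_[3] M] [Algebra ℚ_[3] M] [IsScalarTower ℤ_[3] ℚ_[3] M]
  {φ : ℚ_[3] × ℚ_[3] × ℚ_[3] →ₐ[ℚ_[3]] M} {A : Subalgebra ℚ_[3] M} {Λ : Subalgebra ℤ_[3] M}

omit [IsScalarTower ℤ_[3] ℚ_[3] M] in
theorem IsFullLattice.exists_eq {N : Submodule Λ M} (hN : IsFullLattice A Λ N)
    (hA : ∀ m, m ∈ A ↔ ∃ v, φ v = m) {m : M} (hm : m ∈ N) : ∃ v, φ v = m := by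
  refine (hA m).1 ?_
  change m ∈ Subalgebra.toSubmodule A
  rw [← hN.span_eq]
  exact Submodule.subset_span hm

/-- The values of a non-zero linear functional on a full lattice form a fractional ideal. -/
theorem IsFullLattice.exists_generator {N : Submodule Λ M} (hN : IsFullLattice A Λ N)
    (hφ : Function.Injective φ) (hA : ∀ m, m ∈ A ↔ ∃ v, φ v = m)
    {p : ℚ_[3] × ℚ_[3] × ℚ_[3] →ₗ[ℚ_[3]] ℚ_[3]} (hp : p ≠ 0) :
    ∃ v₀, φ v₀ ∈ N ∧ p v₀ ≠ 0 ∧ ∀ v, φ v ∈ N → ∃ r : ℤ_[3], p v = r * p v₀ := by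
  set H : Submodule ℤ_[3] (ℚ_[3] × ℚ_[3] × ℚ_[3]) :=
    (N.restrictScalars ℤ_[3]).comap (φ.restrictScalars ℤ_[3]).toLinearMap with hH
  have hfg : H.FG := by
    refine Submodule.fg_of_fg_map_injective (φ.restrictScalars ℤ_[3]).toLinearMap hφ ?_
    rw [hH, Submodule.map_comap_eq_of_le]
    · exact hN.fg
    · intro m hm
      exact hN.exists_eq hA hm
  have hbot : H.map (p.restrictScalars ℤ_[3]) ≠ ⊥ := by
    intro h
    refine hp (LinearMap.ext fun v => ?_)
    -- A functional vanishing on N vanishes on its span, which is the whole algebra.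
    have hle : Submodule.span ℚ_[3] (N : Set M) ≤ (LinearMap.ker p).map φ.toLinearMap := by
      rw [Submodule.span_le]
      intro m hm
      obtain ⟨v, rfl⟩ := hN.exists_eq hA hm
      refine ⟨v, ?_, rfl⟩
      have : p v ∈ H.map (p.restrictScalars ℤ_[3]) := ⟨v, hm, rfl⟩
      rw [h] at this
      exact this
    rw [hN.span_eq] at hle
    obtain ⟨w, hw, e⟩ := hle ((hA _).2 ⟨v, rfl⟩)
    rw [← hφ e]
    exact hw
  obtain ⟨_, ⟨v₀, hv₀, rfl⟩, h0, h⟩ := exists_generator_of_fg (hfg.map _) hbot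
  exact ⟨v₀, hv₀, h0, fun v hv => h _ ⟨v, hv, rfl⟩⟩

/-- A full lattice is integral with respect to suitably scaled coordinates, and no coordinate is
divisible by `3` on the whole of it. -/
theorem IsFullLattice.exists_coordinates {N : Submodule Λ M} (hN : IsFullLattice A Λ N)
    (hφ : Function.Injective φ) (hA : ∀ m, m ∈ A ↔ ∃ v, φ v = m) :
    ∃ a : (ℚ_[3] × ℚ_[3] × ℚ_[3])ˣ,
      (∀ v, φ v ∈ N → ∃ w : ℤ_[3] × ℤ_[3] × ℤ_[3], v = a * castTriple ℤ_[3] ℚ_[3] w) ∧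
      (∃ w : ℤ_[3] × ℤ_[3] × ℤ_[3], φ (a * castTriple ℤ_[3] ℚ_[3] w) ∈ N ∧ w.1 = 1) ∧
      (∃ w : ℤ_[3] × ℤ_[3] × ℤ_[3], φ (a * castTriple ℤ_[3] ℚ_[3] w) ∈ N ∧ w.2.1 = 1) ∧
      (∃ w : ℤ_[3] × ℤ_[3] × ℤ_[3], φ (a * castTriple ℤ_[3] ℚ_[3] w) ∈ N ∧ w.2.2 = 1) := by
  obtain ⟨x, hx, hx0, hx'⟩ := hN.exists_generator hφ hA
    (p := LinearMap.fst ℚ_[3] ℚ_[3] (ℚ_[3] × ℚ_[3]))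
    (fun h => one_ne_zero (LinearMap.congr_fun h (1, 0, 0)))
  obtain ⟨y, hy, hy0, hy'⟩ := hN.exists_generator hφ hA
    (p := LinearMap.fst ℚ_[3] ℚ_[3] ℚ_[3] ∘ₗ LinearMap.snd ℚ_[3] ℚ_[3] (ℚ_[3] × ℚ_[3]))
    (fun h => one_ne_zero (LinearMap.congr_fun h (0, 1, 0)))
  obtain ⟨z, hz, hz0, hz'⟩ := hN.exists_generator hφ hA
    (p := LinearMap.snd ℚ_[3] ℚ_[3] ℚ_[3] ∘ₗ LinearMap.snd ℚ_[3] ℚ_[3] (ℚ_[3] × ℚ_[3]))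
    (fun h => one_ne_zero (LinearMap.congr_fun h (0, 0, 1)))
  change x.1 ≠ 0 at hx0
  change y.2.1 ≠ 0 at hy0
  change z.2.2 ≠ 0 at hz0
  obtain ⟨a, ha⟩ : IsUnit (x.1, y.2.1, z.2.2) :=
    Prod.isUnit_iff.2 ⟨hx0.isUnit, Prod.isUnit_iff.2 ⟨hy0.isUnit, hz0.isUnit⟩⟩
  have key : ∀ v, φ v ∈ N → ∃ w : ℤ_[3] × ℤ_[3] × ℤ_[3], v = a * castTriple ℤ_[3] ℚ_[3] w := by
    intro v hv
    obtain ⟨r, hr⟩ := hx' v hv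
    obtain ⟨s, hs⟩ := hy' v hv
    obtain ⟨t, ht⟩ := hz' v hv
    refine ⟨(r, s, t), ?_⟩
    rw [ha]
    refine Prod.ext (hr.trans (mul_comm _ _)) (Prod.ext (hs.trans (mul_comm _ _))
      (ht.trans (mul_comm _ _)))
  have one : ∀ (b : ℚ_[3]) (r : ℤ_[3]), b ≠ 0 → b = b * algebraMap ℤ_[3] ℚ_[3] r → r = 1 := by
    intro b r hb h
    have : algebraMap ℤ_[3] ℚ_[3] r = algebraMap ℤ_[3] ℚ_[3] 1 := by
      rw [map_one]
      exact mul_left_cancel₀ hb (by rw [← h, mul_one])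
    exact FaithfulSMul.algebraMap_injective ℤ_[3] ℚ_[3] this
  refine ⟨a, key, ?_, ?_, ?_⟩
  · obtain ⟨w, hw⟩ := key x hx
    refine ⟨w, hw ▸ hx, one _ _ hx0 ?_⟩
    have := congrArg Prod.fst hw
    rwa [ha] at this
  · obtain ⟨w, hw⟩ := key y hy
    refine ⟨w, hw ▸ hy, one _ _ hy0 ?_⟩
    have := congrArg (fun v => v.2.1) hw
    rwa [ha] at this
  · obtain ⟨w, hw⟩ := key z hz
    refine ⟨w, hw ▸ hz, one _ _ hz0 ?_⟩
    have := congrArg (fun v => v.2.2) hw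
    rwa [ha] at this

/-- Right multiplication by a unit. -/
def unitMulRightEquiv {R M : Type*} [CommRing R] [Ring M] [Algebra R M] (Λ : Subalgebra R M)
    (t : Mˣ) : M ≃ₗ[Λ] M where
  toFun m := m * t
  invFun m := m * (t⁻¹ : Mˣ)
  map_add' m n := add_mul m n _
  map_smul' c m := smul_mul_assoc c m _
  left_inv m := Units.mul_inv_cancel_right m t
  right_inv m := Units.inv_mul_cancel_right m t

theorem IsFullLattice.exists_equiv_latticeModule {N : Submodule Λ M} (hN : IsFullLattice A Λ N)
    (hφ : Function.Injective φ) (hA : ∀ m, m ∈ A ↔ ∃ v, φ v = m)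
    (hΛ : ∀ m, m ∈ Λ ↔ ∃ v ∈ gqLattice ℤ_[3] 5, φ (castTriple ℤ_[3] ℚ_[3] v) = m) :
    ∃ i, Nonempty (N ≃ₗ[Λ] latticeModule hΛ i) := by
  obtain ⟨a, hint, ⟨x, hx, hx1⟩, ⟨y, hy, hy1⟩, ⟨z, hz, hz1⟩⟩ := hN.exists_coordinates hφ hA
  set H : Submodule ℤ_[3] (ℤ_[3] × ℤ_[3] × ℤ_[3]) :=
    (N.restrictScalars ℤ_[3]).comap ((φ.restrictScalars ℤ_[3]).toLinearMap ∘ₗ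
      LinearMap.mulLeft ℤ_[3] (a : ℚ_[3] × ℚ_[3] × ℚ_[3]) ∘ₗ
        (castTriple ℤ_[3] ℚ_[3]).toLinearMap) with hH
  have hmem : ∀ w, w ∈ H ↔ φ (a * castTriple ℤ_[3] ℚ_[3] w) ∈ N := fun _ => Iff.rfl
  have hmul : ∀ c ∈ gqLattice ℤ_[3] 5, ∀ v ∈ H, c * v ∈ H := by
    intro c hc v hv
    have := N.smul_mem ⟨_, (hΛ _).2 ⟨c, hc, rfl⟩⟩ hv
    change φ (castTriple ℤ_[3] ℚ_[3] c) * φ (a * castTriple ℤ_[3] ℚ_[3] v) ∈ N at this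
    rwa [← map_mul, mul_left_comm, ← map_mul] at this
  have h3 := padicInt_not_three_dvd_one
  obtain ⟨u, i, hui⟩ := exists_unit_mul_mem_gqLattice_iff h3 padicInt_three_trichotomy
    (fun x => (padicInt_not_three_dvd_iff x).1) H
    (hmul _ (mem_gqLattice_five.2 (by constructor <;> norm_num)))
    (hmul _ (mem_gqLattice_five.2 (by constructor <;> norm_num)))
    ⟨x, hx, hx1 ▸ h3⟩ ⟨y, hy, hy1 ▸ h3⟩ ⟨z, hz, hz1 ▸ h3⟩
  -- Right multiplication commutes with the left action of Λ even if M is not commutative. The unit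
  -- t removes the scaling by a and applies u.
  set u' : (ℚ_[3] × ℚ_[3] × ℚ_[3])ˣ :=
    Units.map (castTriple ℤ_[3] ℚ_[3] : ℤ_[3] × ℤ_[3] × ℤ_[3] →* ℚ_[3] × ℚ_[3] × ℚ_[3]) u
  set t : Mˣ := Units.map (φ : ℚ_[3] × ℚ_[3] × ℚ_[3] →* M) (u' * a⁻¹)
  have ht : ∀ w, φ (a * castTriple ℤ_[3] ℚ_[3] w) * t =
      φ (castTriple ℤ_[3] ℚ_[3] (u * w)) := by
    intro w
    change φ _ * φ (castTriple ℤ_[3] ℚ_[3] u * (a⁻¹ : (ℚ_[3] × ℚ_[3] × ℚ_[3])ˣ)) = _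
    rw [← map_mul, map_mul (castTriple ℤ_[3] ℚ_[3])]
    congr 1
    have := a.mul_inv
    linear_combination (castTriple ℤ_[3] ℚ_[3] w * castTriple ℤ_[3] ℚ_[3] u) * this
  refine ⟨i, ⟨((unitMulRightEquiv Λ t).submoduleMap N).trans (LinearEquiv.ofEq _ _ ?_)⟩⟩
  ext m
  constructor
  · rintro ⟨n, hn, rfl⟩
    obtain ⟨v, rfl⟩ := hN.exists_eq hA hn
    obtain ⟨w, rfl⟩ := hint v hn
    exact ⟨u * w, (hui w).1 hn, (ht w).symm⟩
  · rintro ⟨v, hv, rfl⟩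
    refine ⟨φ (a * castTriple ℤ_[3] ℚ_[3] ((u⁻¹ : (ℤ_[3] × ℤ_[3] × ℤ_[3])ˣ) * v)), ?_, ?_⟩
    · refine (hui _).2 ?_
      rwa [Units.mul_inv_cancel_left]
    · refine (ht _).trans ?_
      rw [Units.mul_inv_cancel_left]

theorem existsUnique_equiv_latticeModule {N : Submodule Λ M} (hN : IsFullLattice A Λ N)
    (hφ : Function.Injective φ) (hA : ∀ m, m ∈ A ↔ ∃ v, φ v = m)
    (hΛ : ∀ m, m ∈ Λ ↔ ∃ v ∈ gqLattice ℤ_[3] 5, φ (castTriple ℤ_[3] ℚ_[3] v) = m) :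
    ∃! i, Nonempty (N ≃ₗ[Λ] latticeModule hΛ i) := by
  obtain ⟨i, ⟨f⟩⟩ := hN.exists_equiv_latticeModule hφ hA hΛ
  refine ⟨i, ⟨f⟩, ?_⟩
  rintro j ⟨g⟩
  exact eq_of_latticeModule_equiv hΛ hφ (FaithfulSMul.algebraMap_injective _ _)
    padicInt_not_three_dvd_one padicInt_not_nine_dvd_three (g.symm.trans f)

end PadicLattices

/-! ### The integral adjacency algebra -/

section Main

variable {P L : Type*} [Fintype P] [DecidableEq P] {I : P → L → Prop}
  (hI : IsGeneralizedQuadrangle I 2 1)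

/-- Over a field of characteristic zero 3 and 9 are units, so the congruences are void. -/
theorem mem_gq_adjacencyAlgebra_self_iff (K : Type*) [Field K] [CharZero K] (m : Matrix P P K) :
    m ∈ hI.associationScheme.adjacencyAlgebra K K ↔ ∃ v, gqHom hI K v = m := by
  rw [mem_gq_adjacencyAlgebra_iff]
  have h3 : IsUnit (3 : K) := isUnit_iff_ne_zero.2 (by norm_num)
  have h9 : IsUnit (9 : K) := isUnit_iff_ne_zero.2 (by norm_num)
  exact ⟨fun ⟨v, _, h⟩ => ⟨v, h⟩, fun ⟨v, h⟩ => ⟨v, mem_gqLattice_five.2 ⟨h3.dvd, h9.dvd⟩, h⟩⟩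

/-- The coordinates with respect to `e₀, e₁, e₂` embed the integral adjacency algebra into
`ℤ × ℤ × ℤ`. -/
theorem exists_ringHom_gq_adjacencyAlgebra :
    ∃ g : hI.associationScheme.adjacencyAlgebra ℤ ℚ →+* ℤ × ℤ × ℤ,
      Function.Injective g ∧ ∀ v, v ∈ gqLattice ℤ 5 ↔ ∃ x, g x = v := by
  set ψ := intTripleHom (gqHom hI ℚ) with hψ
  have hinj : Function.Injective ψ := intTripleHom_injective (gqHom_injective hI ℚ)
  have hmem := mem_gq_adjacencyAlgebra_iff hI ℚ ℤ
  have hle : hI.associationScheme.adjacencyAlgebra ℤ ℚ ≤ ψ.range := by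
    intro m hm
    obtain ⟨v, -, rfl⟩ := (hmem m).1 hm
    exact ⟨v, rfl⟩
  set σ := AlgEquiv.ofInjective ψ hinj
  have hσ : ∀ x, ψ (σ.symm x) = x := fun x => congrArg Subtype.val (σ.apply_symm_apply x)
  refine ⟨((σ.symm : ψ.range →ₐ[ℤ] ℤ × ℤ × ℤ).comp (Subalgebra.inclusion hle)).toRingHom,
    σ.symm.injective.comp (Subalgebra.inclusion_injective hle), fun v => ⟨fun hv => ?_, ?_⟩⟩
  · refine ⟨⟨ψ v, (hmem _).2 ⟨v, hv, rfl⟩⟩, hinj ?_⟩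
    exact hσ _
  · rintro ⟨x, rfl⟩
    obtain ⟨v, hv, e⟩ := (hmem x).1 x.2
    convert hv
    refine hinj ((hσ _).trans ?_)
    exact e.symm

end Main

end

theorem theorem4p2 {P L : Type*} [Fintype P] [DecidableEq P] (I : P → L → Prop)
    (hI : IsGeneralizedQuadrangle I 2 1) :
    -- `ℤ𝐁` has rank 3, with the adjacency matrices as a basis
    LinearIndependent ℤ (hI.associationScheme.adjMatrix ℚ) ∧
    -- the zeta function of `ℤ𝐁`
    (∀ s : ℂ, 1 < s.re →
      Summable (solomonTerm (hI.associationScheme.adjacencyAlgebra ℤ ℚ)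
        (hI.associationScheme.adjacencyAlgebra ℤ ℚ) s) ∧
      solomonZeta (hI.associationScheme.adjacencyAlgebra ℤ ℚ)
        (hI.associationScheme.adjacencyAlgebra ℤ ℚ) s =
      ((3 : ℂ) ^ (3 - 6 * s) - 2 * (3 : ℂ) ^ (2 - 5 * s) + 4 * (3 : ℂ) ^ (1 - 4 * s) +
        (3 : ℂ) ^ (1 - 3 * s) + 4 * (3 : ℂ) ^ (-2 * s) - 2 * (3 : ℂ) ^ (-s) + 1) *
        riemannZeta s ^ 3) ∧
    -- the only relevant prime is 3
    (∀ p : ℕ, IsRelevantPrime (hI.associationScheme.adjacencyAlgebra ℚ ℚ)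
      (hI.associationScheme.adjacencyAlgebra ℤ ℚ) p ↔ p = 3) ∧
    -- the seven isomorphism classes of full `ℤ_3 𝐁`-lattices in `ℚ_3 𝐁`: all representatives
    -- but the last one are orders
    ∃ N : Fin 7 → Submodule (hI.associationScheme.adjacencyAlgebra ℤ_[3] ℚ_[3])
        (Matrix P P ℚ_[3]),
      (∀ i, (N i).restrictScalars ℤ_[3] = Submodule.span ℤ_[3]
        (Set.range (gqLatticeBasis (gqIdempotent hI.associationScheme ℚ_[3]) i))) ∧
      (∀ i, IsFullLattice (hI.associationScheme.adjacencyAlgebra ℚ_[3] ℚ_[3])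
        (hI.associationScheme.adjacencyAlgebra ℤ_[3] ℚ_[3]) (N i)) ∧
      (∀ N' : Submodule (hI.associationScheme.adjacencyAlgebra ℤ_[3] ℚ_[3])
          (Matrix P P ℚ_[3]),
        IsFullLattice (hI.associationScheme.adjacencyAlgebra ℚ_[3] ℚ_[3])
          (hI.associationScheme.adjacencyAlgebra ℤ_[3] ℚ_[3]) N' →
        ∃! i, Nonempty
          (N' ≃ₗ[hI.associationScheme.adjacencyAlgebra ℤ_[3] ℚ_[3]] N i)) ∧
      (∀ i, (∃ Γ : Subalgebra ℤ_[3] (Matrix P P ℚ_[3]),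
          IsOrderIn ℤ_[3] (hI.associationScheme.adjacencyAlgebra ℚ_[3] ℚ_[3]) Γ ∧
          (Γ : Set (Matrix P P ℚ_[3])) = N i) ↔ i ≠ 6) := by
  have hZ := mem_gq_adjacencyAlgebra_iff hI ℚ ℤ
  have hΛ := mem_gq_adjacencyAlgebra_iff hI ℚ_[3] ℤ_[3]
  have hA := mem_gq_adjacencyAlgebra_self_iff hI ℚ_[3]
  have hφ := gqHom_injective hI ℚ_[3]
  have hR := FaithfulSMul.algebraMap_injective ℤ_[3] ℚ_[3]
  refine ⟨hI.associationScheme.linearIndependent_adjMatrix ℤ ℚ Int.cast_injective,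
    fun s hs => ?_, isRelevantPrime_iff (gqHom_injective hI ℚ)
      (mem_gq_adjacencyAlgebra_self_iff hI ℚ) hZ, latticeModule hΛ, fun i => ?_,
    isFullLattice_latticeModule hΛ hA,
    fun N' hN' => existsUnique_equiv_latticeModule hN' hφ hA hΛ,
    exists_isOrderIn_eq_latticeModule_iff hΛ hφ hR padicInt_not_three_dvd_one hA⟩
  · obtain ⟨g, hg, hg'⟩ := exists_ringHom_gq_adjacencyAlgebra hI
    have h := hasSum_solomonTerm g hg hg' hs
    refine ⟨h.summable, h.tsum_eq.trans ?_⟩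
    rw [gqEulerFactor_eq]
  · rw [latticeModule_restrictScalars, funext (gqHom_tripleBasis hI ℚ_[3])]
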